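/- **Theorem (lower bound on the worst-case detection delay).** *Model.* Time is divided into slots $k=1,2,\dots$. In each slot, independently, a sensor takes a sample with probability $r$; $A_k\in\{0,1\}$ indicates a sample (packet) in slot $k$. Packets join a FIFO queue. $Q_k$ is the queue length at the beginning of slot $k$. If $Q_k=0$ there is no transmission and $Y_k=\emptyset$; if $Q_k>0$ the head-of-line packet is transmitted, successfully ($Y_k=1$) or not ($Y_k=0$), independently of everything else, and it is retransmitted until it is delivered. Thus $Q_{k+1}=(Q_k-\mathbf 1\{Y_k=1\})^+ + A_k$. $Z_k$ is the value of the packet delivered in slot $k$ if $Y_k=1$, and $Z_k=*$ otherwise. Under $\mathbb P_\nu$ ($\nu\in\{0,1,2,\dots\}\cup\{\infty\}$) the success probability is $p_0$ in slots $k\le\nu$ and $p_1$ in slots $k>\nu$; the sample values are independent of each other and of the sampling and the channel, with law $f_0$ if sampled in a slot $\le\nu$ (packets already queued at the start included) and $f_1$ if sampled in a slot $>\nu$. Here $f_0,f_1$ are probability measures on an arbitrary measurable space. Assume $0<r<\min\{p_0,p_1\}$, with $p_0,p_1\le 1$, and that $Q_1$ has, under every $\mathbb P_\nu$, the stationary law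 of the pre-change queue (arrival probability $r$, success probability $p_0$) and is independent of the rest. Let $D(p_1\|p_0)$ be the Kullback–Leibler divergence of the Bernoulli law with parameter $p_1$ from that with parameter $p_0$, and $D(f_1\|f_0)$ that of $f_1$ from $f_0$. Assume that both are finite and that $f_0\neq f_1$ or $p_0\ne p_1$. *Quantities.* Let $\zeta_k=(Q_k,Y_k,Z_k)$, $\mathcal G_t=\sigma(Q_1,\zeta_1,\dots,\zeta_t)$ and $\mathcal F_t=\sigma(Q_1,(Y_k,Z_k),1\le k\le t)$. Let $\ell_{0,n}$ be the log-likelihood ratio of $\mathbb P_0$ against $\mathbb P_\infty$ on $\mathcal G_n$. For $\mathcal H\in\{\mathcal G,\mathcal F\}$ and an $\mathcal H$-stopping time $T$, possibly infinite, put $$\overline{\mathbb E}^{\mathcal H}_1[T]=\sup_{\nu\ge1}\operatorname{ess\,sup}\ \mathbb E_\nu\big[(T-\nu+1)^+\mid\mathcal H_{\nu-1}\big],$$ where the essential supremum is taken under $\mathbb P_\nu$. *Claim.* 1. With $$I=r\Big(\tfrac1{p_1}D(p_1\|p_0)+D(f_1\|f_0)\Big),$$ one has $\frac1n\ell_{0,n}\to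 I$ as $n\to\infty$, $\mathbb P_0$-almost surely. 2. For the augmented observations $\mathcal H=\mathcal G$, and also for $\mathcal H=\mathcal F$, as $\gamma\to\infty$, $$\inf\big\{\overline{\mathbb E}^{\mathcal H}_1[T] : T \text{ an } \mathcal H\text{-stopping time},\ \mathbb E_\infty[T]\ge\gamma\big\}\ \ge\ \big(I^{-1}+o(1)\big)\log\gamma .$$ -/

import Mathlib

open MeasureTheory ProbabilityTheory InformationTheory Filter Topology
open scoped ENNReal unitInterval

namespace NetQCD

/-- What happens on the channel in a slot: no transmission (the queue is empty), an unsuccessful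
transmission, or a successful one. This is the value of `Y_k`. -/
inductive Outcome where
  | idle
  | failure
  | success
  deriving DecidableEq

instance : MeasurableSpace Outcome := ⊤

instance : DiscreteMeasurableSpace Outcome := ⟨fun _ => trivial⟩

/-- The data of the system: sampling rate `r`, success probabilities `p₀`, `p₁` of the channel
before and after the change, measurement laws `f₀`, `f₁` before and after the change, and the law
`π` of the queue length `Q₁` at the beginning of slot `1`. -/
structure Model (E : Type*) [MeasurableSpace E] where
  r : I
  p₀ : I
  p₁ : I
  f₀ : ProbabilityMeasure E
  f₁ : ProbabilityMeasure E
  π : ProbabilityMeasure ℕ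

/-- The sample space. A point consists of
* the initial queue length `Q₁`,
* the values of the packets waiting in the queue at the beginning of slot `1`
  (packets are numbered `1, 2, …`; entry `j` is read only for `1 ≤ j ≤ Q₁`),
* for each slot `k ≥ 1`: whether a sample is taken in slot `k`, whether an attempt in slot `k`
  would get through the channel, and the value that a sample taken in slot `k` has.
Entries with index `0` are never read. -/
abbrev Path (E : Type*) := ℕ × (ℕ → E) × (ℕ → Bool × Bool × E)

section Dynamics

variable {E : Type*}

/-- `A_k`: the number (`0` or `1`) of packets that arrive in slot `k`. -/
def arrival (ω : Path E) (k : ℕ) : ℕ := if (ω.2.2 k).1 = true then 1 else 0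

/-- Outcome of a slot with queue length `q`, where an attempt would succeed iff `c = true`. -/
def outcomeOf (q : ℕ) (c : Bool) : Outcome :=
  if q = 0 then .idle else if c = true then .success else .failure

/-- The number of packets delivered in a slot. -/
def delivered (y : Outcome) : ℕ := if y = .success then 1 else 0

/-- `Q_k`, `k ≥ 1`: queue length at the beginning of slot `k`,
`Q_{k+1} = (Q_k - Y_k)⁺ + A_k`. The value at `k = 0` is a dummy. -/
def queue (ω : Path E) : ℕ → ℕ
  | 0 => ω.1
  | 1 => ω.1
  | k + 2 =>
      queue ω (k + 1) - delivered (outcomeOf (queue ω (k + 1)) (ω.2.2 (k + 1)).2.1)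
        + arrival ω (k + 1)

/-- `Y_k`: outcome of slot `k`. -/
def outcome (ω : Path E) (k : ℕ) : Outcome := outcomeOf (queue ω k) (ω.2.2 k).2.1

/-- `D_k`: number of the last packet delivered up to the end of slot `k`. As packets are delivered
in order, this is the number of deliveries in slots `1, …, k`. -/
def lastDelivered (ω : Path E) (k : ℕ) : ℕ := ∑ i ∈ Finset.Icc 1 k, delivered (outcome ω i)

/-- The slot of the `m`-th arrival after the start, `m ≥ 1`: the first slot `s` such that `m`
packets have arrived in slots `1, …, s`. -/
noncomputable def arrivalSlot (ω : Path E) (m : ℕ) : ℕ :=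
  sInf {s | m ≤ ∑ i ∈ Finset.Icc 1 s, arrival ω i}

/-- `X_j`: value of the packet with number `j ≥ 1`. -/
noncomputable def packetValue (ω : Path E) (j : ℕ) : E :=
  if j ≤ ω.1 then ω.2.1 j else (ω.2.2 (arrivalSlot ω (j - ω.1))).2.2

/-- `Z_k`: the measurement received in slot `k`, where `Sum.inr ()` stands for `*`. -/
noncomputable def received (ω : Path E) (k : ℕ) : E ⊕ Unit :=
  if outcome ω k = .success then Sum.inl (packetValue ω (lastDelivered ω k)) else Sum.inr ()

end Dynamics

section Measurability

variable {E : Type*} [MeasurableSpace E]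

lemma measurable_arrival (k : ℕ) : Measurable fun ω : Path E => arrival ω k :=
  (Measurable.of_discrete (f := fun b : Bool => if b = true then 1 else 0)).comp
    (by fun_prop : Measurable fun ω : Path E => (ω.2.2 k).1)

lemma measurable_outcomeOf {g : Path E → ℕ} (hg : Measurable g) (k : ℕ) :
    Measurable fun ω : Path E => outcomeOf (g ω) (ω.2.2 k).2.1 :=
  (Measurable.of_discrete (f := fun x : ℕ × Bool => outcomeOf x.1 x.2)).comp
    (by fun_prop : Measurable fun ω : Path E => (g ω, (ω.2.2 k).2.1))

lemma measurable_queue : ∀ k : ℕ, Measurable fun ω : Path E => queue ω k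
  | 0 => measurable_fst
  | 1 => measurable_fst
  | k + 2 =>
      ((measurable_queue (k + 1)).sub ((Measurable.of_discrete (f := delivered)).comp
        (measurable_outcomeOf (measurable_queue (k + 1)) (k + 1)))).add (measurable_arrival (k + 1))

lemma measurable_outcome (k : ℕ) : Measurable fun ω : Path E => outcome ω k :=
  measurable_outcomeOf (measurable_queue k) k

lemma measurable_lastDelivered (k : ℕ) : Measurable fun ω : Path E => lastDelivered ω k :=
  Finset.measurable_sum _ fun i _ =>
    (Measurable.of_discrete (f := delivered)).comp (measurable_outcome i)

lemma measurable_arrivalSlot (m : ℕ) : Measurable fun ω : Path E => arrivalSlot ω m := by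
  have hS : ∀ s : ℕ, MeasurableSet {ω : Path E | m ≤ ∑ i ∈ Finset.Icc 1 s, arrival ω i} := fun s =>
    measurableSet_le measurable_const (Finset.measurable_sum _ fun i _ => measurable_arrival i)
  refine measurable_of_Iic fun s => ?_
  have : (fun ω : Path E => arrivalSlot ω m) ⁻¹' Set.Iic s =
      (⋃ t ∈ Finset.range (s + 1), {ω : Path E | m ≤ ∑ i ∈ Finset.Icc 1 t, arrival ω i}) ∪
        ⋂ t : ℕ, {ω : Path E | m ≤ ∑ i ∈ Finset.Icc 1 t, arrival ω i}ᶜ := by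
    ext ω
    simp only [Set.mem_preimage, Set.mem_Iic, Set.mem_union, Set.mem_iUnion, Finset.mem_range,
      Set.mem_ofPred_eq, Set.mem_iInter, Set.mem_compl_iff, exists_prop]
    constructor
    · intro h
      by_cases hne : {t | m ≤ ∑ i ∈ Finset.Icc 1 t, arrival ω i}.Nonempty
      · exact Or.inl ⟨_, Nat.lt_succ_of_le h, Nat.sInf_mem hne⟩
      · exact Or.inr fun t ht => hne ⟨t, ht⟩
    · rintro (⟨t, ht, h⟩ | h)
      · exact (Nat.sInf_le (s := {t | m ≤ ∑ i ∈ Finset.Icc 1 t, arrival ω i}) h).trans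
          (Nat.le_of_lt_succ ht)
      · have : {t | m ≤ ∑ i ∈ Finset.Icc 1 t, arrival ω i} = ∅ :=
          Set.eq_empty_of_forall_notMem h
        simp [arrivalSlot, this]
  rw [this]
  exact (Finset.measurableSet_biUnion _ fun t _ => hS t).union
    (MeasurableSet.iInter fun t => (hS t).compl)

lemma measurable_packetValue : Measurable fun x : Path E × ℕ => packetValue x.1 x.2 := by
  refine measurable_from_prod_countable_left fun j => ?_
  refine Measurable.ite (measurableSet_le measurable_const measurable_fst)
    ((measurable_pi_apply j).comp (measurable_fst.comp measurable_snd)) ?_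
  have h1 : Measurable fun x : Path E × ℕ => (x.1.2.2 x.2).2.2 :=
    measurable_from_prod_countable_left fun s =>
      measurable_snd.comp (measurable_snd.comp ((measurable_pi_apply s).comp
        (measurable_snd.comp measurable_snd)))
  have h2 : Measurable fun x : Path E × ℕ => arrivalSlot x.1 x.2 :=
    measurable_from_prod_countable_left fun m => measurable_arrivalSlot m
  have h3 : Measurable fun ω : Path E => arrivalSlot ω (j - ω.1) :=
    h2.comp (measurable_id.prodMk (measurable_const.sub measurable_fst))
  exact h1.comp (measurable_id.prodMk h3)

lemma measurable_received (k : ℕ) : Measurable fun ω : Path E => received ω k := by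
  refine Measurable.ite (measurable_outcome k (MeasurableSet.of_discrete (s := {Outcome.success})))
    (measurable_inl.comp (measurable_packetValue.comp
      (measurable_id.prodMk (measurable_lastDelivered k)))) measurable_const

end Measurability

section Filtrations

variable (E : Type*) [MeasurableSpace E]

/-- `𝓕_t = σ(Q₁, (Y_k, Z_k), 1 ≤ k ≤ t)`: the observations at the decision maker. -/
noncomputable def obsFiltration : Filtration ℕ (inferInstance : MeasurableSpace (Path E)) where
  seq t := MeasurableSpace.comap (fun ω : Path E => queue ω 1) inferInstance ⊔
    ⨆ k ∈ Set.Icc 1 t, MeasurableSpace.comap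
      (fun ω : Path E => (outcome ω k, received ω k)) inferInstance
  mono' _ _ hst := sup_le_sup le_rfl (biSup_mono fun _ hk => ⟨hk.1, hk.2.trans hst⟩)
  le' _ := sup_le (measurable_queue 1).comap_le (iSup₂_le fun k _ =>
    ((measurable_outcome k).prodMk (measurable_received k)).comap_le)

/-- `𝓖_t = σ(Q₁, ζ_k, 1 ≤ k ≤ t)` with `ζ_k = (Q_k, Y_k, Z_k)`: the augmented observations. -/
noncomputable def augFiltration : Filtration ℕ (inferInstance : MeasurableSpace (Path E)) where
  seq t := MeasurableSpace.comap (fun ω : Path E => queue ω 1) inferInstance ⊔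
    ⨆ k ∈ Set.Icc 1 t, MeasurableSpace.comap
      (fun ω : Path E => (queue ω k, outcome ω k, received ω k)) inferInstance
  mono' _ _ hst := sup_le_sup le_rfl (biSup_mono fun _ hk => ⟨hk.1, hk.2.trans hst⟩)
  le' _ := sup_le (measurable_queue 1).comap_le (iSup₂_le fun k _ =>
    ((measurable_queue k).prodMk
      ((measurable_outcome k).prodMk (measurable_received k))).comap_le)

end Filtrations

namespace Model

variable {E : Type*} [MeasurableSpace E] (M : Model E)

/-- Law of (sampling indicator, channel state, sample value) in slot `k` when the change occurs at
the end of slot `ν`; the three are independent. -/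
noncomputable def slotLaw (ν : ℕ∞) (k : ℕ) : Measure (Bool × Bool × E) :=
  if (k : ℕ∞) ≤ ν then
    (bernoulliMeasure true false M.r).prod
      ((bernoulliMeasure true false M.p₀).prod (M.f₀ : Measure E))
  else
    (bernoulliMeasure true false M.r).prod
      ((bernoulliMeasure true false M.p₁).prod (M.f₁ : Measure E))

instance (ν : ℕ∞) (k : ℕ) : IsProbabilityMeasure (M.slotLaw ν k) := by
  unfold slotLaw
  split_ifs <;> infer_instance

/-- `ℙ_ν`: the change occurs at the end of slot `ν`. Everything is independent; packets queued
before slot `1` have law `f₀`. `ν = ⊤` is the law without a change, and `ν = 0` the law under which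
all slots `k ≥ 1` are post-change. -/
noncomputable def law (ν : ℕ∞) : Measure (Path E) :=
  (M.π : Measure ℕ).prod
    ((Measure.infinitePi fun _ : ℕ => (M.f₀ : Measure E)).prod (Measure.infinitePi (M.slotLaw ν)))

/-- The system is in steady state at the start: the law of `Q₁` is invariant under the pre-change
queue dynamics, that is, `Q₂` has the same law as `Q₁` when there is no change. -/
def IsSteadyState : Prop :=
  (M.law ⊤).map (fun ω => queue ω 2) = (M.π : Measure ℕ)

/-- Kullback-Leibler divergence of the post-change from the pre-change channel. -/
noncomputable def channelDiv : ℝ≥0∞ :=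
  klDiv (bernoulliMeasure true false M.p₁) (bernoulliMeasure true false M.p₀)

/-- Kullback-Leibler divergence of the post-change from the pre-change measurement law. -/
noncomputable def sampleDiv : ℝ≥0∞ := klDiv (M.f₁ : Measure E) (M.f₀ : Measure E)

/-- The information number `I = r (D(p₁‖p₀) / p₁ + D(f₁‖f₀))`. -/
noncomputable def infoNumber : ℝ :=
  (M.r : ℝ) * (M.channelDiv.toReal / (M.p₁ : ℝ) + M.sampleDiv.toReal)

/-- `ℓ_{ν,n}`: log-likelihood ratio of `ℙ_ν` against `ℙ_∞` for the augmented observations up to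
slot `n`. (`Q₁` has the same law under both, so this is also the ratio given `Q₁`.) -/
noncomputable def logLR (ν : ℕ∞) (n : ℕ) : Path E → ℝ :=
  @llr _ (augFiltration E n) ((M.law ν).trim ((augFiltration E).le n))
    ((M.law ⊤).trim ((augFiltration E).le n))

/-- Lorden's worst-case average detection delay of `T`,
`sup_{ν ≥ 1} ess sup 𝔼_ν[(T - ν + 1)⁺ | 𝓗_{ν-1}]`, for the observation filtration `𝓗`. -/
noncomputable def worstDelay (𝓗 : Filtration ℕ (inferInstance : MeasurableSpace (Path E)))
    (T : Path E → ℕ∞) : ℝ≥0∞ :=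
  ⨆ (ν : ℕ) (_ : 1 ≤ ν), essSup
    (condLExp (𝓗 (ν - 1)) (M.law ν) fun ω => ((T ω + 1 - (ν : ℕ∞) : ℕ∞) : ℝ≥0∞)) (M.law ν)

/-- `𝓒_γ`: stopping times of `𝓗`, possibly infinite, with `𝔼_∞[T] ≥ γ`. -/
def admissible (𝓗 : Filtration ℕ (inferInstance : MeasurableSpace (Path E))) (γ : ℝ) :
    Set (Path E → ℕ∞) :=
  {T | IsStoppingTime 𝓗 T ∧ ENNReal.ofReal γ ≤ ∫⁻ ω, ((T ω : ℕ∞) : ℝ≥0∞) ∂(M.law ⊤)}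

end Model

end NetQCD

/-! Likelihood ratio. By the end of slot `n` the augmented observations reveal the channel state
exactly in the slots with a nonempty queue, and the sample value exactly for the delivered packets;
the sampling law does not change. So the ratio of `ℙ_ν` against `ℙ_∞` is `obsLR`: one channel factor
for each busy slot after `ν`, and one sample factor for each delivered sample taken after `ν`. Which
coordinates are revealed is itself random. The proof of `lintegral_law` decomposes along the
finitely many values of the two sets of slots; on each cell the unrevealed coordinates are erased,
after which it does not matter whether their law is pre- or post-change.

Growth rate. Under `ℙ_0` the queue is stable because `r < p₁`, so `Q_n = o(n)` and packets are
delivered at rate `r`. A busy slot delivers with probability `p₁`, hence busy slots have frequency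
`r / p₁`. By FIFO the delivered samples are those taken up to some slot `κ`, with `κ / n → 1`. Laws
of large numbers for the two kinds of factors then give `r / p₁ · D(p₁‖p₀) + r · D(f₁‖f₀) = I`
(`tendsto_log_obsLR`, `tendsto_logLR`).

Delay. Take a window of `m ≈ a log γ` slots with `a < 1 / I`. If `𝔼_∞[T] ≥ γ`, a pigeonhole argument
finds an event of the past on which `T` has not occurred and whose conditional probability under
`ℙ_∞` of stopping within the next `m` slots is below `ε`, of order `m / γ` (`exists_quiet_slot`).
Put the change there. Under `ℙ_ν` the conditional probability of stopping in the window is at most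
`c ε` plus the probability that the likelihood ratio exceeds `c` (`law_inter_obsLR_le`,
`law_inter_obsLR_gt`). With `c = exp((I + η)(m - 1))` and `(I + η) a < 1` the first term vanishes as
`γ → ∞`, and the second vanishes by the growth rate. So the delay is at least `m (1 - o(1))`
(`le_worstDelay`).

The second term has to be small uniformly in the queue length at the change. For this reason the
change is placed only just after idle slots: the queue is then at most `2`, which leaves finitely
many initial conditions, and idleness is visible in `𝓕` as well as in `𝓖`, so one argument serves
both. The price is that the pigeonhole runs over idle slots, so `𝔼_∞[T]` must be bounded through the
expected number of idle slots before `T`. Summing the queue drift `r - p₀ + p₀ 1{idle}` up to `T`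
gives `(p₀ - r) 𝔼_∞[T] ≤ 𝔼[Q₁] + p₀ 𝔼_∞[#idle slots up to T]` (`mul_lintegral_le`), and `𝔼[Q₁]` is
finite because the stationary tail is geometric. -/

namespace NetQCD

/-! ### Combinatorics of paths: arrivals, deliveries, observational equivalence -/

section Paths

variable {E : Type*}

/-- The number of arrivals in slots `1, …, n`. -/
def arrivalCount (ω : Path E) (n : ℕ) : ℕ := ∑ i ∈ Finset.Icc 1 n, arrival ω i

@[simp] lemma arrivalCount_zero (ω : Path E) : arrivalCount ω 0 = 0 := rfl

lemma arrivalCount_succ (ω : Path E) (n : ℕ) :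
    arrivalCount ω (n + 1) = arrivalCount ω n + arrival ω (n + 1) :=
  Finset.sum_Icc_succ_top (by omega) _

lemma arrivalCount_mono (ω : Path E) : Monotone (arrivalCount ω) :=
  monotone_nat_of_le_succ fun n => by rw [arrivalCount_succ]; omega

@[simp] lemma lastDelivered_zero (ω : Path E) : lastDelivered ω 0 = 0 := rfl

lemma lastDelivered_succ (ω : Path E) (n : ℕ) :
    lastDelivered ω (n + 1) = lastDelivered ω n + delivered (outcome ω (n + 1)) :=
  Finset.sum_Icc_succ_top (by omega) _

lemma lastDelivered_mono (ω : Path E) : Monotone (lastDelivered ω) :=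
  monotone_nat_of_le_succ fun n => by rw [lastDelivered_succ]; omega

lemma arrival_le_one (ω : Path E) (k : ℕ) : arrival ω k ≤ 1 := by
  unfold arrival; split_ifs <;> omega

lemma arrival_eq_one_iff {ω : Path E} {k : ℕ} : arrival ω k = 1 ↔ (ω.2.2 k).1 = true := by
  unfold arrival; split_ifs <;> simp_all

lemma delivered_outcomeOf_le (q : ℕ) (c : Bool) : delivered (outcomeOf q c) ≤ q := by
  unfold outcomeOf delivered; split_ifs <;> (simp_all; try omega)

lemma delivered_outcomeOf (q : ℕ) (c : Bool) :
    delivered (outcomeOf q c) = if q ≠ 0 ∧ c = true then 1 else 0 := by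
  unfold outcomeOf delivered; split_ifs <;> simp_all

lemma queue_succ (ω : Path E) (n : ℕ) :
    queue ω (n + 2) =
      queue ω (n + 1) - delivered (outcome ω (n + 1)) + arrival ω (n + 1) := rfl

/-- Conservation of packets. -/
lemma lastDelivered_add_queue (ω : Path E) (n : ℕ) :
    lastDelivered ω n + queue ω (n + 1) = ω.1 + arrivalCount ω n := by
  induction n with
  | zero => simp [queue]
  | succ n ih =>
    have := delivered_outcomeOf_le (queue ω (n + 1)) (ω.2.2 (n + 1)).2.1
    rw [lastDelivered_succ, arrivalCount_succ, queue_succ]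
    unfold outcome
    omega

/-- The count grows by at most one per slot, so its first passage above `m` hits `m` exactly. The
witness `t` excludes the default value `sInf ∅ = 0`. -/
lemma arrivalSlot_spec {ω : Path E} {m t : ℕ} (hm : 1 ≤ m) (ht : m ≤ arrivalCount ω t) :
    1 ≤ arrivalSlot ω m ∧ arrivalSlot ω m ≤ t ∧ arrivalCount ω (arrivalSlot ω m) = m ∧
      arrival ω (arrivalSlot ω m) = 1 := by
  have hne : {s | m ≤ ∑ i ∈ Finset.Icc 1 s, arrival ω i}.Nonempty := ⟨t, ht⟩
  have h1 : m ≤ arrivalCount ω (arrivalSlot ω m) := Nat.sInf_mem hne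
  have h2 : arrivalSlot ω m ≤ t := Nat.sInf_le ht
  obtain ⟨s, hs⟩ : ∃ s, arrivalSlot ω m = s + 1 := by
    refine Nat.exists_eq_succ_of_ne_zero fun h => ?_
    rw [h] at h1; simp at h1; omega
  have h3 : ¬ m ≤ arrivalCount ω s := fun h => by
    have : arrivalSlot ω m ≤ s := Nat.sInf_le h
    omega
  have h4 := arrivalCount_succ ω s
  have h5 := arrival_le_one ω (s + 1)
  rw [hs] at h1 ⊢
  omega

lemma arrivalSlot_arrivalCount {ω : Path E} {s : ℕ} (hs : 1 ≤ s) (h : arrival ω s = 1) :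
    arrivalSlot ω (arrivalCount ω s) = s := by
  obtain ⟨s, rfl⟩ := Nat.exists_eq_add_of_le' hs
  have h4 := arrivalCount_succ ω s
  obtain ⟨h1, h2, h3, h5⟩ :=
    arrivalSlot_spec (ω := ω) (m := arrivalCount ω (s + 1)) (t := s + 1) (by omega) le_rfl
  refine le_antisymm h2 (not_lt.1 fun hlt => ?_)
  have := arrivalCount_mono ω (Nat.le_of_lt_succ hlt)
  omega

/-- The slots in `(ν, n]` whose channel state is observed. -/
def busySlots (ν n : ℕ) (ω : Path E) : Finset ℕ :=
  (Finset.Icc (ν + 1) n).filter fun k => queue ω k ≠ 0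

/-- The slots in `(ν, n]` in which a sample was taken that is delivered by the end of slot `n`. -/
def deliveredSlots (ν n : ℕ) (ω : Path E) : Finset ℕ :=
  (Finset.Icc (ν + 1) n).filter fun k =>
    (ω.2.2 k).1 = true ∧ ω.1 + arrivalCount ω k ≤ lastDelivered ω n

/-- `ω'` agrees with `ω` on everything that happens up to slot `min ν n`, and in slots `(ν, n]` on
everything that is observed by the end of slot `n`. -/
structure Agree (ν n : ℕ) (ω ω' : Path E) : Prop where
  init : ω.1 = ω'.1
  waiting : ω.2.1 = ω'.2.1
  pre : ∀ k, k ≤ ν → k ≤ n → ω.2.2 k = ω'.2.2 k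
  sampling : ∀ k, k ≤ n → (ω.2.2 k).1 = (ω'.2.2 k).1
  channel : ∀ k ∈ busySlots ν n ω, (ω.2.2 k).2.1 = (ω'.2.2 k).2.1
  value : ∀ k ∈ deliveredSlots ν n ω, (ω.2.2 k).2.2 = (ω'.2.2 k).2.2

namespace Agree

variable {ν n : ℕ} {ω ω' : Path E}

lemma outcome_of_queue (h : Agree ν n ω ω') {k : ℕ} (hk : k ≤ n)
    (hq : queue ω k = queue ω' k) : outcome ω k = outcome ω' k := by
  unfold outcome
  rw [← hq]
  by_cases h0 : queue ω k = 0
  · simp [outcomeOf, h0]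
  · rcases le_or_gt k ν with h1 | h1
    · rw [h.pre k h1 hk]
    · rw [h.channel k (by simp [busySlots]; omega)]

lemma arrival (h : Agree ν n ω ω') {k : ℕ} (hk : k ≤ n) :
    NetQCD.arrival ω k = NetQCD.arrival ω' k := by
  unfold NetQCD.arrival; rw [h.sampling k hk]

lemma queue (h : Agree ν n ω ω') : ∀ k ≤ n + 1, queue ω k = queue ω' k
  | 0, _ => h.init
  | 1, _ => h.init
  | k + 2, hk => by
    rw [queue_succ, queue_succ, h.queue (k + 1) (by omega),
      h.outcome_of_queue (k := k + 1) (by omega) (h.queue (k + 1) (by omega)),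
      h.arrival (k := k + 1) (by omega)]

lemma outcome (h : Agree ν n ω ω') {k : ℕ} (hk : k ≤ n) :
    NetQCD.outcome ω k = NetQCD.outcome ω' k :=
  h.outcome_of_queue hk (h.queue k (by omega))

lemma lastDelivered (h : Agree ν n ω ω') {k : ℕ} (hk : k ≤ n) :
    NetQCD.lastDelivered ω k = NetQCD.lastDelivered ω' k :=
  Finset.sum_congr rfl fun i hi => by rw [h.outcome ((Finset.mem_Icc.1 hi).2.trans hk)]

lemma arrivalCount (h : Agree ν n ω ω') {k : ℕ} (hk : k ≤ n) :
    NetQCD.arrivalCount ω k = NetQCD.arrivalCount ω' k :=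
  Finset.sum_congr rfl fun _ hi => h.arrival ((Finset.mem_Icc.1 hi).2.trans hk)

lemma busySlots (h : Agree ν n ω ω') : busySlots ν n ω = busySlots ν n ω' :=
  Finset.filter_congr fun k hk => by rw [h.queue k (by simp at hk; omega)]

lemma deliveredSlots (h : Agree ν n ω ω') : deliveredSlots ν n ω = deliveredSlots ν n ω' :=
  Finset.filter_congr fun k hk => by
    have hk := (Finset.mem_Icc.1 hk).2
    rw [h.sampling k hk, h.init, h.arrivalCount hk, h.lastDelivered le_rfl]

/-- A packet delivered by slot `n` was waiting at the start, or was sampled by slot `ν`, or was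
sampled in one of the `deliveredSlots`; `Agree` fixes its value in each case. Its sampling slot is
the same on both paths because the arrivals coincide. -/
lemma received (h : Agree ν n ω ω') {k : ℕ} (hk : k ≤ n) :
    NetQCD.received ω k = NetQCD.received ω' k := by
  unfold NetQCD.received
  rw [← h.outcome hk, ← h.lastDelivered hk]
  split_ifs with hs
  swap; · rfl
  congr 1
  unfold packetValue
  rw [← h.init]
  split_ifs with hD
  · rw [h.waiting]
  have hle : NetQCD.lastDelivered ω k ≤ ω.1 + NetQCD.arrivalCount ω k := by
    have := lastDelivered_add_queue ω k; omega
  obtain ⟨s1, s2, s3, s4⟩ := arrivalSlot_spec (ω := ω)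
    (m := NetQCD.lastDelivered ω k - ω.1) (t := k) (by omega) (by omega)
  set s := arrivalSlot ω (NetQCD.lastDelivered ω k - ω.1) with hsdef
  have hs' : arrivalSlot ω' (NetQCD.lastDelivered ω k - ω.1) = s := by
    rw [← s3, h.arrivalCount (by omega)]
    exact arrivalSlot_arrivalCount s1 (by rw [← h.arrival (by omega)]; exact s4)
  rw [hs']
  rcases le_or_gt s ν with hν | hν
  · rw [h.pre s hν (by omega)]
  · refine h.value s ?_
    have := lastDelivered_mono ω hk
    simp only [NetQCD.deliveredSlots, Finset.mem_filter, Finset.mem_Icc]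
    exact ⟨by omega, arrival_eq_one_iff.1 s4, by omega⟩

end Agree

/-- With `ν = n` there are no slots after the change, and `Agree n n` becomes the relation used
below to say that an event depends on the past only. -/
lemma agree_of_eq_upTo {n : ℕ} {ω ω' : Path E} (h1 : ω.1 = ω'.1) (h2 : ω.2.1 = ω'.2.1)
    (h3 : ∀ k ≤ n, ω.2.2 k = ω'.2.2 k) : Agree n n ω ω' where
  init := h1
  waiting := h2
  pre k hk _ := h3 k hk
  sampling k hk := by rw [h3 k hk]
  channel k hk := by simp [busySlots] at hk
  value k hk := by simp [deliveredSlots] at hk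

end Paths

/-! ### Observed events are invariant under observational equivalence -/

section Measurability

variable {E : Type*} [MeasurableSpace E]

lemma mem_iff_of_agree {ν n : ℕ} {ω ω' : Path E} (h : Agree ν n ω ω') {B : Set (Path E)}
    (hB : MeasurableSet[augFiltration E n] B) : ω ∈ B ↔ ω' ∈ B := by
  let O : Path E → ℕ × (Set.Icc 1 n → ℕ × Outcome × (E ⊕ Unit)) := fun ω =>
    (queue ω 1, fun k => (queue ω k, outcome ω k, received ω k))
  have hle : augFiltration E n ≤ MeasurableSpace.comap O inferInstance := by
    refine sup_le ?_ (iSup₂_le fun k hk => ?_)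
    · rw [← measurable_iff_comap_le]
      exact (comap_measurable O).fst
    · rw [← measurable_iff_comap_le]
      exact (measurable_pi_apply (⟨k, hk⟩ : Set.Icc 1 n)).comp (comap_measurable O).snd
  obtain ⟨B', -, rfl⟩ := hle _ hB
  have : O ω = O ω' := by
    refine Prod.ext (h.queue 1 (by omega)) (funext fun k => ?_)
    have h2 := k.2.2
    exact Prod.ext (h.queue k (by omega)) (Prod.ext (h.outcome h2) (h.received h2))
  simp only [Set.mem_preimage, this]

lemma measurable_arrivalCount (k : ℕ) : Measurable fun ω : Path E => arrivalCount ω k :=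
  Finset.measurable_sum _ fun i _ => measurable_arrival i

lemma measurableSet_busySlots_eq (ν n : ℕ) (S : Finset ℕ) :
    MeasurableSet {ω : Path E | busySlots ν n ω = S} := by
  simp only [Finset.ext_iff, busySlots, Finset.mem_filter]
  rw [Set.ofPred_forall]
  refine MeasurableSet.iInter fun k => ?_
  have h : MeasurableSet {ω : Path E | queue ω k ≠ 0} :=
    measurable_queue k (MeasurableSet.of_discrete (s := {0}ᶜ))
  exact ((MeasurableSet.const _).inter h).iff (MeasurableSet.const _)

lemma measurableSet_deliveredSlots_eq (ν n : ℕ) (S : Finset ℕ) :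
    MeasurableSet {ω : Path E | deliveredSlots ν n ω = S} := by
  simp only [Finset.ext_iff, deliveredSlots, Finset.mem_filter]
  rw [Set.ofPred_forall]
  refine MeasurableSet.iInter fun k => ?_
  have h1 : MeasurableSet {ω : Path E | (ω.2.2 k).1 = true} :=
    (by fun_prop : Measurable fun ω : Path E => (ω.2.2 k).1) (MeasurableSet.of_discrete (s := {true}))
  have h2 : MeasurableSet {ω : Path E | ω.1 + arrivalCount ω k ≤ lastDelivered ω n} :=
    measurableSet_le (measurable_fst.add (measurable_arrivalCount k)) (measurable_lastDelivered n)
  exact ((MeasurableSet.const _).inter (h1.inter h2)).iff (MeasurableSet.const _)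

end Measurability

end NetQCD

/-! ### Densities of infinite product measures -/

section ProductDensity

variable {ι : Type*} {X : ι → Type*} [∀ i, MeasurableSpace (X i)]

/-- Changing finitely many factors of a product measure by densities. -/
lemma infinitePi_withDensity (μ : ∀ i, Measure (X i)) [∀ i, IsProbabilityMeasure (μ i)]
    (w : ∀ i, X i → ℝ≥0∞) (hw : ∀ i, Measurable (w i))
    [∀ i, IsProbabilityMeasure ((μ i).withDensity (w i))] (s : Finset ι)
    (hs : ∀ i, i ∉ s → w i = 1) :
    Measure.infinitePi (fun i => (μ i).withDensity (w i)) =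
      (Measure.infinitePi μ).withDensity fun x => ∏ i ∈ s, w i (x i) := by
  classical
  refine (Measure.eq_infinitePi _ fun t A hA => ?_).symm
  have hbox : MeasurableSet (Set.pi (t : Set ι) A) :=
    MeasurableSet.pi t.countable_toSet fun i _ => hA i
  rw [withDensity_apply _ hbox, ← lintegral_indicator hbox]
  -- The factor `v i` absorbs both the density and the constraint `A i`, so the integrand is a
  -- product of independent factors. Those outside `t` integrate to `1`, since `w i` is a
  -- probability density.
  let v : ∀ i, X i → ℝ≥0∞ := fun i => if i ∈ t then (A i).indicator (w i) else w i
  have hv : ∀ i, Measurable (v i) := fun i => by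
    simp only [v]; split_ifs
    · exact (hw i).indicator (hA i)
    · exact hw i
  have key : ∀ x : ∀ i, X i, (Set.pi (t : Set ι) A).indicator (fun x => ∏ i ∈ s, w i (x i)) x =
      ∏ i ∈ s ∪ t, v i (x i) := fun x => by
    by_cases hx : x ∈ Set.pi (t : Set ι) A
    · rw [Set.indicator_of_mem hx]
      rw [Finset.prod_subset (f := fun i => w i (x i)) (Finset.subset_union_left (s₂ := t))
        (fun i _ hi => by rw [hs i hi]; rfl)]
      refine Finset.prod_congr rfl fun i _ => ?_
      by_cases hi : i ∈ t
      · simp [v, hi, Set.indicator_of_mem (hx i hi)]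
      · simp [v, hi]
    · rw [Set.indicator_of_notMem hx]
      obtain ⟨i, hi, hxi⟩ : ∃ i ∈ t, x i ∉ A i := by simpa [Set.mem_pi] using hx
      exact (Finset.prod_eq_zero (Finset.mem_union_right s hi) (by simp [v, hi, hxi])).symm
  simp_rw [key]
  have hprod := lintegral_prod_eq_prod_lintegral_of_indepFun (s ∪ t)
    (fun i (x : ∀ i, X i) => v i (x i)) (iIndepFun_infinitePi (P := μ) hv)
    (fun i => (hv i).comp (measurable_pi_apply i))
  rw [hprod]
  rw [← Finset.prod_subset (Finset.subset_union_right (s₁ := s) (s₂ := t))]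
  · refine Finset.prod_congr rfl fun i hi => ?_
    rw [← lintegral_map (μ := Measure.infinitePi μ) (hv i) (measurable_pi_apply i),
      Measure.infinitePi_map_eval]
    simp only [v, hi, if_true]
    rw [lintegral_indicator (hA i), withDensity_apply _ (hA i)]
  · intro i _ hi
    rw [← lintegral_map (μ := Measure.infinitePi μ) (hv i) (measurable_pi_apply i),
      Measure.infinitePi_map_eval]
    simp only [v, hi, if_false]
    have := measure_univ (μ := (μ i).withDensity (w i))
    rwa [withDensity_apply _ .univ, Measure.restrict_univ] at this

end ProductDensity

/-! ### Change of measure on the observations -/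

namespace NetQCD

namespace Model

variable {E : Type*} [MeasurableSpace E] (M : Model E)

/-- Law of the path for arbitrary slot laws. -/
noncomputable def pathLaw (μ : ℕ → Measure (Bool × Bool × E)) [∀ k, IsProbabilityMeasure (μ k)] :
    Measure (Path E) :=
  (M.π : Measure ℕ).prod
    ((Measure.infinitePi fun _ : ℕ => (M.f₀ : Measure E)).prod (Measure.infinitePi μ))

instance (μ : ℕ → Measure (Bool × Bool × E)) [∀ k, IsProbabilityMeasure (μ k)] :
    IsProbabilityMeasure (M.pathLaw μ) := by unfold pathLaw; infer_instance

lemma law_eq_pathLaw (ν : ℕ∞) : M.law ν = M.pathLaw (M.slotLaw ν) := rfl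

instance (ν : ℕ∞) : IsProbabilityMeasure (M.law ν) := by rw [law_eq_pathLaw]; infer_instance

/-- The law of a slot in which the channel (the sample) is post-change iff `c` (iff `x`). -/
noncomputable def mixedLaw (c x : Bool) : Measure (Bool × Bool × E) :=
  (bernoulliMeasure true false M.r).prod
    ((bernoulliMeasure true false (if c then M.p₁ else M.p₀)).prod
      ((if x then M.f₁ else M.f₀ : ProbabilityMeasure E) : Measure E))

instance (c x : Bool) : IsProbabilityMeasure (M.mixedLaw c x) := by
  unfold mixedLaw; infer_instance

/-- Likelihood ratio of one channel observation. -/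
noncomputable def channelLR : Bool → ℝ≥0∞ :=
  (bernoulliMeasure true false M.p₁).rnDeriv (bernoulliMeasure true false M.p₀)

/-- Likelihood ratio of one sample. -/
noncomputable def sampleLR : E → ℝ≥0∞ := (M.f₁ : Measure E).rnDeriv (M.f₀ : Measure E)

lemma measurable_channelLR : Measurable M.channelLR := Measure.measurable_rnDeriv _ _

lemma measurable_sampleLR : Measurable M.sampleLR := Measure.measurable_rnDeriv _ _

/-- Likelihood ratio of a slot with respect to the pre-change law. -/
noncomputable def slotLR (c x : Bool) (s : Bool × Bool × E) : ℝ≥0∞ :=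
  (if c then M.channelLR s.2.1 else 1) * (if x then M.sampleLR s.2.2 else 1)

lemma measurable_slotLR (c x : Bool) : Measurable (M.slotLR c x) := by
  have h1 : Measurable fun s : Bool × Bool × E => M.channelLR s.2.1 :=
    M.measurable_channelLR.comp (by fun_prop)
  have h2 : Measurable fun s : Bool × Bool × E => M.sampleLR s.2.2 :=
    M.measurable_sampleLR.comp (by fun_prop)
  unfold slotLR
  cases c <;> cases x <;> simp <;> fun_prop

variable {M}

lemma mixedLaw_eq_withDensity (hsample : M.sampleDiv ≠ ⊤) (hchannel : M.channelDiv ≠ ⊤)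
    (c x : Bool) :
    M.mixedLaw c x = (M.mixedLaw false false).withDensity (M.slotLR c x) := by
  have hc := Measure.withDensity_rnDeriv_eq _ _ (klDiv_ne_top_iff.1 hchannel).1
  have hx := Measure.withDensity_rnDeriv_eq _ _ (klDiv_ne_top_iff.1 hsample).1
  have h1 : bernoulliMeasure true false (if c then M.p₁ else M.p₀) =
      (bernoulliMeasure true false M.p₀).withDensity
        (fun b => if c then M.channelLR b else 1) := by
    cases c
    · simp only [Bool.false_eq_true, if_false]; exact withDensity_one.symm
    · simpa only [if_true] using! hc.symm
  have h2 : ((if x then M.f₁ else M.f₀ : ProbabilityMeasure E) : Measure E) =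
      (M.f₀ : Measure E).withDensity (fun b => if x then M.sampleLR b else 1) := by
    cases x
    · simp only [Bool.false_eq_true, if_false]; exact withDensity_one.symm
    · simpa only [if_true] using! hx.symm
  have m1 : Measurable fun b => if c then M.channelLR b else 1 := .of_discrete
  have m2 : Measurable fun b => if x then M.sampleLR b else 1 := by
    have := M.measurable_sampleLR
    cases x
    · simp
    · simpa using this
  have i1 : SFinite ((bernoulliMeasure true false M.p₀).withDensity
      (fun b => if c then M.channelLR b else 1)) := by rw [← h1]; infer_instance
  have i2 : SFinite ((M.f₀ : Measure E).withDensity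
      (fun b => if x then M.sampleLR b else 1)) := by rw [← h2]; infer_instance
  unfold mixedLaw
  have m3 : Measurable fun z : Bool × E =>
      (if c then M.channelLR z.1 else 1) * if x then M.sampleLR z.2 else 1 :=
    (m1.comp measurable_fst).mul (m2.comp measurable_snd)
  rw [h1, h2, prod_withDensity m1 m2, prod_withDensity_right m3]
  rfl

lemma pathLaw_withDensity (μ : ℕ → Measure (Bool × Bool × E)) [∀ k, IsProbabilityMeasure (μ k)]
    {f : (ℕ → Bool × Bool × E) → ℝ≥0∞} (hf : Measurable f)
    (μ' : ℕ → Measure (Bool × Bool × E)) [∀ k, IsProbabilityMeasure (μ' k)]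
    (h : Measure.infinitePi μ' = (Measure.infinitePi μ).withDensity f) :
    M.pathLaw μ' = (M.pathLaw μ).withDensity fun ω => f ω.2.2 := by
  have i1 : SFinite ((Measure.infinitePi μ).withDensity f) := by rw [← h]; infer_instance
  unfold pathLaw
  rw [h, prod_withDensity_right hf]
  have i2 : SFinite ((((Measure.infinitePi fun _ : ℕ => (M.f₀ : Measure E))).prod
    (Measure.infinitePi μ)).withDensity fun z => f z.2) := by
    rw [← prod_withDensity_right hf]; infer_instance
  rw [prod_withDensity_right (by fun_prop)]

/-- The likelihood ratio of the channel states in the slots of `C` and the sample values in the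
slots of `X`. -/
noncomputable def partialLR (M : Model E) (C X : Finset ℕ) (ω : Path E) : ℝ≥0∞ :=
  (∏ k ∈ C, M.channelLR (ω.2.2 k).2.1) * ∏ k ∈ X, M.sampleLR (ω.2.2 k).2.2

lemma measurable_partialLR (C X : Finset ℕ) : Measurable (M.partialLR C X) := by
  refine (Finset.measurable_prod _ fun k _ => M.measurable_channelLR.comp ?_).mul
    (Finset.measurable_prod _ fun k _ => M.measurable_sampleLR.comp ?_) <;> fun_prop

lemma slotLaw_eq_mixedLaw (ν : ℕ∞) (k : ℕ) :
    M.slotLaw ν k = M.mixedLaw (decide (¬ (k : ℕ∞) ≤ ν)) (decide (¬ (k : ℕ∞) ≤ ν)) := by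
  unfold slotLaw mixedLaw
  by_cases h : (k : ℕ∞) ≤ ν <;> simp [h]

/-- Here `C` and `X` are deterministic, so this is a product of one-slot densities. Finite
divergence enters through the absolute continuity of the post-change laws. -/
lemma pathLaw_mixedLaw (hsample : M.sampleDiv ≠ ⊤) (hchannel : M.channelDiv ≠ ⊤)
    (C X : Finset ℕ) :
    M.pathLaw (fun k => M.mixedLaw (decide (k ∈ C)) (decide (k ∈ X))) =
      (M.law ⊤).withDensity (M.partialLR C X) := by
  have h := mixedLaw_eq_withDensity hsample hchannel
  have i1 : ∀ k : ℕ, IsProbabilityMeasure ((M.mixedLaw false false).withDensity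
      (M.slotLR (decide (k ∈ C)) (decide (k ∈ X)))) := fun k => by rw [← h]; infer_instance
  have h0 : M.slotLaw ⊤ = fun _ => M.mixedLaw false false := by
    funext k; rw [slotLaw_eq_mixedLaw]; simp
  have h1 := infinitePi_withDensity (fun _ : ℕ => M.mixedLaw false false)
    (fun k => M.slotLR (decide (k ∈ C)) (decide (k ∈ X))) (fun k => M.measurable_slotLR _ _)
    (C ∪ X) (fun k hk => by
      funext s
      simp only [Finset.mem_union, not_or] at hk
      simp [slotLR, hk.1, hk.2])
  simp_rw [← h] at h1
  rw [law_eq_pathLaw]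
  simp_rw [h0]
  rw [pathLaw_withDensity _ _ _ h1]
  · congr 1
    funext ω
    simp only [slotLR, partialLR, Finset.prod_mul_distrib, decide_eq_true_eq]
    simp only [Finset.prod_ite_mem, Finset.union_inter_cancel_left, Finset.union_inter_cancel_right]
  · exact Finset.measurable_prod _ fun k _ => (M.measurable_slotLR _ _).comp (measurable_pi_apply k)

/-- Forget, after slot `ν`, the channel states outside `C` and the sample values outside `X`. -/
noncomputable def mask (ν : ℕ) (C X : Finset ℕ) (e : E) (ω : Path E) : Path E :=
  (ω.1, ω.2.1, fun k => if k ≤ ν then ω.2.2 k else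
    ((ω.2.2 k).1, if k ∈ C then (ω.2.2 k).2.1 else true, if k ∈ X then (ω.2.2 k).2.2 else e))

lemma measurable_mask_slot (ν : ℕ) (C X : Finset ℕ) (e : E) (k : ℕ) :
    Measurable fun s : Bool × Bool × E => if k ≤ ν then s else
      (s.1, if k ∈ C then s.2.1 else true, if k ∈ X then s.2.2 else e) := by
  split_ifs <;> fun_prop

lemma measurable_mask (ν : ℕ) (C X : Finset ℕ) (e : E) : Measurable (mask ν C X e) := by
  refine measurable_fst.prodMk ((measurable_fst.comp measurable_snd).prodMk
    (measurable_pi_lambda _ fun k => ?_))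
  exact (measurable_mask_slot ν C X e k).comp
    ((measurable_pi_apply k).comp (measurable_snd.comp measurable_snd))

lemma map_mask_pathLaw (ν : ℕ) (C X : Finset ℕ) (e : E) (μ : ℕ → Measure (Bool × Bool × E))
    [∀ k, IsProbabilityMeasure (μ k)] :
    (M.pathLaw μ).map (mask ν C X e) =
      (M.π : Measure ℕ).prod ((Measure.infinitePi fun _ : ℕ => (M.f₀ : Measure E)).prod
        ((Measure.infinitePi μ).map fun x k => if k ≤ ν then x k else
          ((x k).1, if k ∈ C then (x k).2.1 else true, if k ∈ X then (x k).2.2 else e))) := by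
  have hm : Measurable fun (x : ℕ → Bool × Bool × E) k => if k ≤ ν then x k else
      ((x k).1, if k ∈ C then (x k).2.1 else true, if k ∈ X then (x k).2.2 else e) :=
    measurable_pi_lambda _ fun k => (measurable_mask_slot ν C X e k).comp (measurable_pi_apply k)
  conv_rhs => rw [← Measure.map_id (μ := (Measure.infinitePi fun _ : ℕ => (M.f₀ : Measure E))),
    Measure.map_prod_map _ _ measurable_id hm, ← Measure.map_id (μ := (M.π : Measure ℕ)),
    Measure.map_prod_map _ _ measurable_id (measurable_id.prodMap hm)]
  rfl

/-- An erased coordinate is constant whatever its law was, a kept one in `C` or `X` is post-change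
under both laws, and up to `ν` both laws are pre-change. The sampling indicators have the same law
throughout. -/
lemma map_mask_law (ν : ℕ) {C X : Finset ℕ} (hC : ∀ k ∈ C, ν < k) (hX : ∀ k ∈ X, ν < k) (e : E) :
    (M.law ν).map (mask ν C X e) =
      (M.pathLaw (fun k => M.mixedLaw (decide (k ∈ C)) (decide (k ∈ X)))).map (mask ν C X e) := by
  rw [law_eq_pathLaw, map_mask_pathLaw, map_mask_pathLaw,
    Measure.infinitePi_map_pi _ (measurable_mask_slot ν C X e),
    Measure.infinitePi_map_pi _ (measurable_mask_slot ν C X e)]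
  congr 3
  funext k
  rw [slotLaw_eq_mixedLaw]
  by_cases hk : k ≤ ν
  · have h1 : k ∉ C := fun h => by have := hC k h; omega
    have h2 : k ∉ X := fun h => by have := hX k h; omega
    simp [hk, h1, h2]
  · have hk' : ¬ (k : ℕ∞) ≤ ν := by simpa using hk
    simp only [hk, hk', if_false, decide_not, decide_false, Bool.not_false]
    have m1 : Measurable fun b : Bool => if k ∈ C then b else true := .of_discrete
    have m2 : Measurable fun b : E => if k ∈ X then b else e := by split_ifs <;> fun_prop
    have key : ∀ c x : Bool, (k ∈ C → c = true) → (k ∈ X → x = true) →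
        (M.mixedLaw c x).map (fun s => (s.1, if k ∈ C then s.2.1 else true,
          if k ∈ X then s.2.2 else e)) =
        (bernoulliMeasure true false M.r).prod
          (((bernoulliMeasure true false M.p₁).map fun b : Bool => if k ∈ C then b else true).prod
            ((M.f₁ : Measure E).map fun b : E => if k ∈ X then b else e)) := by
      intro c x hc hx
      unfold mixedLaw
      have e1 : (bernoulliMeasure true false M.p₁).map (fun b : Bool => if k ∈ C then b else true) =
        (bernoulliMeasure true false (if c then M.p₁ else M.p₀)).map
          (fun b : Bool => if k ∈ C then b else true) := by
        by_cases h : k ∈ C <;> simp [h, hc]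
      have e2 : (M.f₁ : Measure E).map (fun b : E => if k ∈ X then b else e) =
        ((if x then M.f₁ else M.f₀ : ProbabilityMeasure E) : Measure E).map
          (fun b : E => if k ∈ X then b else e) := by
        by_cases h : k ∈ X <;> simp [h, hx, Measure.map_const]
      rw [e1, e2, Measure.map_prod_map _ _ m1 m2]
      conv_rhs => rw [← Measure.map_id (μ := bernoulliMeasure true false M.r),
        Measure.map_prod_map _ _ measurable_id (m1.prodMap m2)]
      rfl
    rw [key _ _ (by simp) (by simp), key _ _ (by simp) (by simp)]

/-- Likelihood ratio of `ℙ_ν` against `ℙ_∞` for the augmented observations up to slot `n`. -/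
noncomputable def obsLR (M : Model E) (ν n : ℕ) (ω : Path E) : ℝ≥0∞ :=
  M.partialLR (busySlots ν n ω) (deliveredSlots ν n ω) ω

omit [MeasurableSpace E] in
lemma agree_mask {ν n : ℕ} {C X : Finset ℕ} (e : E) {ω : Path E}
    (hC : busySlots ν n ω ⊆ C) (hX : deliveredSlots ν n ω ⊆ X) :
    Agree ν n ω (mask ν C X e ω) where
  init := rfl
  waiting := rfl
  pre k hk _ := by simp [mask, hk]
  sampling k hk := by simp only [mask]; split_ifs <;> rfl
  channel k hk := by simp only [mask, hC hk, if_true]; split_ifs <;> rfl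
  value k hk := by simp only [mask, hX hk, if_true]; split_ifs <;> rfl

omit [MeasurableSpace E] in
-- The converse direction is needed because membership in a cell must be read off from the masked
-- path alone.
lemma agree_mask' {ν n : ℕ} {C X : Finset ℕ} (e : E) {ω : Path E}
    (hC : busySlots ν n (mask ν C X e ω) ⊆ C) (hX : deliveredSlots ν n (mask ν C X e ω) ⊆ X) :
    Agree ν n (mask ν C X e ω) ω where
  init := rfl
  waiting := rfl
  pre k hk _ := by simp [mask, hk]
  sampling k hk := by simp only [mask]; split_ifs <;> rfl
  channel k hk := by simp only [mask, hC hk, if_true]; split_ifs <;> rfl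
  value k hk := by simp only [mask, hX hk, if_true]; split_ifs <;> rfl

/-- Change of measure for functionals of what is observed by the end of slot `n`. -/
lemma lintegral_law (hsample : M.sampleDiv ≠ ⊤) (hchannel : M.channelDiv ≠ ⊤) (ν n : ℕ)
    {F : Path E → ℝ≥0∞} (hF : Measurable F) (hF' : ∀ ω ω', Agree ν n ω ω' → F ω = F ω') :
    ∫⁻ ω, F ω ∂M.law ν = ∫⁻ ω, M.obsLR ν n ω * F ω ∂M.law ⊤ := by
  classical
  have : Nonempty E := (M.f₀ : Measure E).nonempty_of_neZero
  obtain ⟨e⟩ := this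
  let P : Finset (Finset ℕ × Finset ℕ) :=
    (Finset.Icc (ν + 1) n).powerset ×ˢ (Finset.Icc (ν + 1) n).powerset
  let G : Finset ℕ × Finset ℕ → Set (Path E) := fun S =>
    {ω | busySlots ν n ω = S.1} ∩ {ω | deliveredSlots ν n ω = S.2}
  have hG : ∀ S, MeasurableSet (G S) := fun S =>
    (measurableSet_busySlots_eq ν n S.1).inter (measurableSet_deliveredSlots_eq ν n S.2)
  have split : ∀ f : Path E → ℝ≥0∞, ∀ ω, f ω = ∑ S ∈ P, (G S).indicator f ω := by
    intro f ω
    rw [Finset.sum_eq_single (busySlots ν n ω, deliveredSlots ν n ω)]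
    · rw [Set.indicator_of_mem (by simp [G])]
    · rintro S - hS
      refine Set.indicator_of_notMem (fun h => hS ?_) _
      have h1 : busySlots ν n ω = S.1 := h.1
      have h2 : deliveredSlots ν n ω = S.2 := h.2
      rw [h1, h2]
    · intro h
      exact absurd (by simp [P, busySlots, deliveredSlots]) h
  rw [lintegral_congr (split F), lintegral_congr (split fun ω => M.obsLR ν n ω * F ω),
    lintegral_finsetSum' _ fun S _ => (hF.indicator (hG S)).aemeasurable]
  have hobs : ∀ S, (G S).indicator (fun ω => M.obsLR ν n ω * F ω) =
      (G S).indicator fun ω => M.partialLR S.1 S.2 ω * F ω := fun S => by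
    refine Set.indicator_congr fun ω hω => ?_
    unfold obsLR
    rw [hω.1, hω.2]
  simp_rw [hobs]
  rw [lintegral_finsetSum' P (f := fun S => (G S).indicator fun ω => M.partialLR S.1 S.2 ω * F ω)
    fun S _ => (((measurable_partialLR S.1 S.2).mul hF).indicator (hG S)).aemeasurable]
  refine Finset.sum_congr rfl fun S hS => ?_
  obtain ⟨h1, h2⟩ := Finset.mem_product.1 hS
  rw [Finset.mem_powerset] at h1 h2
  -- On a cell the mask keeps everything observed, and it neither leads into the cell nor out of it.
  -- So the integrand factors through the mask.
  have hinv : ∀ ω, (G S).indicator F ω = (G S).indicator F (mask ν S.1 S.2 e ω) := by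
    intro ω
    by_cases hω : ω ∈ G S
    · have ha := agree_mask (C := S.1) (X := S.2) e hω.1.le hω.2.le
      have : mask ν S.1 S.2 e ω ∈ G S := ⟨ha.busySlots.symm.trans hω.1,
        ha.deliveredSlots.symm.trans hω.2⟩
      rw [Set.indicator_of_mem hω, Set.indicator_of_mem this, hF' _ _ ha]
    · have : mask ν S.1 S.2 e ω ∉ G S := fun h => by
        have ha := agree_mask' (C := S.1) (X := S.2) e h.1.le h.2.le
        exact hω ⟨ha.busySlots.symm.trans h.1, ha.deliveredSlots.symm.trans h.2⟩
      rw [Set.indicator_of_notMem hω, Set.indicator_of_notMem this]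
  -- Push forward along the mask, exchange `ℙ_ν` for the law that is post-change on `S` only, pull
  -- back, and insert the density of that law.
  rw [lintegral_congr hinv, ← lintegral_map (hF.indicator (hG S)) (measurable_mask ν S.1 S.2 e),
    map_mask_law ν (fun k hk => (Finset.mem_Icc.1 (h1 hk)).1)
      (fun k hk => (Finset.mem_Icc.1 (h2 hk)).1) e,
    lintegral_map (hF.indicator (hG S)) (measurable_mask ν S.1 S.2 e), ← lintegral_congr hinv,
    pathLaw_mixedLaw hsample hchannel,
    lintegral_withDensity_eq_lintegral_mul _ (measurable_partialLR _ _) (hF.indicator (hG S))]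
  refine lintegral_congr fun ω => ?_
  simp only [Pi.mul_apply, Set.indicator_apply]
  split_ifs <;> simp

lemma measurable_obsLR (ν n : ℕ) : Measurable (M.obsLR ν n) := by
  have h : M.obsLR ν n = fun ω =>
      (∏ k ∈ Finset.Icc (ν + 1) n, if queue ω k ≠ 0 then M.channelLR (ω.2.2 k).2.1 else 1) *
      ∏ k ∈ Finset.Icc (ν + 1) n, if (ω.2.2 k).1 = true ∧
        ω.1 + arrivalCount ω k ≤ lastDelivered ω n then M.sampleLR (ω.2.2 k).2.2 else 1 := by
    funext ω
    simp only [obsLR, partialLR, busySlots, deliveredSlots, Finset.prod_filter]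
  rw [h]
  refine (Finset.measurable_prod _ fun k _ => Measurable.ite ?_ (M.measurable_channelLR.comp
    (by fun_prop)) measurable_const).mul (Finset.measurable_prod _ fun k _ => Measurable.ite ?_
      (M.measurable_sampleLR.comp (by fun_prop)) measurable_const)
  · exact measurable_queue k (MeasurableSet.of_discrete (s := {0}ᶜ))
  · exact ((by fun_prop : Measurable fun ω : Path E => (ω.2.2 k).1)
      (MeasurableSet.of_discrete (s := {true}))).inter
      (measurableSet_le (measurable_fst.add (measurable_arrivalCount k))
        (measurable_lastDelivered n))

end Model

end NetQCD

/-! ### Splitting a product measure into past and future -/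

section Join

variable {S : Type*}

/-- The sequence that is `a` up to index `n` and continues with `t`. -/
def joinAt (n : ℕ) (a t : ℕ → S) (k : ℕ) : S := if k ≤ n then a k else t (k - (n + 1))

lemma joinAt_of_le {n : ℕ} {a t : ℕ → S} {k : ℕ} (h : k ≤ n) : joinAt n a t k = a k := if_pos h

lemma joinAt_add (n : ℕ) (a t : ℕ → S) (k : ℕ) : joinAt n a t (n + 1 + k) = t k := by
  unfold joinAt; rw [if_neg (by omega)]; congr 1; omega

variable [MeasurableSpace S]

lemma measurable_joinAt (n : ℕ) :
    Measurable fun p : (ℕ → S) × (ℕ → S) => joinAt n p.1 p.2 := by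
  refine measurable_pi_lambda _ fun k => ?_
  unfold joinAt
  split_ifs <;> fun_prop

/-- Replacing the entries after `n` by an independent copy does not change a product law. This gives
conditioning on the past as an iterated integral, without conditional expectations. -/
lemma infinitePi_map_joinAt (μ : ℕ → Measure S) [∀ k, IsProbabilityMeasure (μ k)] (n : ℕ) :
    ((Measure.infinitePi μ).prod (Measure.infinitePi fun k => μ (n + 1 + k))).map
      (fun p => joinAt n p.1 p.2) = Measure.infinitePi μ := by
  refine Measure.eq_infinitePi _ fun s A hA => ?_
  rw [Measure.map_apply (measurable_joinAt n)
    (MeasurableSet.pi s.countable_toSet fun i _ => hA i)]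
  have hpre : (fun p : (ℕ → S) × (ℕ → S) => joinAt n p.1 p.2) ⁻¹' Set.pi (s : Set ℕ) A =
      Set.pi (s.filter (· ≤ n) : Finset ℕ) A ×ˢ
        Set.pi ((s.filter fun k => ¬ k ≤ n).image (· - (n + 1)) : Finset ℕ)
          fun k => A (n + 1 + k) := by
    ext ⟨a, t⟩
    simp only [Set.mem_preimage, Set.mem_pi, Set.mem_prod, Finset.mem_coe, Finset.mem_filter,
      Finset.mem_image]
    constructor
    · refine fun h => ⟨fun k hk => by simpa [joinAt_of_le hk.2] using h k hk.1, ?_⟩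
      rintro _ ⟨k, ⟨hk, hkn⟩, rfl⟩
      have := h k hk
      obtain ⟨j, rfl⟩ := Nat.exists_eq_add_of_le (show n + 1 ≤ k by omega)
      rw [joinAt_add] at this
      simpa using this
    · rintro ⟨h1, h2⟩ k hk
      rcases le_or_gt k n with hkn | hkn
      · rw [joinAt_of_le hkn]; exact h1 k ⟨hk, hkn⟩
      · obtain ⟨j, rfl⟩ := Nat.exists_eq_add_of_le (show n + 1 ≤ k by omega)
        rw [joinAt_add]
        exact h2 j ⟨n + 1 + j, ⟨hk, by omega⟩, by omega⟩
  rw [hpre, Measure.prod_prod, Measure.infinitePi_pi _ fun i _ => hA i,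
    Measure.infinitePi_pi (fun k => μ (n + 1 + k)) fun i _ => hA _, Finset.prod_image,
    ← Finset.prod_filter_mul_prod_filter_not s (· ≤ n)]
  · congr 1
    refine Finset.prod_congr rfl fun k hk => ?_
    have := (Finset.mem_filter.1 hk).2
    rw [show n + 1 + (k - (n + 1)) = k by omega]
  · intro i hi j hj hij
    have h1 := (Finset.mem_filter.1 hi).2
    have h2 := (Finset.mem_filter.1 hj).2
    simp only at hij
    omega

lemma lintegral_infinitePi_joinAt (μ : ℕ → Measure S) [∀ k, IsProbabilityMeasure (μ k)] (n : ℕ)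
    {F : (ℕ → S) → ℝ≥0∞} (hF : Measurable F) :
    ∫⁻ s, F s ∂Measure.infinitePi μ = ∫⁻ a, ∫⁻ t, F (joinAt n a t)
      ∂Measure.infinitePi (fun k => μ (n + 1 + k)) ∂Measure.infinitePi μ := by
  conv_lhs => rw [← infinitePi_map_joinAt μ n]
  rw [lintegral_map hF (measurable_joinAt n),
    lintegral_prod (fun p => F (joinAt n p.1 p.2)) (hF.comp (measurable_joinAt n)).aemeasurable]

end Join

namespace NetQCD

/-! ### Restarting the path at the change -/

section Shift

variable {E : Type*}

/-- The path as seen from the beginning of slot `ν + 1`. -/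
def shift (ν : ℕ) (ω : Path E) : Path E := (queue ω (ν + 1), ω.2.1, fun k => ω.2.2 (ν + k))

lemma queue_shift (ν : ℕ) (ω : Path E) (k : ℕ) :
    queue (shift ν ω) (k + 1) = queue ω (ν + k + 1) := by
  induction k with
  | zero => rfl
  | succ k ih =>
    rw [queue_succ, show ν + (k + 1) + 1 = (ν + k) + 2 by ring, queue_succ, ih]
    unfold outcome
    rw [ih]
    rfl

lemma outcome_shift (ν : ℕ) (ω : Path E) (k : ℕ) :
    outcome (shift ν ω) (k + 1) = outcome ω (ν + k + 1) := by
  unfold outcome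
  rw [queue_shift]
  rfl

lemma arrivalCount_shift (ν : ℕ) (ω : Path E) (k : ℕ) :
    arrivalCount ω ν + arrivalCount (shift ν ω) k = arrivalCount ω (ν + k) := by
  induction k with
  | zero => simp
  | succ k ih =>
    rw [arrivalCount_succ, ← add_assoc ν, arrivalCount_succ, ← ih, add_assoc]
    rfl

lemma lastDelivered_shift (ν : ℕ) (ω : Path E) (k : ℕ) :
    lastDelivered ω ν + lastDelivered (shift ν ω) k = lastDelivered ω (ν + k) := by
  induction k with
  | zero => simp
  | succ k ih =>
    rw [lastDelivered_succ, ← add_assoc ν, lastDelivered_succ, ← ih, outcome_shift, add_assoc, add_assoc]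

lemma busySlots_shift (ν n : ℕ) (ω : Path E) :
    busySlots ν (ν + n) ω = (busySlots 0 n (shift ν ω)).map (addLeftEmbedding ν) := by
  ext k
  simp only [busySlots, Finset.mem_filter, Finset.mem_map, Finset.mem_Icc, addLeftEmbedding_apply]
  constructor
  · rintro ⟨⟨h1, h2⟩, h3⟩
    obtain ⟨j, rfl⟩ := Nat.exists_eq_add_of_le h1
    exact ⟨j + 1, ⟨by omega, by rw [queue_shift]; convert h3 using 2; ring⟩, by ring⟩
  · rintro ⟨j, ⟨⟨h1, h2⟩, h3⟩, rfl⟩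
    obtain ⟨j, rfl⟩ := Nat.exists_eq_add_of_le' h1
    rw [queue_shift] at h3
    exact ⟨by omega, h3⟩

/-- By conservation of packets, restarting with `Q_{ν+1}` waiting packets renumbers every packet by
`D_ν`, so the FIFO condition for delivery is unchanged. The waiting values of the shifted path carry
no meaning, and the likelihood ratio does not read them. -/
lemma deliveredSlots_shift (ν n : ℕ) (ω : Path E) :
    deliveredSlots ν (ν + n) ω = (deliveredSlots 0 n (shift ν ω)).map (addLeftEmbedding ν) := by
  have h0 := lastDelivered_add_queue ω ν
  have hD := lastDelivered_shift ν ω n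
  ext k
  simp only [deliveredSlots, Finset.mem_filter, Finset.mem_map, Finset.mem_Icc,
    addLeftEmbedding_apply]
  constructor
  · rintro ⟨⟨h1, h2⟩, h3, h4⟩
    obtain ⟨j, rfl⟩ := Nat.exists_eq_add_of_le (show ν ≤ k by omega)
    have hA := arrivalCount_shift ν ω j
    exact ⟨j, ⟨by omega, h3, by simp only [shift] at hA hD ⊢; omega⟩, rfl⟩
  · rintro ⟨j, ⟨⟨h1, h2⟩, h3, h4⟩, rfl⟩
    have hA := arrivalCount_shift ν ω j
    exact ⟨by omega, h3, by simp only [shift] at hA hD h4; omega⟩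

lemma obsLR_shift [MeasurableSpace E] (M : Model E) (ν n : ℕ) (ω : Path E) :
    M.obsLR ν (ν + n) ω = M.obsLR 0 n (shift ν ω) := by
  unfold Model.obsLR Model.partialLR
  rw [busySlots_shift, deliveredSlots_shift, Finset.prod_map, Finset.prod_map]
  rfl

end Shift

/-! ### The likelihood ratio as a function of the observations -/

section ObservedRatio

variable {E : Type*}

/-- Reindexes from sampling slots to delivery slots: each success adds exactly one sampling slot,
unless the packet was waiting at the start. The right-hand side involves observed quantities only,
hence the measurability of `obsLR 0 n`. -/
lemma prod_deliveredSlots {R : Type*} [CommMonoid R] (f : E → R) (ω : Path E) (n : ℕ) :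
    ∏ k ∈ deliveredSlots 0 n ω, f (ω.2.2 k).2.2 =
      ∏ k ∈ Finset.Icc 1 n, if ω.1 < lastDelivered ω k then
        Sum.elim f (fun _ => 1) (received ω k) else 1 := by
  induction n with
  | zero => simp [deliveredSlots]
  | succ n ih =>
    rw [Finset.prod_Icc_succ_top (by omega), ← ih]
    have hD := lastDelivered_succ ω n
    have hQ := lastDelivered_add_queue ω n
    have hle : delivered (outcome ω (n + 1)) ≤ queue ω (n + 1) := delivered_outcomeOf_le _ _
    have hS := arrivalCount_succ ω n
    by_cases hs : outcome ω (n + 1) = .success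
    swap
    · have h0 : delivered (outcome ω (n + 1)) = 0 := by simp [delivered, hs]
      have hr : received ω (n + 1) = Sum.inr () := by simp [received, hs]
      rw [hr]
      simp only [Sum.elim_inr, ite_self, mul_one]
      congr 1
      ext k
      simp only [deliveredSlots, Finset.mem_filter, Finset.mem_Icc]
      constructor
      · rintro ⟨h1, h2, h3⟩
        have := arrival_eq_one_iff.2 h2
        have hk : k ≠ n + 1 := by rintro rfl; omega
        exact ⟨by omega, h2, by omega⟩
      · rintro ⟨h1, h2, h3⟩
        exact ⟨by omega, h2, by omega⟩
    have h1 : delivered (outcome ω (n + 1)) = 1 := by simp [delivered, hs]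
    split_ifs with hlt
    swap
    · rw [mul_one]
      congr 1
      ext k
      simp only [deliveredSlots, Finset.mem_filter, Finset.mem_Icc]
      have hpos : ∀ k, 1 ≤ k → (ω.2.2 k).1 = true → 0 < arrivalCount ω k := by
        intro k hk h2
        obtain ⟨k, rfl⟩ := Nat.exists_eq_add_of_le' hk
        have := arrival_eq_one_iff.2 h2
        rw [arrivalCount_succ]; omega
      constructor <;> rintro ⟨h1, h2, h3⟩ <;> have := hpos k h1.1 h2 <;> omega
    obtain ⟨s1, s2, s3, s4⟩ := arrivalSlot_spec (ω := ω)
      (m := lastDelivered ω (n + 1) - ω.1) (t := n) (by omega) (by omega)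
    have hr : received ω (n + 1) =
        Sum.inl (ω.2.2 (arrivalSlot ω (lastDelivered ω (n + 1) - ω.1))).2.2 := by
      simp [received, hs, packetValue, hlt]
    rw [hr, Sum.elim_inl]
    set s := arrivalSlot ω (lastDelivered ω (n + 1) - ω.1) with hsdef
    have hins : deliveredSlots 0 (n + 1) ω = insert s (deliveredSlots 0 n ω) := by
      ext k
      simp only [deliveredSlots, Finset.mem_filter, Finset.mem_Icc, Finset.mem_insert]
      constructor
      · rintro ⟨h5, h6, h7⟩
        have := arrival_eq_one_iff.2 h6
        have hk : k ≠ n + 1 := by rintro rfl; omega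
        by_cases h8 : ω.1 + arrivalCount ω k ≤ lastDelivered ω n
        · exact Or.inr ⟨by omega, h6, h8⟩
        · refine Or.inl ?_
          rw [hsdef, ← arrivalSlot_arrivalCount h5.1 this]
          congr 1; omega
      · rintro (rfl | ⟨h5, h6, h7⟩)
        · exact ⟨by omega, arrival_eq_one_iff.1 s4, by omega⟩
        · exact ⟨by omega, h6, by omega⟩
    rw [hins, Finset.prod_insert, mul_comm]
    simp only [deliveredSlots, Finset.mem_filter, not_and]
    intros; omega

variable [MeasurableSpace E]

lemma measurable_aug_init (n : ℕ) : Measurable[augFiltration E n] fun ω : Path E => ω.1 :=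
  (comap_measurable (fun ω : Path E => queue ω 1)).mono le_sup_left le_rfl

lemma measurable_aug {n k : ℕ} (h1 : 1 ≤ k) (hk : k ≤ n) :
    Measurable[augFiltration E n] fun ω : Path E => (queue ω k, outcome ω k, received ω k) :=
  (comap_measurable (fun ω : Path E => (queue ω k, outcome ω k, received ω k))).mono
    (le_sup_of_le_right (le_iSup₂_of_le k ⟨h1, hk⟩ le_rfl)) le_rfl

lemma measurable_aug_lastDelivered {n k : ℕ} (hk : k ≤ n) :
    Measurable[augFiltration E n] fun ω : Path E => lastDelivered ω k :=
  Finset.measurable_sum _ fun _ hi => (Measurable.of_discrete (f := delivered)).comp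
    (measurable_aug (Finset.mem_Icc.1 hi).1 ((Finset.mem_Icc.1 hi).2.trans hk)).snd.fst

lemma measurable_aug_obsLR (M : Model E) (n : ℕ) :
    Measurable[augFiltration E n] (M.obsLR 0 n) := by
  let g : Outcome → ℝ≥0∞
    | .idle => 1
    | .failure => M.channelLR false
    | .success => M.channelLR true
  have h : M.obsLR 0 n = fun ω => (∏ k ∈ Finset.Icc 1 n, g (outcome ω k)) *
      ∏ k ∈ Finset.Icc 1 n, if ω.1 < lastDelivered ω k then
        Sum.elim M.sampleLR (fun _ => 1) (received ω k) else 1 := by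
    funext ω
    rw [Model.obsLR, Model.partialLR, prod_deliveredSlots, busySlots, Finset.prod_filter]
    congr 1
    refine Finset.prod_congr rfl fun k _ => ?_
    unfold outcome outcomeOf
    by_cases hq : queue ω k = 0
    · simp [hq, g]
    · cases hc : (ω.2.2 k).2.1 <;> simp [hq, g]
  rw [h]
  refine (Finset.measurable_prod _ fun k hk => ?_).mul (Finset.measurable_prod _ fun k hk => ?_) <;>
    obtain ⟨h1, h2⟩ := Finset.mem_Icc.1 hk
  · exact (Measurable.of_discrete (f := g)).comp (measurable_aug h1 h2).snd.fst
  · refine Measurable.ite (measurableSet_lt (measurable_aug_init n)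
      (measurable_aug_lastDelivered h2)) ?_ measurable_const
    exact (M.measurable_sampleLR.sumElim measurable_const).comp (measurable_aug h1 h2).snd.snd

/-- Invariance under `Agree` is assumed rather than membership in `𝓖_n`, so that events such as
`obsLR ν n ≤ c` are covered for every `ν`; the `𝓖_n`-measurability of the ratio is established only
for `ν = 0`. -/
lemma law_apply {M : Model E} (hsample : M.sampleDiv ≠ ⊤) (hchannel : M.channelDiv ≠ ⊤) (ν n : ℕ)
    {B : Set (Path E)} (hB : MeasurableSet B) (hB' : ∀ ω ω', Agree ν n ω ω' → (ω ∈ B ↔ ω' ∈ B)) :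
    M.law ν B = ∫⁻ ω in B, M.obsLR ν n ω ∂M.law ⊤ := by
  rw [← lintegral_indicator_one hB, Model.lintegral_law hsample hchannel ν n
    (measurable_one.indicator hB), ← lintegral_indicator hB]
  · refine lintegral_congr fun ω => ?_
    by_cases h : ω ∈ B <;> simp [h]
  · intro ω ω' h
    by_cases hω : ω ∈ B
    · simp [hω, (hB' _ _ h).1 hω]
    · have hω' : ω' ∉ B := fun h' => hω ((hB' _ _ h).2 h')
      simp [hω, hω']

/-- `obsLR 0 n` is `𝓖_n`-measurable and is a density on `𝓖_n`, so it is a version of the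
Radon–Nikodym derivative of the trimmed laws. -/
lemma logLR_ae_eq {M : Model E} (hsample : M.sampleDiv ≠ ⊤) (hchannel : M.channelDiv ≠ ⊤)
    (n : ℕ) : M.logLR 0 n =ᵐ[M.law 0] fun ω => Real.log (M.obsLR 0 n ω).toReal := by
  have hm := measurable_aug_obsLR M n
  have h : (M.law 0).trim ((augFiltration E).le n) =
      ((M.law ⊤).trim ((augFiltration E).le n)).withDensity (M.obsLR 0 n) := by
    refine @Measure.ext _ (augFiltration E n) _ _ fun B hB => ?_
    rw [trim_measurableSet_eq _ hB, withDensity_apply _ hB, setLIntegral_trim _ hm hB]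
    exact law_apply hsample hchannel 0 n ((augFiltration E).le n _ hB)
      fun ω ω' ha => mem_iff_of_agree ha hB
  have h1 := Measure.rnDeriv_withDensity ((M.law ⊤).trim ((augFiltration E).le n)) hm
  rw [← h] at h1
  have h2 : (M.law 0).trim ((augFiltration E).le n) ≪ (M.law ⊤).trim ((augFiltration E).le n) := by
    rw [h]; exact withDensity_absolutelyContinuous _ _
  filter_upwards [ae_eq_of_ae_eq_trim (h2.ae_eq h1)] with ω hω
  rw [Model.logLR, llr, hω]

end ObservedRatio

namespace Model

variable {E : Type*} [MeasurableSpace E] {M : Model E}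

lemma lintegral_pathLaw_joinAt (μ : ℕ → Measure (Bool × Bool × E))
    [∀ k, IsProbabilityMeasure (μ k)] (n : ℕ) {F : Path E → ℝ≥0∞} (hF : Measurable F) :
    ∫⁻ ω, F ω ∂M.pathLaw μ = ∫⁻ ω, ∫⁻ t, F (ω.1, ω.2.1, joinAt n ω.2.2 t)
      ∂Measure.infinitePi (fun k => μ (n + 1 + k)) ∂M.pathLaw μ := by
  have hj : Measurable fun p : Path E × (ℕ → Bool × Bool × E) =>
      F (p.1.1, p.1.2.1, joinAt n p.1.2.2 p.2) := by
    refine hF.comp (Measurable.prodMk (by fun_prop) (Measurable.prodMk (by fun_prop) ?_))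
    exact (measurable_joinAt n).comp (by fun_prop :
      Measurable fun p : Path E × (ℕ → Bool × Bool × E) => (p.1.2.2, p.2))
  have hi := hj.lintegral_prod_right' (ν := Measure.infinitePi fun k => μ (n + 1 + k))
  unfold pathLaw
  rw [lintegral_prod _ hF.aemeasurable, lintegral_prod _ hi.aemeasurable]
  refine lintegral_congr fun q => ?_
  have hq : Measurable fun y => F (q, y) := hF.comp measurable_prodMk_left
  have hq' := (hi.comp (measurable_prodMk_left (x := q))).aemeasurable
    (μ := (Measure.infinitePi fun _ : ℕ => (M.f₀ : Measure E)).prod (Measure.infinitePi μ))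
  rw [lintegral_prod _ hq.aemeasurable]
  refine Eq.trans ?_ (lintegral_prod _ hq').symm
  exact lintegral_congr fun x => lintegral_infinitePi_joinAt μ n (by fun_prop)

end Model

end NetQCD

/-! ### Laws of large numbers, with and without predictable weights -/

section SequenceLaws

variable {S : Type*} [MeasurableSpace S] {κ : ℕ → Measure S} [∀ k, IsProbabilityMeasure (κ k)]
  {ρ : Measure S} [IsProbabilityMeasure ρ]

omit [MeasurableSpace S] in
lemma sum_Icc_one_eq_sum_range (f : ℕ → ℝ) (n : ℕ) :
    ∑ k ∈ Finset.Icc 1 n, f k = ∑ i ∈ Finset.range n, f (i + 1) := by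
  induction n with
  | zero => simp
  | succ n ih => rw [Finset.sum_Icc_succ_top (by omega), Finset.sum_range_succ, ih]

omit [IsProbabilityMeasure ρ] in
/-- Strong law of large numbers for the coordinates `1, 2, …`. -/
lemma ae_tendsto_average (hκ : ∀ k, κ (k + 1) = ρ) {φ : S → ℝ} (hφ : Measurable φ)
    (hint : Integrable φ ρ) :
    ∀ᵐ s ∂Measure.infinitePi κ, Tendsto
      (fun n : ℕ => (∑ k ∈ Finset.Icc 1 n, φ (s k)) / n) atTop (𝓝 (∫ y, φ y ∂ρ)) := by
  have hmap : ∀ i, (Measure.infinitePi κ).map (fun s => s (i + 1)) = ρ := fun i => by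
    rw [← hκ i]; exact Measure.infinitePi_map_eval κ (i + 1)
  have hm : ∀ i, Measurable fun s : ℕ → S => φ (s (i + 1)) := fun i => by fun_prop
  have h0 := strong_law_ae_real (μ := Measure.infinitePi κ) (fun i s => φ (s (i + 1)))
    (by
      rw [← hmap 0] at hint
      exact hint.comp_measurable (by fun_prop))
    (fun i j hij => (iIndepFun_infinitePi (P := κ) (X := fun _ => φ) (fun _ => hφ)).indepFun
      (by omega : i + 1 ≠ j + 1))
    (fun i => ⟨(hm i).aemeasurable, (hm 0).aemeasurable, by
      have h := fun i => Measure.map_map (μ := Measure.infinitePi κ) hφ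
        (measurable_pi_apply (X := fun _ => S) (i + 1))
      simp only [hmap] at h
      exact (h i).symm.trans (h 0)⟩)
  have h1 : ∫ s, φ (s (0 + 1)) ∂Measure.infinitePi κ = ∫ y, φ y ∂ρ := by
    rw [← hmap 0, integral_map (measurable_pi_apply (0 + 1)).aemeasurable hφ.aestronglyMeasurable]
  rw [h1] at h0
  filter_upwards [h0] with s hs
  simpa only [sum_Icc_one_eq_sum_range] using hs

variable {b : ℕ → (ℕ → S) → ℝ} {φ : S → ℝ}

/-- Induction on `n`: the weight of the last term is determined by the past, so integrating out the
last coordinate costs at most a factor `exp c`. -/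
lemma lintegral_exp_sum_le (hκ : ∀ k, κ (k + 1) = ρ) (hb : ∀ k, Measurable (b k))
    (hb01 : ∀ k s, b k s = 0 ∨ b k s = 1)
    (hpred : ∀ k s s', (∀ j < k, s j = s' j) → b k s = b k s') (hφ : Measurable φ) {c l : ℝ}
    (hc : 0 ≤ c) (hmgf : ∫⁻ y, ENNReal.ofReal (Real.exp (l * φ y)) ∂ρ ≤ ENNReal.ofReal (Real.exp c))
    (n : ℕ) :
    ∫⁻ s, ENNReal.ofReal (Real.exp (l * ∑ k ∈ Finset.Icc 1 n, b k s * φ (s k)))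
      ∂Measure.infinitePi κ ≤ ENNReal.ofReal (Real.exp (c * n)) := by
  have hm : ∀ n, Measurable fun s : ℕ → S => ∑ k ∈ Finset.Icc 1 n, b k s * φ (s k) := fun n => by
    fun_prop
  induction n with
  | zero => simp
  | succ n ih =>
    rw [lintegral_infinitePi_joinAt κ n (by fun_prop)]
    have hstep : ∀ a, ∫⁻ t, ENNReal.ofReal (Real.exp (l * ∑ k ∈ Finset.Icc 1 (n + 1),
        b k (joinAt n a t) * φ (joinAt n a t k))) ∂Measure.infinitePi (fun k => κ (n + 1 + k)) ≤
        ENNReal.ofReal (Real.exp (l * ∑ k ∈ Finset.Icc 1 n, b k a * φ (a k))) *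
          ENNReal.ofReal (Real.exp c) := by
      intro a
      have hsum : ∀ t, ∑ k ∈ Finset.Icc 1 (n + 1), b k (joinAt n a t) * φ (joinAt n a t k) =
          ∑ k ∈ Finset.Icc 1 n, b k a * φ (a k) + b (n + 1) a * φ (t 0) := fun t => by
        rw [Finset.sum_Icc_succ_top (by omega)]
        congr 1
        · refine Finset.sum_congr rfl fun k hk => ?_
          have hk := (Finset.mem_Icc.1 hk).2
          rw [joinAt_of_le hk, hpred k _ a fun j hj => joinAt_of_le (by omega)]
        · rw [hpred (n + 1) _ a fun j hj => joinAt_of_le (by omega)]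
          rw [show joinAt n a t (n + 1) = t 0 from joinAt_add n a t 0]
      simp_rw [hsum, mul_add, Real.exp_add, ENNReal.ofReal_mul (Real.exp_nonneg _)]
      rw [lintegral_const_mul _ (by fun_prop)]
      gcongr
      rw [← lintegral_map (μ := Measure.infinitePi fun k => κ (n + 1 + k))
        (f := fun y => ENNReal.ofReal (Real.exp (l * (b (n + 1) a * φ y)))) (g := fun t => t 0)
        (by fun_prop) (by fun_prop), Measure.infinitePi_map_eval (fun k => κ (n + 1 + k)) 0,
        add_zero, hκ]
      -- A vanishing weight contributes the factor `1`, which is where `0 ≤ c` is needed.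
      rcases hb01 (n + 1) a with h | h
      · simp only [h, zero_mul, mul_zero, Real.exp_zero, lintegral_const, measure_univ, mul_one]
        exact ENNReal.ofReal_le_ofReal (Real.one_le_exp hc)
      · simpa only [h, one_mul] using hmgf
    refine (lintegral_mono hstep).trans ?_
    rw [lintegral_mul_const _ (by fun_prop)]
    calc _ ≤ ENNReal.ofReal (Real.exp (c * n)) * ENNReal.ofReal (Real.exp c) := by gcongr
      _ = _ := by
        rw [← ENNReal.ofReal_mul (Real.exp_nonneg _), ← Real.exp_add]; push_cast; ring_nf

/-- Hoeffding's lemma bounds the one-step exponential moment, Markov's inequality gives an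
exponentially small tail, and Borel–Cantelli concludes. -/
lemma ae_eventually_sum_lt (hκ : ∀ k, κ (k + 1) = ρ) (hb : ∀ k, Measurable (b k))
    (hb01 : ∀ k s, b k s = 0 ∨ b k s = 1)
    (hpred : ∀ k s s', (∀ j < k, s j = s' j) → b k s = b k s') (hφ : Measurable φ) {K : ℝ}
    (hK : 0 < K) (hbd : ∀ y, φ y ∈ Set.Icc (-K) K) (hmean : ∫ y, φ y ∂ρ = 0) {ε : ℝ}
    (hε : 0 < ε) :
    ∀ᵐ s ∂Measure.infinitePi κ, ∀ᶠ n : ℕ in atTop,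
      ∑ k ∈ Finset.Icc 1 n, b k s * φ (s k) < ε * n := by
  have hsub := hasSubgaussianMGF_of_mem_Icc_of_integral_eq_zero (μ := ρ) hφ.aemeasurable
    (ae_of_all _ hbd) hmean
  have hmgf : ∀ l : ℝ, ∫⁻ y, ENNReal.ofReal (Real.exp (l * φ y)) ∂ρ ≤
      ENNReal.ofReal (Real.exp (K ^ 2 * l ^ 2 / 2)) := fun l => by
    rw [← ofReal_integral_eq_lintegral_ofReal (hsub.integrable_exp_mul l)
      (ae_of_all _ fun _ => Real.exp_nonneg _)]
    refine ENNReal.ofReal_le_ofReal ((hsub.mgf_le l).trans (le_of_eq ?_))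
    congr 3
    push_cast
    rw [show K - -K = 2 * K by ring]
    simp [abs_of_pos hK]
  -- Minimizer of `K² l² / 2 - l ε`, with minimum `-ε² / (2 K²)`.
  set l : ℝ := ε / K ^ 2 with hl
  have hexp := fun n => lintegral_exp_sum_le (l := l) hκ hb hb01 hpred hφ (by positivity) (hmgf l) n
  have hm : ∀ n, Measurable fun s : ℕ → S => ∑ k ∈ Finset.Icc 1 n, b k s * φ (s k) := fun n => by
    fun_prop
  have hbound : ∀ n : ℕ, Measure.infinitePi κ
      {s | ε * n ≤ ∑ k ∈ Finset.Icc 1 n, b k s * φ (s k)} ≤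
      ENNReal.ofReal (Real.exp (-(ε ^ 2 / (2 * K ^ 2)))) ^ n := by
    intro n
    have hpos : (0 : ℝ) < Real.exp (l * (ε * n)) := Real.exp_pos _
    calc _ ≤ Measure.infinitePi κ {s | ENNReal.ofReal (Real.exp (l * (ε * n))) ≤
          ENNReal.ofReal (Real.exp (l * ∑ k ∈ Finset.Icc 1 n, b k s * φ (s k)))} := by
          refine measure_mono fun s hs => ?_
          refine ENNReal.ofReal_le_ofReal (Real.exp_le_exp.2 ?_)
          exact mul_le_mul_of_nonneg_left hs (by positivity)
      _ ≤ _ := meas_ge_le_lintegral_div (by fun_prop) (by simpa using Real.exp_pos _)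
        ENNReal.ofReal_ne_top
      _ ≤ ENNReal.ofReal (Real.exp (K ^ 2 * l ^ 2 / 2 * n)) /
          ENNReal.ofReal (Real.exp (l * (ε * n))) := by gcongr; exact hexp n
      _ = _ := by
        rw [← ENNReal.ofReal_div_of_pos hpos, ← Real.exp_sub, ← ENNReal.ofReal_pow
          (Real.exp_nonneg _), ← Real.exp_nat_mul]
        congr 2
        rw [hl]
        field_simp
        ring
  have hsum : ∑' n : ℕ, Measure.infinitePi κ
      {s | ε * n ≤ ∑ k ∈ Finset.Icc 1 n, b k s * φ (s k)} ≠ ⊤ := by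
    refine ne_top_of_le_ne_top ?_ (ENNReal.tsum_le_tsum hbound)
    rw [ENNReal.tsum_geometric]
    refine ENNReal.inv_ne_top.2 (tsub_pos_of_lt ?_).ne'
    rw [← ENNReal.ofReal_one]
    refine (ENNReal.ofReal_lt_ofReal_iff one_pos).2 (Real.exp_lt_one_iff.2 ?_)
    rw [neg_lt_zero]; positivity
  filter_upwards [ae_eventually_notMem hsum] with s hs
  filter_upwards [hs] with n hn
  simpa using hn

/-- Law of large numbers for bounded centred variables with predictable weights in `{0, 1}`. -/
lemma ae_tendsto_predictable_average (hκ : ∀ k, κ (k + 1) = ρ) (hb : ∀ k, Measurable (b k))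
    (hb01 : ∀ k s, b k s = 0 ∨ b k s = 1)
    (hpred : ∀ k s s', (∀ j < k, s j = s' j) → b k s = b k s') (hφ : Measurable φ) {K : ℝ}
    (hK : 0 < K) (hbd : ∀ y, φ y ∈ Set.Icc (-K) K) (hmean : ∫ y, φ y ∂ρ = 0) :
    ∀ᵐ s ∂Measure.infinitePi κ, Tendsto
      (fun n : ℕ => (∑ k ∈ Finset.Icc 1 n, b k s * φ (s k)) / n) atTop (𝓝 0) := by
  have h1 := ae_all_iff.2 fun j : ℕ => ae_eventually_sum_lt hκ hb hb01 hpred hφ hK hbd hmean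
    (show (0 : ℝ) < 1 / ((j : ℝ) + 1) by positivity)
  have h2 := ae_all_iff.2 fun j : ℕ => ae_eventually_sum_lt (φ := fun y => -φ y) hκ hb hb01 hpred
    hφ.neg hK (fun y => ⟨neg_le_neg (hbd y).2, neg_le.1 (hbd y).1⟩) (by rw [integral_neg, hmean,
      neg_zero]) (show (0 : ℝ) < 1 / ((j : ℝ) + 1) by positivity)
  filter_upwards [h1, h2] with s hs1 hs2
  rw [Metric.tendsto_atTop']
  intro ε hε
  obtain ⟨j, hj⟩ := exists_nat_one_div_lt hε
  obtain ⟨N, hN⟩ := eventually_atTop.1 ((hs1 j).and (hs2 j))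
  refine ⟨N, fun n hn => ?_⟩
  obtain ⟨h3, h4⟩ := hN n hn.le
  have hn0 : (0 : ℝ) < n := by exact_mod_cast (Nat.zero_le N).trans_lt hn
  simp only [mul_neg, Finset.sum_neg_distrib] at h4
  rw [Real.dist_0_eq_abs, abs_div, abs_of_pos hn0, div_lt_iff₀ hn0]
  calc _ < 1 / ((j : ℝ) + 1) * n := abs_lt.2 ⟨by linarith, h3⟩
    _ ≤ _ := by gcongr

end SequenceLaws

/-- The constant absorbs the finitely many early indices, so the bound holds at every index. It will
be used at an index `τ` over which there is no control. -/
lemma exists_abs_sub_le_of_tendsto_div {W : ℕ → ℝ} {w : ℝ}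
    (h : Tendsto (fun n : ℕ => W n / n) atTop (𝓝 w)) {ε : ℝ} (hε : 0 < ε) :
    ∃ K, ∀ n : ℕ, |W n - w * n| ≤ ε * n + K := by
  obtain ⟨N, hN⟩ := Metric.tendsto_atTop'.1 h ε hε
  refine ⟨∑ k ∈ Finset.range (N + 1), |W k - w * k|, fun n => ?_⟩
  have hK : 0 ≤ ∑ k ∈ Finset.range (N + 1), |W k - w * k| :=
    Finset.sum_nonneg fun _ _ => abs_nonneg _
  rcases le_or_gt n N with hn | hn
  · have := Finset.single_le_sum (f := fun k : ℕ => |W k - w * k|) (fun _ _ => abs_nonneg _)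
      (Finset.mem_range.2 (Nat.lt_succ_of_le hn))
    have h2 : 0 ≤ ε * n := by positivity
    linarith
  · have hn0 : (0 : ℝ) < n := by exact_mod_cast (Nat.zero_le N).trans_lt hn
    have := hN n hn
    rw [Real.dist_eq, show W n / n - w = (W n - w * n) / n by field_simp, abs_div,
      abs_of_pos hn0, div_lt_iff₀ hn0] at this
    linarith

namespace NetQCD

/-! ### Rates along a fixed path -/

section Deterministic

variable {E : Type*} {ω : Path E}

/-- `1` if an attempt in slot `k` would succeed, else `0`. -/
def channelState (ω : Path E) (k : ℕ) : ℝ := if (ω.2.2 k).2.1 = true then 1 else 0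

lemma delivered_outcome (ω : Path E) (k : ℕ) :
    (delivered (outcome ω k) : ℝ) = if queue ω k ≠ 0 then channelState ω k else 0 := by
  unfold outcome channelState
  rw [delivered_outcomeOf]
  split_ifs <;> simp_all

/-- The free random walk that drives the queue. -/
noncomputable def netInput (ω : Path E) (n : ℕ) : ℝ :=
  ∑ k ∈ Finset.Icc 1 n, ((arrival ω k : ℝ) - channelState ω k)

lemma netInput_succ (ω : Path E) (n : ℕ) : netInput ω (n + 1) =
    netInput ω n + (arrival ω (n + 1) - channelState ω (n + 1)) :=
  Finset.sum_Icc_succ_top (by omega) _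

/-- `τ` is the last idle slot up to `n`, or `0` if there is none. After it every successful channel
state removes a packet, so the queue moves with the free walk; the `1` is a possible arrival in the
idle slot. -/
lemma exists_queue_le (ω : Path E) (n : ℕ) :
    ∃ τ ≤ n, (queue ω (n + 1) : ℝ) ≤ ω.1 + 1 + (netInput ω n - netInput ω τ) := by
  induction n with
  | zero => exact ⟨0, le_rfl, by simp [queue]⟩
  | succ n ih =>
    by_cases h0 : queue ω (n + 1) = 0
    · refine ⟨n + 1, le_rfl, ?_⟩
      rw [queue_succ, h0]
      have : (arrival ω (n + 1) : ℝ) ≤ 1 := by exact_mod_cast arrival_le_one ω (n + 1)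
      simp only [Nat.zero_sub, zero_add, sub_self, add_zero]
      have : (0 : ℝ) ≤ ω.1 := Nat.cast_nonneg _
      linarith
    · obtain ⟨τ, hτ, h⟩ := ih
      refine ⟨τ, by omega, ?_⟩
      have hle : delivered (outcome ω (n + 1)) ≤ queue ω (n + 1) := delivered_outcomeOf_le _ _
      rw [queue_succ, netInput_succ]
      push_cast [hle]
      rw [delivered_outcome, if_pos h0]
      linarith

lemma tendsto_queue_div {w : ℝ} (hw : w ≤ 0)
    (h : Tendsto (fun n : ℕ => netInput ω n / n) atTop (𝓝 w)) :
    Tendsto (fun n : ℕ => (queue ω (n + 1) : ℝ) / n) atTop (𝓝 0) := by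
  rw [Metric.tendsto_atTop']
  intro ε hε
  obtain ⟨K, hK⟩ := exists_abs_sub_le_of_tendsto_div h (show 0 < ε / 4 by positivity)
  obtain ⟨N, hN⟩ := exists_nat_gt ((ω.1 + 1 + 2 * K) / (ε / 2))
  refine ⟨N, fun n hn => ?_⟩
  have hn0 : (0 : ℝ) < n := by exact_mod_cast (Nat.zero_le N).trans_lt hn
  obtain ⟨τ, hτ, hq⟩ := exists_queue_le ω n
  have h1 := abs_le.1 (hK n)
  have h2 := abs_le.1 (hK τ)
  have hτ' : (τ : ℝ) ≤ n := by exact_mod_cast hτ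
  have hNn : (N : ℝ) < n := by exact_mod_cast hn
  rw [div_lt_iff₀ (by positivity)] at hN
  rw [Real.dist_0_eq_abs, abs_of_nonneg (by positivity), div_lt_iff₀ hn0]
  -- The drift over `(τ, n]` has a favourable sign and is dropped; only the two fluctuation bounds
  -- remain.
  have h3 : w * (n - τ) ≤ 0 := mul_nonpos_of_nonpos_of_nonneg hw (by linarith)
  have h4 : ε / 4 * τ ≤ ε / 4 * n := by gcongr
  have h5 : ε / 2 * N < ε / 2 * n := by gcongr
  linarith [h1.2, h2.1]

lemma tendsto_lastDelivered_div {r w : ℝ} (hw : w ≤ 0)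
    (h : Tendsto (fun n : ℕ => netInput ω n / n) atTop (𝓝 w))
    (hA : Tendsto (fun n : ℕ => (arrivalCount ω n : ℝ) / n) atTop (𝓝 r)) :
    Tendsto (fun n : ℕ => (lastDelivered ω n : ℝ) / n) atTop (𝓝 r) := by
  have h1 := (tendsto_const_div_atTop_nhds_zero_nat (ω.1 : ℝ)).add hA |>.sub (tendsto_queue_div hw h)
  simp only [zero_add, sub_zero] at h1
  refine h1.congr fun n => ?_
  have := lastDelivered_add_queue ω n
  have : (lastDelivered ω n : ℝ) + queue ω (n + 1) = ω.1 + arrivalCount ω n := by exact_mod_cast this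
  rw [← add_div, ← sub_div, ← this]; ring

lemma sum_busySlots (ω : Path E) (f : Bool → ℝ) (n : ℕ) :
    ∑ k ∈ busySlots 0 n ω, f (ω.2.2 k).2.1 =
      ∑ k ∈ Finset.Icc 1 n, if queue ω k ≠ 0 then f (ω.2.2 k).2.1 else 0 := by
  rw [busySlots, Finset.sum_filter]

lemma lastDelivered_eq_sum_busySlots (ω : Path E) (n : ℕ) :
    (lastDelivered ω n : ℝ) = ∑ k ∈ busySlots 0 n ω, channelState ω k := by
  rw [lastDelivered, busySlots, Finset.sum_filter]
  push_cast
  exact Finset.sum_congr rfl fun k _ => delivered_outcome ω k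

/-- `D_n` is the sum of the channel states over the busy slots. After centring the sum is `o(n)`, so
`p₁` times the number of busy slots is asymptotic to `D_n`. -/
lemma tendsto_busySlots_div {r p₁ : ℝ} (hp : p₁ ≠ 0)
    (hD : Tendsto (fun n : ℕ => (lastDelivered ω n : ℝ) / n) atTop (𝓝 r))
    (hM : Tendsto (fun n : ℕ => (∑ k ∈ busySlots 0 n ω, (channelState ω k - p₁)) / n)
      atTop (𝓝 0)) :
    Tendsto (fun n : ℕ => ((busySlots 0 n ω).card : ℝ) / n) atTop (𝓝 (r / p₁)) := by
  have h := (hD.sub hM).div_const p₁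
  rw [sub_zero] at h
  refine h.congr fun n => ?_
  rw [Finset.sum_sub_distrib, ← lastDelivered_eq_sum_busySlots, Finset.sum_const, nsmul_eq_mul,
    ← sub_div]
  field_simp
  ring

lemma tendsto_channelPart_div {r p₁ : ℝ} {f : Bool → ℝ} {m : ℝ}
    (hB : Tendsto (fun n : ℕ => ((busySlots 0 n ω).card : ℝ) / n) atTop (𝓝 (r / p₁)))
    (hM : Tendsto (fun n : ℕ => (∑ k ∈ busySlots 0 n ω, (f (ω.2.2 k).2.1 - m)) / n)
      atTop (𝓝 0)) :
    Tendsto (fun n : ℕ => (∑ k ∈ busySlots 0 n ω, f (ω.2.2 k).2.1) / n) atTop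
      (𝓝 (r / p₁ * m)) := by
  have h := hM.add (hB.mul_const m)
  rw [zero_add] at h
  refine h.congr fun n => ?_
  rw [Finset.sum_sub_distrib, Finset.sum_const, nsmul_eq_mul]
  ring

/-- FIFO: the delivered packets form an initial segment of the arrivals, so the sum over delivered
samples is a partial sum over all samples, ending at an index `κ` that depends on the path. -/
lemma exists_deliveredSlots_eq {n : ℕ} (h : ω.1 ≤ lastDelivered ω n) :
    ∃ κ ≤ n, ω.1 + arrivalCount ω κ = lastDelivered ω n ∧
      deliveredSlots 0 n ω = (Finset.Icc 1 κ).filter fun k => (ω.2.2 k).1 = true := by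
  let P : ℕ → Prop := fun k => ω.1 + arrivalCount ω k ≤ lastDelivered ω n
  have hP0 : P 0 := by simpa [P] using h
  have hPκ : P (Nat.findGreatest P n) := Nat.findGreatest_spec (Nat.zero_le n) hP0
  set κ := Nat.findGreatest P n with hκ
  have hκn : κ ≤ n := Nat.findGreatest_le n
  refine ⟨κ, hκn, le_antisymm hPκ ?_, ?_⟩
  · rcases hκn.eq_or_lt with h1 | h1
    · have := lastDelivered_add_queue ω n
      rw [h1]; omega
    · have h2 : ¬ P (κ + 1) := Nat.findGreatest_is_greatest (Nat.lt_succ_self κ) h1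
      have h3 := arrivalCount_succ ω κ
      have h4 := arrival_le_one ω (κ + 1)
      simp only [P] at h2
      omega
  · ext k
    simp only [deliveredSlots, Finset.mem_filter, Finset.mem_Icc]
    constructor
    · rintro ⟨⟨h1, h2⟩, h3, h4⟩
      exact ⟨⟨h1, Nat.le_findGreatest h2 h4⟩, h3⟩
    · rintro ⟨⟨h1, h2⟩, h3⟩
      exact ⟨⟨h1, h2.trans hκn⟩, h3,
        (Nat.add_le_add_left (arrivalCount_mono ω h2) _).trans hPκ⟩

lemma tendsto_samplePart_div {r d : ℝ} (hr : 0 < r) {f : E → ℝ}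
    (hA : Tendsto (fun n : ℕ => (arrivalCount ω n : ℝ) / n) atTop (𝓝 r))
    (hD : Tendsto (fun n : ℕ => (lastDelivered ω n : ℝ) / n) atTop (𝓝 r))
    (hX : Tendsto (fun n : ℕ => (∑ k ∈ Finset.Icc 1 n,
      if (ω.2.2 k).1 = true then f (ω.2.2 k).2.2 else 0) / n) atTop (𝓝 d)) :
    Tendsto (fun n : ℕ => (∑ k ∈ deliveredSlots 0 n ω, f (ω.2.2 k).2.2) / n) atTop (𝓝 d) := by
  have hDtop : Tendsto (fun n : ℕ => (lastDelivered ω n : ℝ)) atTop atTop := by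
    refine (hD.pos_mul_atTop hr tendsto_natCast_atTop_atTop).congr' ?_
    filter_upwards [eventually_gt_atTop 0] with n hn
    field_simp
  have hDtop' : Tendsto (fun n : ℕ => lastDelivered ω n) atTop atTop :=
    tendsto_natCast_atTop_iff.1 hDtop
  have hex : ∀ n, ∃ κ : ℕ, ω.1 ≤ lastDelivered ω n → (κ ≤ n ∧
      ω.1 + arrivalCount ω κ = lastDelivered ω n ∧
      deliveredSlots 0 n ω = (Finset.Icc 1 κ).filter fun k => (ω.2.2 k).1 = true) := fun n => by
    by_cases h : ω.1 ≤ lastDelivered ω n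
    · obtain ⟨κ, h⟩ := exists_deliveredSlots_eq h
      exact ⟨κ, fun _ => h⟩
    · exact ⟨0, fun h' => absurd h' h⟩
  choose κ hκ using hex
  have hev : ∀ᶠ n in atTop, ω.1 ≤ lastDelivered ω n := hDtop'.eventually_ge_atTop ω.1
  have hcount : ∀ n, arrivalCount ω n ≤ n := fun n => by
    induction n with
    | zero => simp
    | succ n ih =>
      have := arrival_le_one ω (n + 1)
      rw [arrivalCount_succ]; omega
  -- At most one arrival per slot, so `κ` is at least its arrival count `D_n - Q₁`.
  have hκtop : Tendsto κ atTop atTop := by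
    refine tendsto_atTop_mono' atTop (f₁ := fun n => lastDelivered ω n - ω.1) ?_ ?_
    · filter_upwards [hev] with n hn
      have := (hκ n hn).2.1
      have := hcount (κ n)
      omega
    · rw [tendsto_atTop] at hDtop' ⊢
      intro b
      filter_upwards [hDtop' (b + ω.1)] with n hn
      omega
  have hAκ : Tendsto (fun n : ℕ => (arrivalCount ω (κ n) : ℝ) / n) atTop (𝓝 r) := by
    have h1 := hD.sub (tendsto_const_div_atTop_nhds_zero_nat (ω.1 : ℝ))
    rw [sub_zero] at h1
    refine h1.congr' ?_
    filter_upwards [hev] with n hn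
    rw [← (hκ n hn).2.1]
    push_cast
    ring
  -- Both `A_κ / n` and `A_κ / κ` tend to `r`, so this is the statement `κ / n → 1`.
  have hratio := hAκ.div (hA.comp hκtop) hr.ne'
  have h2 := (hX.comp hκtop).mul hratio
  rw [div_self hr.ne', mul_one] at h2
  refine h2.congr' ?_
  have hApos : ∀ᶠ n in atTop, 0 < (arrivalCount ω (κ n) : ℝ) / n :=
    hAκ.eventually_const_lt hr
  filter_upwards [hev, hκtop.eventually_gt_atTop 0, hApos, eventually_gt_atTop 0]
    with n hn hκ0 hA0 hn0
  rw [(hκ n hn).2.2, Finset.sum_filter]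
  have h3 : (0 : ℝ) < n := by exact_mod_cast hn0
  have h4 : (arrivalCount ω (κ n) : ℝ) ≠ 0 := fun h => by simp [h] at hA0
  have h5 : (κ n : ℝ) ≠ 0 := by exact_mod_cast hκ0.ne'
  simp only [Function.comp, Pi.div_apply]
  field_simp

end Deterministic

end NetQCD

/-! ### Almost sure growth of the log-likelihood ratio -/

namespace NetQCD

namespace Model

variable {E : Type*} [MeasurableSpace E] {M : Model E}

lemma slotLaw_zero_succ (k : ℕ) : M.slotLaw 0 (k + 1) = M.mixedLaw true true := by
  rw [slotLaw_eq_mixedLaw]; simp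

lemma integral_bernoulli_ite (p : I) :
    ∫ b, (if b = true then (1 : ℝ) else 0) ∂bernoulliMeasure true false p = p := by
  rw [integral_bernoulliMeasure]; simp

lemma integrable_mixedLaw_of_bool {f : Bool → Bool → ℝ} (c x : Bool) :
    Integrable (fun y : Bool × Bool × E => f y.1 y.2.1) (M.mixedLaw c x) := by
  have hm : Measurable fun y : Bool × Bool × E => f y.1 y.2.1 :=
    (Measurable.of_discrete (f := fun z : Bool × Bool => f z.1 z.2)).comp
      (by fun_prop : Measurable fun y : Bool × Bool × E => (y.1, y.2.1))
  refine Integrable.of_bound hm.aestronglyMeasurable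
    (|f true true| + |f true false| + |f false true| + |f false false|) (ae_of_all _ fun y => ?_)
  have h1 := abs_nonneg (f true true)
  have h2 := abs_nonneg (f true false)
  have h3 := abs_nonneg (f false true)
  have h4 := abs_nonneg (f false false)
  rw [Real.norm_eq_abs]
  cases y.1 <;> cases y.2.1 <;> linarith

lemma integral_sampling (c x : Bool) :
    ∫ y : Bool × Bool × E, (if y.1 = true then (1 : ℝ) else 0) ∂M.mixedLaw c x = M.r := by
  unfold mixedLaw
  rw [integral_fun_fst (fun b : Bool => if b = true then (1 : ℝ) else 0)]
  simp [integral_bernoulli_ite]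

lemma integral_channel (c x : Bool) (f : Bool → ℝ) :
    ∫ y : Bool × Bool × E, f y.2.1 ∂M.mixedLaw c x =
      ∫ b, f b ∂bernoulliMeasure true false (if c then M.p₁ else M.p₀) := by
  unfold mixedLaw
  rw [integral_fun_snd (fun z : Bool × E => f z.1), integral_fun_fst]
  simp

lemma integral_sample_mul {f : E → ℝ} :
    ∫ y : Bool × Bool × E, (if y.1 = true then f y.2.2 else 0) ∂M.mixedLaw true true =
      M.r * ∫ z, f z ∂(M.f₁ : Measure E) := by
  unfold mixedLaw
  have h : ∀ y : Bool × Bool × E, (if y.1 = true then f y.2.2 else 0) =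
      (if y.1 = true then (1 : ℝ) else 0) * f y.2.2 := fun y => by split_ifs <;> simp
  simp_rw [h]
  rw [integral_prod_mul (fun b : Bool => if b = true then (1 : ℝ) else 0)
    (fun z : Bool × E => f z.2), integral_bernoulli_ite, integral_fun_snd]
  simp

lemma integrable_sample_mul {f : E → ℝ} (hf : Integrable f (M.f₁ : Measure E)) :
    Integrable (fun y : Bool × Bool × E => if y.1 = true then f y.2.2 else 0)
      (M.mixedLaw true true) := by
  unfold mixedLaw
  have h : (fun y : Bool × Bool × E => (if y.1 = true then f y.2.2 else 0)) = fun y =>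
      (if y.1 = true then (1 : ℝ) else 0) * f y.2.2 := by funext y; split_ifs <;> simp
  rw [h]
  exact (integrable_bernoulliMeasure true false M.r
    (fun b : Bool => if b = true then (1 : ℝ) else 0)).mul_prod
    (hf.comp_snd _ : Integrable (fun z : Bool × E => f z.2) _)

/-- Log-likelihood ratio of one channel observation. -/
noncomputable def channelLLR (M : Model E) (b : Bool) : ℝ := Real.log (M.channelLR b).toReal

/-- Log-likelihood ratio of one sample. -/
noncomputable def sampleLLR (M : Model E) (z : E) : ℝ := Real.log (M.sampleLR z).toReal

lemma measurable_sampleLLR : Measurable M.sampleLLR :=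
  Real.measurable_log.comp M.measurable_sampleLR.ennreal_toReal

lemma integral_channelLLR (hchannel : M.channelDiv ≠ ⊤) :
    ∫ b, M.channelLLR b ∂bernoulliMeasure true false M.p₁ = M.channelDiv.toReal := by
  obtain ⟨h1, h2⟩ := klDiv_ne_top_iff.1 hchannel
  rw [channelDiv, toReal_klDiv h1 h2]
  simp only [probReal_univ, add_sub_cancel_right]
  rfl

lemma integral_sampleLLR (hsample : M.sampleDiv ≠ ⊤) :
    ∫ z, M.sampleLLR z ∂(M.f₁ : Measure E) = M.sampleDiv.toReal := by
  obtain ⟨h1, h2⟩ := klDiv_ne_top_iff.1 hsample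
  rw [sampleDiv, toReal_klDiv h1 h2]
  simp only [probReal_univ, add_sub_cancel_right]
  rfl

/-- Sequences of slots whose likelihood ratios are neither `0` nor `∞`. -/
lemma ae_slots_regular (hsample : M.sampleDiv ≠ ⊤) (hchannel : M.channelDiv ≠ ⊤) :
    ∀ᵐ s ∂Measure.infinitePi (M.slotLaw 0), ∀ k,
      (M.channelLR (s (k + 1)).2.1 ≠ 0 ∧ M.channelLR (s (k + 1)).2.1 ≠ ⊤) ∧
      (M.sampleLR (s (k + 1)).2.2 ≠ 0 ∧ M.sampleLR (s (k + 1)).2.2 ≠ ⊤) := by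
  rw [ae_all_iff]
  intro k
  obtain ⟨hc, -⟩ := klDiv_ne_top_iff.1 hchannel
  obtain ⟨hs, -⟩ := klDiv_ne_top_iff.1 hsample
  have h1 : ∀ᵐ b ∂bernoulliMeasure true false M.p₁, M.channelLR b ≠ 0 ∧ M.channelLR b ≠ ⊤ := by
    filter_upwards [Measure.rnDeriv_pos hc, hc.ae_le (Measure.rnDeriv_ne_top (bernoulliMeasure true false M.p₁) _)] with b h1 h2
    exact ⟨h1.ne', h2⟩
  have h2 : ∀ᵐ z ∂(M.f₁ : Measure E), M.sampleLR z ≠ 0 ∧ M.sampleLR z ≠ ⊤ := by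
    filter_upwards [Measure.rnDeriv_pos hs, hs.ae_le (Measure.rnDeriv_ne_top (M.f₁ : Measure E) _)] with b h1 h2
    exact ⟨h1.ne', h2⟩
  have h3 : ∀ᵐ y ∂M.mixedLaw true true, (M.channelLR y.2.1 ≠ 0 ∧ M.channelLR y.2.1 ≠ ⊤) ∧
      (M.sampleLR y.2.2 ≠ 0 ∧ M.sampleLR y.2.2 ≠ ⊤) := by
    unfold mixedLaw
    refine Measure.quasiMeasurePreserving_snd.ae
      (p := fun z : Bool × E => (M.channelLR z.1 ≠ 0 ∧ M.channelLR z.1 ≠ ⊤) ∧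
      (M.sampleLR z.2 ≠ 0 ∧ M.sampleLR z.2 ≠ ⊤)) ?_
    simp only [if_true]
    exact (Measure.quasiMeasurePreserving_fst.ae h1).and (Measure.quasiMeasurePreserving_snd.ae h2)
  rw [← slotLaw_zero_succ k, ← Measure.infinitePi_map_eval (M.slotLaw 0) (k + 1)] at h3
  exact ae_of_ae_map (measurable_pi_apply (k + 1)).aemeasurable h3

/-- Whether slot `k` is busy depends on the slots before `k` only, hence is independent of the
channel state in slot `k`: a predictable weight. -/
lemma tendsto_average_busySlots (x : ℕ → E) (q : ℕ) (f : Bool → ℝ) :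
    ∀ᵐ s ∂Measure.infinitePi (M.slotLaw 0), Tendsto (fun n : ℕ =>
      (∑ k ∈ busySlots 0 n (q, x, s), (f (s k).2.1 -
        ∫ b, f b ∂bernoulliMeasure true false M.p₁)) / n) atTop (𝓝 0) := by
  set m := ∫ b, f b ∂bernoulliMeasure true false M.p₁ with hm
  let b : ℕ → (ℕ → Bool × Bool × E) → ℝ := fun k s => if queue (q, x, s) k ≠ 0 then 1 else 0
  have hb : ∀ k, Measurable (b k) := fun k => Measurable.ite
    (((measurable_queue k).comp (by fun_prop :
      Measurable fun s : ℕ → Bool × Bool × E => ((q, x, s) : Path E)))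
      (MeasurableSet.of_discrete (s := {0}ᶜ))) measurable_const measurable_const
  have hpred : ∀ k s s', (∀ j < k, s j = s' j) → b k s = b k s' := by
    rintro (_ | k) s s' h
    · rfl
    · have ha := agree_of_eq_upTo (n := k) (ω := ((q, x, s) : Path E)) (ω' := (q, x, s')) rfl rfl
        fun j hj => h j (Nat.lt_succ_of_le hj)
      simp only [b, ha.queue (k + 1) le_rfl]
  have h := ae_tendsto_predictable_average (κ := M.slotLaw 0) (ρ := M.mixedLaw true true)
    (b := b) (φ := fun y : Bool × Bool × E => f y.2.1 - m) (K := |f true - m| + |f false - m| + 1)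
    slotLaw_zero_succ hb (fun k s => by simp only [b]; split_ifs <;> simp) hpred
    ((Measurable.of_discrete (f := fun c : Bool => f c - m)).comp (by fun_prop)) (by positivity)
    (fun y => by
      have h1 := abs_le.1 (le_refl |f true - m|)
      have h2 := abs_le.1 (le_refl |f false - m|)
      have h3 := abs_nonneg (f true - m)
      have h4 := abs_nonneg (f false - m)
      cases y.2.1 <;> constructor <;> linarith [h1.1, h1.2, h2.1, h2.2])
    (by
      rw [integral_channel true true (fun c => f c - m), integral_sub
        (integrable_bernoulliMeasure _ _ _ _) (integrable_const _)]
      simp [hm])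
  filter_upwards [h] with s hs
  refine hs.congr fun n => ?_
  rw [sum_busySlots (q, x, s) (fun c => f c - m)]
  simp only [b, ite_mul, one_mul, zero_mul]

lemma tendsto_log_obsLR_aux (hr : 0 < M.r) (hr₁ : M.r < M.p₁) (hsample : M.sampleDiv ≠ ⊤)
    (hchannel : M.channelDiv ≠ ⊤) (x : ℕ → E) :
    ∀ᵐ s ∂Measure.infinitePi (M.slotLaw 0), ∀ q : ℕ, (∀ n, M.obsLR 0 n (q, x, s) ≠ ⊤) ∧
      Tendsto (fun n : ℕ => Real.log (M.obsLR 0 n (q, x, s)).toReal / n) atTop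
        (𝓝 M.infoNumber) := by
  have hr' : (0 : ℝ) < M.r := hr
  have hp : (M.r : ℝ) < M.p₁ := hr₁
  have hκ : ∀ k, M.slotLaw 0 (k + 1) = M.mixedLaw true true := slotLaw_zero_succ
  have F1 := ae_tendsto_average (κ := M.slotLaw 0) hκ
    (φ := fun y : Bool × Bool × E => if y.1 = true then (1 : ℝ) else 0)
    ((Measurable.of_discrete (f := fun c : Bool => if c = true then (1 : ℝ) else 0)).comp
      measurable_fst) (integrable_mixedLaw_of_bool (f := fun c _ => if c = true then 1 else 0) _ _)
  have F2 := ae_tendsto_average (κ := M.slotLaw 0) hκ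
    (φ := fun y : Bool × Bool × E => (if y.1 = true then (1 : ℝ) else 0) -
      if y.2.1 = true then 1 else 0)
    ((Measurable.of_discrete (f := fun c : Bool × Bool => (if c.1 = true then (1 : ℝ) else 0) -
      if c.2 = true then 1 else 0)).comp (by fun_prop :
        Measurable fun y : Bool × Bool × E => (y.1, y.2.1)))
    (integrable_mixedLaw_of_bool
      (f := fun c d => (if c = true then 1 else 0) - if d = true then 1 else 0) _ _)
  have F3 := ae_tendsto_average (κ := M.slotLaw 0) hκ
    (φ := fun y : Bool × Bool × E => if y.1 = true then M.sampleLLR y.2.2 else 0)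
    (Measurable.ite (measurable_fst (MeasurableSet.of_discrete (s := {true})))
      (M.measurable_sampleLLR.comp (by fun_prop)) measurable_const)
    (integrable_sample_mul (klDiv_ne_top_iff.1 hsample).2)
  have F4 := ae_all_iff.2 fun q => tendsto_average_busySlots (M := M) x q
    (fun c => if c = true then 1 else 0)
  have F5 := ae_all_iff.2 fun q => tendsto_average_busySlots (M := M) x q M.channelLLR
  rw [integral_sampling] at F1
  rw [integral_sub (integrable_mixedLaw_of_bool (f := fun c _ => if c = true then 1 else 0) _ _)
    (integrable_mixedLaw_of_bool (f := fun _ c => if c = true then 1 else 0) _ _),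
    integral_sampling, integral_channel true true (fun c => if c = true then 1 else 0),
    integral_bernoulli_ite] at F2
  rw [integral_sample_mul, integral_sampleLLR hsample] at F3
  simp only [integral_bernoulli_ite] at F4
  simp only [integral_channelLLR hchannel] at F5
  filter_upwards [F1, F2, F3, F4, F5, ae_slots_regular hsample hchannel] with s h1 h2 h3 h4 h5 h6
  intro q
  set ω : Path E := (q, x, s) with hω
  have hA : Tendsto (fun n : ℕ => (arrivalCount ω n : ℝ) / n) atTop (𝓝 (M.r : ℝ)) := by
    refine h1.congr fun n => ?_
    simp only [arrivalCount, arrival]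
    push_cast
    rfl
  have hW : Tendsto (fun n : ℕ => netInput ω n / n) atTop (𝓝 ((M.r : ℝ) - M.p₁)) := by
    refine h2.congr fun n => ?_
    simp only [netInput, arrival, channelState]
    push_cast
    rfl
  have hD := tendsto_lastDelivered_div (sub_nonpos.2 hp.le) hW hA
  have hB := tendsto_busySlots_div (hr'.trans hp).ne' hD (h4 q)
  have hC := tendsto_channelPart_div (f := M.channelLLR) hB (h5 q)
  have hX := tendsto_samplePart_div hr' (f := M.sampleLLR) hA hD h3
  have hreg : ∀ n, ∀ k ∈ Finset.Icc (0 + 1) n,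
      (M.channelLR (s k).2.1 ≠ 0 ∧ M.channelLR (s k).2.1 ≠ ⊤) ∧
      (M.sampleLR (s k).2.2 ≠ 0 ∧ M.sampleLR (s k).2.2 ≠ ⊤) := fun n k hk => by
    obtain ⟨j, rfl⟩ := Nat.exists_eq_add_of_le' (Finset.mem_Icc.1 hk).1
    exact h6 j
  have hb : ∀ n, ∀ k ∈ busySlots 0 n ω, M.channelLR (s k).2.1 ≠ 0 ∧ M.channelLR (s k).2.1 ≠ ⊤ :=
    fun n k hk => (hreg n k (Finset.mem_filter.1 hk).1).1
  have hd : ∀ n, ∀ k ∈ deliveredSlots 0 n ω,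
      M.sampleLR (s k).2.2 ≠ 0 ∧ M.sampleLR (s k).2.2 ≠ ⊤ :=
    fun n k hk => (hreg n k (Finset.mem_filter.1 hk).1).2
  refine ⟨fun n => ENNReal.mul_ne_top (ENNReal.prod_ne_top fun k hk => (hb n k hk).2)
    (ENNReal.prod_ne_top fun k hk => (hd n k hk).2), ?_⟩
  have hlim := hC.add hX
  have hI : (M.r : ℝ) / M.p₁ * M.channelDiv.toReal + M.r * M.sampleDiv.toReal = M.infoNumber := by
    unfold infoNumber; ring
  rw [hI] at hlim
  refine hlim.congr fun n => ?_
  rw [obsLR, partialLR, ENNReal.toReal_mul, ENNReal.toReal_prod, ENNReal.toReal_prod,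
    Real.log_mul, Real.log_prod, Real.log_prod, add_div]
  · rfl
  · exact fun k hk => ENNReal.toReal_ne_zero.2 (hd n k hk)
  · exact fun k hk => ENNReal.toReal_ne_zero.2 (hb n k hk)
  · exact Finset.prod_ne_zero_iff.2 fun k hk => ENNReal.toReal_ne_zero.2 (hb n k hk)
  · exact Finset.prod_ne_zero_iff.2 fun k hk => ENNReal.toReal_ne_zero.2 (hd n k hk)

/-- The ratio never reads the waiting values, nor the dummy slot `0`. -/
lemma obsLR_congr {ω ω' : Path E} (h1 : ω.1 = ω'.1) (h : ∀ k, ω.2.2 (k + 1) = ω'.2.2 (k + 1))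
    (n : ℕ) : M.obsLR 0 n ω = M.obsLR 0 n ω' := by
  have hq : ∀ k, queue ω (k + 1) = queue ω' (k + 1) := fun k => by
    induction k with
    | zero => exact h1
    | succ k ih => rw [queue_succ, queue_succ]; unfold outcome arrival; rw [ih, h]
  have hA : ∀ k, arrivalCount ω k = arrivalCount ω' k := fun k => by
    induction k with
    | zero => simp
    | succ k ih => rw [arrivalCount_succ, arrivalCount_succ, ih]; unfold arrival; rw [h]
  have hD : ∀ k, lastDelivered ω k = lastDelivered ω' k := fun k => by
    induction k with
    | zero => simp
    | succ k ih => rw [lastDelivered_succ, lastDelivered_succ, ih]; unfold outcome; rw [h, hq]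
  have hslot : ∀ k ∈ Finset.Icc (0 + 1) n, ω.2.2 k = ω'.2.2 k ∧ queue ω k = queue ω' k :=
    fun k hk => by
      obtain ⟨j, rfl⟩ := Nat.exists_eq_add_of_le' (Finset.mem_Icc.1 hk).1
      exact ⟨h j, hq j⟩
  have hb : busySlots 0 n ω = busySlots 0 n ω' :=
    Finset.filter_congr fun k hk => by rw [(hslot k hk).2]
  have hd : deliveredSlots 0 n ω = deliveredSlots 0 n ω' :=
    Finset.filter_congr fun k hk => by rw [(hslot k hk).1, h1, hA, hD]
  unfold obsLR partialLR
  rw [← hb, ← hd]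
  congr 1 <;> refine Finset.prod_congr rfl fun k hk => ?_ <;>
    rw [(hslot k (Finset.mem_filter.1 hk).1).1]

/-- Under the post-change law, the log-likelihood ratio of the observations grows at rate
`infoNumber`, whatever the initial queue. -/
theorem tendsto_log_obsLR (hr : 0 < M.r) (hr₁ : M.r < M.p₁) (hsample : M.sampleDiv ≠ ⊤)
    (hchannel : M.channelDiv ≠ ⊤) :
    ∀ᵐ s ∂Measure.infinitePi (M.slotLaw 0), ∀ (q : ℕ) (x : ℕ → E),
      (∀ n, M.obsLR 0 n (q, x, s) ≠ ⊤) ∧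
      Tendsto (fun n : ℕ => Real.log (M.obsLR 0 n (q, x, s)).toReal / n) atTop
        (𝓝 M.infoNumber) := by
  obtain ⟨e⟩ : Nonempty E := (M.f₀ : Measure E).nonempty_of_neZero
  -- As the waiting values play no role, one arbitrary sequence yields a single null set for all
  -- `x`; a union over uncountably many `x` is avoided.
  filter_upwards [tendsto_log_obsLR_aux hr hr₁ hsample hchannel fun _ => e] with s hs q x
  have h : ∀ n, M.obsLR 0 n (q, x, s) = M.obsLR 0 n (q, fun _ => e, s) := fun n =>
    obsLR_congr (ω := (q, x, s)) (ω' := (q, fun _ => e, s)) rfl (fun _ => rfl) n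
  simpa only [h] using hs q

theorem tendsto_logLR (hr : 0 < M.r) (hr₁ : M.r < M.p₁) (hsample : M.sampleDiv ≠ ⊤)
    (hchannel : M.channelDiv ≠ ⊤) :
    ∀ᵐ ω ∂M.law 0, Tendsto (fun n : ℕ => M.logLR 0 n ω / n) atTop (𝓝 M.infoNumber) := by
  have h1 : ∀ᵐ ω ∂M.law 0, ∀ (q : ℕ) (x : ℕ → E), (∀ n, M.obsLR 0 n (q, x, ω.2.2) ≠ ⊤) ∧
      Tendsto (fun n : ℕ => Real.log (M.obsLR 0 n (q, x, ω.2.2)).toReal / n) atTop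
        (𝓝 M.infoNumber) := by
    unfold law
    exact Measure.quasiMeasurePreserving_snd.ae (Measure.quasiMeasurePreserving_snd.ae
      (tendsto_log_obsLR hr hr₁ hsample hchannel))
  filter_upwards [h1, ae_all_iff.2 fun n => logLR_ae_eq hsample hchannel n] with ω h2 h3
  simpa only [h3] using (h2 ω.1 ω.2.1).2

/-- Large deviations of the log-likelihood ratio above its growth rate have small probability. -/
lemma tendsto_measure_obsLR_gt (hr : 0 < M.r) (hr₁ : M.r < M.p₁) (hsample : M.sampleDiv ≠ ⊤)
    (hchannel : M.channelDiv ≠ ⊤) (q : ℕ) (x : ℕ → E) {η : ℝ} (hη : 0 < η) :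
    Tendsto (fun n : ℕ => Measure.infinitePi (M.slotLaw 0)
      {s | ENNReal.ofReal (Real.exp ((M.infoNumber + η) * n)) < M.obsLR 0 n (q, x, s)})
      atTop (𝓝 0) := by
  have hm : ∀ n : ℕ, MeasurableSet
      {s | ENNReal.ofReal (Real.exp ((M.infoNumber + η) * n)) < M.obsLR 0 n (q, x, s)} := fun n =>
    measurableSet_lt measurable_const ((measurable_obsLR 0 n).comp (by fun_prop))
  have h := tendsto_measure_of_ae_tendsto_indicator atTop
    (μ := Measure.infinitePi (M.slotLaw 0)) (A := ∅) (B := Set.univ)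
    (As := fun n : ℕ => {s : ℕ → Bool × Bool × E |
      ENNReal.ofReal (Real.exp ((M.infoNumber + η) * n)) < M.obsLR 0 n (q, x, s)})
    MeasurableSet.empty hm .univ (measure_ne_top _ _) (by simp) ?_
  · simpa using h
  filter_upwards [tendsto_log_obsLR hr hr₁ hsample hchannel] with s hs
  obtain ⟨h1, h2⟩ := hs q x
  filter_upwards [h2.eventually_lt_const (lt_add_of_pos_right M.infoNumber hη),
    eventually_gt_atTop 0] with n hn hn0
  have hn0 : (0 : ℝ) < n := by exact_mod_cast hn0
  simp only [Set.mem_empty_iff_false, iff_false, not_lt]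
  rw [← ENNReal.ofReal_toReal (h1 n)]
  refine ENNReal.ofReal_le_ofReal ?_
  -- A vanishing ratio is treated apart: `Real.log 0 = 0` says nothing about it.
  rcases (ENNReal.toReal_nonneg (a := M.obsLR 0 n (q, x, s))).eq_or_lt with h0 | h0
  · rw [← h0]; positivity
  · rw [← Real.log_le_iff_le_exp h0]
    exact ((div_lt_iff₀ hn0).1 hn).le

/-! ### Independence of the next slot, and the stationary queue -/

/-- The slot `j + 1` is independent of the past. -/
lemma setLIntegral_pathLaw (μ : ℕ → Measure (Bool × Bool × E))
    [∀ k, IsProbabilityMeasure (μ k)] (j : ℕ) {B : Set (Path E)} (hB : MeasurableSet B)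
    (hB' : ∀ ω ω' : Path E, Agree j j ω ω' → (ω ∈ B ↔ ω' ∈ B)) {g : Bool × Bool × E → ℝ≥0∞}
    (hg : Measurable g) :
    ∫⁻ ω in B, g (ω.2.2 (j + 1)) ∂M.pathLaw μ = M.pathLaw μ B * ∫⁻ y, g y ∂μ (j + 1) := by
  have hgm : Measurable fun ω : Path E => g (ω.2.2 (j + 1)) := by fun_prop
  rw [← lintegral_indicator hB, lintegral_pathLaw_joinAt μ j (hgm.indicator hB)]
  have h : ∀ ω : Path E, ∫⁻ t, B.indicator (fun ω : Path E => g (ω.2.2 (j + 1)))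
      (ω.1, ω.2.1, joinAt j ω.2.2 t) ∂Measure.infinitePi (fun k => μ (j + 1 + k)) =
      B.indicator (fun _ => ∫⁻ y, g y ∂μ (j + 1)) ω := by
    intro ω
    have ha : ∀ t, ω ∈ B ↔ (ω.1, ω.2.1, joinAt j ω.2.2 t) ∈ B := fun t =>
      hB' _ _ (agree_of_eq_upTo rfl rfl fun k hk => (joinAt_of_le hk).symm)
    by_cases hω : ω ∈ B
    · rw [Set.indicator_of_mem hω]
      have h1 : ∀ t, B.indicator (fun ω : Path E => g (ω.2.2 (j + 1)))
          (ω.1, ω.2.1, joinAt j ω.2.2 t) = g (t 0) := fun t => by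
        rw [Set.indicator_of_mem ((ha t).1 hω)]
        exact congrArg g (joinAt_add j ω.2.2 t 0)
      simp_rw [h1]
      rw [← lintegral_map (μ := Measure.infinitePi fun k => μ (j + 1 + k)) (g := fun t => t 0) hg
        (by fun_prop), Measure.infinitePi_map_eval (fun k => μ (j + 1 + k)) 0, add_zero]
    · rw [Set.indicator_of_notMem hω]
      simp_rw [Set.indicator_of_notMem fun h => hω ((ha _).2 h)]
      simp
  simp_rw [h]
  rw [lintegral_indicator hB, setLIntegral_const, mul_comm]

lemma slotLaw_top (k : ℕ) : M.slotLaw ⊤ k = M.mixedLaw false false := by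
  rw [slotLaw_eq_mixedLaw]; simp

/-- Probability of an event of the past and an event of the slot `j + 1`, before the change. -/
lemma law_top_inter (j : ℕ) {B : Set (Path E)} (hB : MeasurableSet B)
    (hB' : ∀ ω ω' : Path E, Agree j j ω ω' → (ω ∈ B ↔ ω' ∈ B)) {G : Set (Bool × Bool)} :
    M.law ⊤ (B ∩ {ω | ((ω.2.2 (j + 1)).1, (ω.2.2 (j + 1)).2.1) ∈ G}) =
      M.law ⊤ B * M.mixedLaw false false {y | (y.1, y.2.1) ∈ G} := by
  have hG : MeasurableSet {y : Bool × Bool × E | (y.1, y.2.1) ∈ G} :=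
    (by fun_prop : Measurable fun y : Bool × Bool × E => (y.1, y.2.1)) (.of_discrete (s := G))
  have h := setLIntegral_pathLaw (M := M) (M.slotLaw ⊤) j hB hB'
    (g := {y : Bool × Bool × E | (y.1, y.2.1) ∈ G}.indicator 1) (measurable_one.indicator hG)
  rw [lintegral_indicator_one hG, slotLaw_top, ← law_eq_pathLaw] at h
  rw [← h, Set.inter_comm]
  have hG' : MeasurableSet {ω : Path E | ((ω.2.2 (j + 1)).1, (ω.2.2 (j + 1)).2.1) ∈ G} :=
    (by fun_prop : Measurable fun ω : Path E => ω.2.2 (j + 1)) hG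
  rw [← Measure.restrict_apply hG', ← lintegral_indicator_one hG']
  rfl

lemma mixedLaw_bool (c x : Bool) {G : Set (Bool × Bool)} : M.mixedLaw c x {y | (y.1, y.2.1) ∈ G} =
    ((bernoulliMeasure true false M.r).prod
      (bernoulliMeasure true false (if c then M.p₁ else M.p₀))) G := by
  unfold mixedLaw
  have h := (Measure.map_prod_map (bernoulliMeasure true false M.r)
    ((bernoulliMeasure true false (if c then M.p₁ else M.p₀)).prod
      ((if x then M.f₁ else M.f₀ : ProbabilityMeasure E) : Measure E))
    measurable_id measurable_fst)
  rw [Measure.map_id, Measure.map_fst_prod, measure_univ, one_smul] at h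
  rw [h, Measure.map_apply (by fun_prop) .of_discrete]
  rfl

lemma bernoulli_true (p : I) : bernoulliMeasure true false p {true} = ENNReal.ofReal p := by
  rw [← ofReal_measureReal,
    bernoulliMeasure_real_apply_of_mem_of_notMem _ .of_discrete (Set.mem_singleton _) (by simp)]

lemma bernoulli_false (p : I) : bernoulliMeasure true false p {false} = ENNReal.ofReal (1 - p) := by
  rw [← ofReal_measureReal,
    bernoulliMeasure_real_apply_of_notMem_of_mem _ .of_discrete (by simp) (Set.mem_singleton _)]

lemma mixedLaw_arrival :
    M.mixedLaw false false {y | (y.1, y.2.1) ∈ {z : Bool × Bool | z.1 = true}} =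
      ENNReal.ofReal M.r := by
  have : {z : Bool × Bool | z.1 = true} = {true} ×ˢ Set.univ := by ext; simp
  rw [mixedLaw_bool, this, Measure.prod_prod, bernoulli_true, measure_univ, mul_one]

lemma mixedLaw_channel :
    M.mixedLaw false false {y | (y.1, y.2.1) ∈ {z : Bool × Bool | z.2 = true}} =
      ENNReal.ofReal M.p₀ := by
  have : {z : Bool × Bool | z.2 = true} = Set.univ ×ˢ {true} := by ext; simp
  rw [mixedLaw_bool, this, Measure.prod_prod, measure_univ, one_mul]
  exact bernoulli_true _

lemma mixedLaw_singleton (a c : Bool) :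
    M.mixedLaw false false {y | (y.1, y.2.1) ∈ {z : Bool × Bool | z = (a, c)}} =
      bernoulliMeasure true false M.r {a} * bernoulliMeasure true false M.p₀ {c} := by
  have : {z : Bool × Bool | z = (a, c)} = {a} ×ˢ {c} := by ext ⟨_, _⟩; simp
  rw [mixedLaw_bool, this, Measure.prod_prod]
  rfl

lemma map_queue_one (ν : ℕ∞) : (M.law ν).map (fun ω => queue ω 1) = M.π := by
  unfold law
  change Measure.map Prod.fst _ = _
  rw [Measure.map_fst_prod, measure_univ, one_smul]

/-- Cut balance between the queue lengths `q + 1` and `q + 2` in steady state. -/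
lemma IsSteadyState.cut (hπ : M.IsSteadyState) (q : ℕ) :
    (M.π : Measure ℕ) {q + 2} * (ENNReal.ofReal (1 - M.r) * ENNReal.ofReal M.p₀) =
      (M.π : Measure ℕ) {q + 1} * (ENNReal.ofReal M.r * ENNReal.ofReal (1 - M.p₀)) := by
  let up : Set (Path E) := {ω | queue ω 1 = q + 1} ∩
    {ω | ((ω.2.2 (0 + 1)).1, (ω.2.2 (0 + 1)).2.1) ∈ {z : Bool × Bool | z = (true, false)}}
  let down : Set (Path E) := {ω | queue ω 1 = q + 2} ∩
    {ω | ((ω.2.2 (0 + 1)).1, (ω.2.2 (0 + 1)).2.1) ∈ {z : Bool × Bool | z = (false, true)}}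
  have hm : ∀ k n, MeasurableSet {ω : Path E | queue ω k = n} := fun k n =>
    measurable_queue k (MeasurableSet.of_discrete (s := {n}))
  have hm' : ∀ k, MeasurableSet {ω : Path E | queue ω k ≤ q + 1} := fun k =>
    measurable_queue k (MeasurableSet.of_discrete (s := Set.Iic (q + 1)))
  have hs : ∀ z : Bool × Bool, MeasurableSet {ω : Path E |
      ((ω.2.2 (0 + 1)).1, (ω.2.2 (0 + 1)).2.1) ∈ {w : Bool × Bool | w = z}} := fun z =>
    (by fun_prop : Measurable fun ω : Path E => ((ω.2.2 (0 + 1)).1, (ω.2.2 (0 + 1)).2.1))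
      (.of_discrete (s := {w : Bool × Bool | w = z}))
  have hP : ∀ n z, M.law ⊤ ({ω | queue ω 1 = n} ∩ {ω | ((ω.2.2 (0 + 1)).1, (ω.2.2 (0 + 1)).2.1) ∈
      {w : Bool × Bool | w = z}}) = (M.π : Measure ℕ) {n} *
      (bernoulliMeasure true false M.r {z.1} * bernoulliMeasure true false M.p₀ {z.2}) := by
    intro n z
    rw [law_top_inter 0 (hm 1 n) fun ω ω' h => by
      show queue ω 1 = n ↔ queue ω' 1 = n
      rw [h.queue 1 le_rfl], mixedLaw_singleton]
    congr 1
    rw [← map_queue_one (M := M) ⊤, Measure.map_apply (measurable_queue 1) .of_discrete]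
    rfl
  -- The queue moves by at most one per slot, so `up` and `down` are the only crossings of the cut.
  -- Stationarity then equates their probabilities. Both levels are positive, so an upward crossing
  -- needs a failed transmission.
  have hset : {ω : Path E | queue ω 2 ≤ q + 1} ∪ up = {ω : Path E | queue ω 1 ≤ q + 1} ∪ down := by
    ext ω
    have h2 : queue ω 2 = queue ω 1 - delivered (outcomeOf (queue ω 1) (ω.2.2 1).2.1) +
      arrival ω 1 := rfl
    rw [delivered_outcomeOf, arrival] at h2
    simp only [up, down, Set.mem_union, Set.mem_inter_iff, Set.mem_ofPred_eq, zero_add,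
      Prod.mk.injEq, h2]
    cases (ω.2.2 1).1 <;> cases (ω.2.2 1).2.1 <;> simp <;> (try split_ifs) <;> omega
  have hd1 : Disjoint {ω : Path E | queue ω 2 ≤ q + 1} up := by
    rw [Set.disjoint_left]
    intro ω h ⟨h1, h3⟩
    have h2 : queue ω 2 = queue ω 1 - delivered (outcomeOf (queue ω 1) (ω.2.2 1).2.1) +
      arrival ω 1 := rfl
    rw [delivered_outcomeOf, arrival] at h2
    simp only [Set.mem_ofPred_eq, zero_add, Prod.mk.injEq] at h h1 h3
    simp [h3.1, h3.2] at h2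
    omega
  have hd2 : Disjoint {ω : Path E | queue ω 1 ≤ q + 1} down := by
    rw [Set.disjoint_left]
    intro ω h ⟨h1, h3⟩
    simp only [Set.mem_ofPred_eq] at h h1
    omega
  have heq : M.law ⊤ {ω | queue ω 2 ≤ q + 1} = M.law ⊤ {ω | queue ω 1 ≤ q + 1} := by
    have h1 := congrArg (fun μ => μ (Set.Iic (q + 1))) (hπ.trans (map_queue_one (M := M) ⊤).symm)
    rwa [Measure.map_apply (measurable_queue 2) .of_discrete,
      Measure.map_apply (measurable_queue 1) .of_discrete] at h1
  have hmeas := congrArg (M.law ⊤) hset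
  rw [measure_union hd1 ((hm 1 _).inter (hs _)), measure_union hd2 ((hm 1 _).inter (hs _)), heq]
    at hmeas
  have := (ENNReal.add_right_inj (measure_ne_top _ _)).1 hmeas
  rw [hP, hP] at this
  simp only [bernoulli_true, bernoulli_false] at this
  exact this.symm

/-- The stationary queue length has a finite mean. -/
lemma IsSteadyState.lintegral_ne_top (hπ : M.IsSteadyState) (hr₀ : M.r < M.p₀) :
    ∫⁻ q, (q : ℝ≥0∞) ∂(M.π : Measure ℕ) ≠ ⊤ := by
  have hr0 : (0 : ℝ) ≤ M.r := M.r.2.1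
  have hp1 : (M.p₀ : ℝ) ≤ 1 := M.p₀.2.2
  have hrp : (M.r : ℝ) < M.p₀ := hr₀
  have hden : 0 < (1 - (M.r : ℝ)) * M.p₀ := mul_pos (by linarith) (by linarith)
  set a : ℝ := (M.r * (1 - M.p₀)) / ((1 - M.r) * M.p₀) with ha
  have ha0 : 0 ≤ a := div_nonneg (mul_nonneg hr0 (by linarith)) hden.le
  -- `r (1 - p₀) < (1 - r) p₀` is the same as `r < p₀`.
  have ha1 : a < 1 := by rw [ha, div_lt_one hden]; nlinarith
  have hgeo : ∀ q, (M.π : Measure ℕ) {q + 1} ≤ ENNReal.ofReal (a ^ q) := by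
    intro q
    induction q with
    | zero => simpa using prob_le_one
    | succ q ih =>
      have h := hπ.cut q
      rw [← ENNReal.ofReal_mul (by linarith), ← ENNReal.ofReal_mul hr0] at h
      have h0 : ENNReal.ofReal ((1 - M.r) * M.p₀) ≠ 0 := by simpa using hden
      refine (ENNReal.mul_le_mul_iff_left h0 ENNReal.ofReal_ne_top).1 (h.le.trans ?_)
      rw [show (M.r : ℝ) * (1 - M.p₀) = a * ((1 - M.r) * M.p₀) from
        (div_mul_cancel₀ _ hden.ne').symm, ENNReal.ofReal_mul ha0, ← mul_assoc, pow_succ,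
        ENNReal.ofReal_mul (pow_nonneg ha0 q)]
      gcongr
  rw [lintegral_countable']
  have hs := summable_pow_mul_geometric_of_norm_lt_one (R := ℝ) 1 (r := a)
    (by rwa [Real.norm_eq_abs, abs_of_nonneg ha0])
  have hs' : Summable fun q : ℕ => ((q : ℝ) + 1) * a ^ q := by
    have := hs.add (summable_geometric_of_lt_one ha0 ha1)
    refine this.congr fun q => ?_
    ring
  rw [tsum_eq_zero_add' ENNReal.summable]
  simp only [Nat.cast_zero, zero_mul, zero_add]
  refine ne_top_of_le_ne_top hs'.tsum_ofReal_ne_top (ENNReal.tsum_le_tsum fun q => ?_)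
  rw [ENNReal.ofReal_mul (by positivity)]
  gcongr
  · rw [ENNReal.ofReal_add (by positivity) zero_le_one]; simp
  · exact hgeo q

end Model

end NetQCD

/-! ### Idle slots before the stopping time -/

namespace NetQCD

lemma toENNReal_eq_tsum (t : ℕ∞) :
    (t : ℝ≥0∞) = ∑' j : ℕ, if ((j + 1 : ℕ) : ℕ∞) ≤ t then (1 : ℝ≥0∞) else 0 := by
  induction t with
  | top => simp
  | coe n =>
    rw [tsum_eq_sum (s := Finset.range n)]
    · rw [Finset.sum_congr rfl fun j hj => if_pos (by
        simpa only [Nat.cast_le] using Nat.succ_le_of_lt (Finset.mem_range.1 hj))]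
      simp
    · intro j hj
      rw [Finset.mem_range, not_lt] at hj
      exact if_neg (by simpa only [Nat.cast_le, not_le] using Nat.lt_succ_of_le hj)

/-- A finite stopping time lies in at most `m` of the windows `[j + 2, j + 1 + m]`, an infinite one
in none. This drives the pigeonhole over idle slots. -/
lemma tsum_window_le (t : ℕ∞) (m : ℕ) :
    ∑' j : ℕ, (if ((j + 2 : ℕ) : ℕ∞) ≤ t ∧ t ≤ ((j + 1 + m : ℕ) : ℕ∞) then (1 : ℝ≥0∞) else 0) ≤ m := by
  induction t with
  | top => simp
  | coe n =>
    simp only [Nat.cast_le]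
    rw [tsum_eq_sum (s := Finset.Ico (n - 1 - m) (n - 1)), ← Finset.sum_filter]
    · rw [Finset.sum_const, nsmul_eq_mul, mul_one]
      have h1 := Finset.card_filter_le (Finset.Ico (n - 1 - m) (n - 1))
        fun j => j + 2 ≤ n ∧ n ≤ j + 1 + m
      rw [Nat.card_Ico] at h1
      exact_mod_cast h1.trans (by omega)
    · intro j hj
      refine if_neg fun h => hj ?_
      rw [Finset.mem_Ico]
      omega

namespace Model

variable {E : Type*} [MeasurableSpace E] {M : Model E} {T : Path E → ℕ∞}

/-- The event that `T` has not occurred by the end of slot `j`. -/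
def notStopped (T : Path E → ℕ∞) (j : ℕ) : Set (Path E) := {ω | ((j + 1 : ℕ) : ℕ∞) ≤ T ω}

/-- The event that slot `j + 1` is idle and `T` does not occur by the end of this slot. -/
def idleNotStopped (T : Path E → ℕ∞) (j : ℕ) : Set (Path E) :=
  notStopped T (j + 1) ∩ {ω | queue ω (j + 1) = 0}

lemma measurableSet_notStopped {𝓗 : Filtration ℕ (inferInstance : MeasurableSpace (Path E))}
    (hT : IsStoppingTime 𝓗 T) (j : ℕ) : MeasurableSet[𝓗 j] (notStopped T j) := by
  have h : notStopped T j = {ω | T ω ≤ (j : ℕ∞)}ᶜ := by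
    ext ω
    simp only [notStopped, Set.mem_ofPred_eq, Set.mem_compl_iff, not_le]
    push_cast
    exact ENat.add_one_le_iff (ENat.natCast_ne_top j)
  rw [h]
  exact (hT j).compl

lemma measurableSet_queue_eq (k n : ℕ) : MeasurableSet {ω : Path E | queue ω k = n} :=
  measurable_queue k (MeasurableSet.of_discrete (s := {n}))

lemma notStopped_agree (hT : IsStoppingTime (augFiltration E) T) (j : ℕ) (ω ω' : Path E)
    (h : Agree j j ω ω') : ω ∈ notStopped T j ↔ ω' ∈ notStopped T j :=
  mem_iff_of_agree h (measurableSet_notStopped hT j)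

/-- Given survival up to slot `j`, the mean increment of the queue is `r - p₀` when it is nonempty
and `r` when it is empty. Terms are moved across the inequality so that everything stays in `ℝ≥0∞`.
-/
lemma drift_step (hT : IsStoppingTime (augFiltration E) T) (hr₀ : M.r < M.p₀) (j : ℕ) :
    ∫⁻ ω in notStopped T (j + 1), (queue ω (j + 2) : ℝ≥0∞) ∂M.law ⊤ +
        ENNReal.ofReal (M.p₀ - M.r) * M.law ⊤ (notStopped T j) ≤
      ∫⁻ ω in notStopped T j, (queue ω (j + 1) : ℝ≥0∞) ∂M.law ⊤ +
        ENNReal.ofReal M.p₀ * M.law ⊤ (notStopped T j ∩ {ω | queue ω (j + 1) = 0}) := by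
  have hB : MeasurableSet (notStopped T j) :=
    (augFiltration E).le j _ (measurableSet_notStopped hT j)
  set B := notStopped T j with hBdef
  have hag := notStopped_agree hT j
  have hmq : ∀ k, Measurable fun ω : Path E => (queue ω k : ℝ≥0∞) := fun k =>
    (Measurable.of_discrete (f := fun n : ℕ => (n : ℝ≥0∞))).comp (measurable_queue k)
  have hQ0 : MeasurableSet {ω : Path E | queue ω (j + 1) = 0} := measurableSet_queue_eq _ _
  have hA : MeasurableSet {ω : Path E | ((ω.2.2 (j + 1)).1, (ω.2.2 (j + 1)).2.1) ∈
      {z : Bool × Bool | z.1 = true}} :=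
    (by fun_prop : Measurable fun ω : Path E => ((ω.2.2 (j + 1)).1, (ω.2.2 (j + 1)).2.1))
      (.of_discrete (s := {z : Bool × Bool | z.1 = true}))
  have hC : MeasurableSet {ω : Path E | ((ω.2.2 (j + 1)).1, (ω.2.2 (j + 1)).2.1) ∈
      {z : Bool × Bool | z.2 = true}} :=
    (by fun_prop : Measurable fun ω : Path E => ((ω.2.2 (j + 1)).1, (ω.2.2 (j + 1)).2.1))
      (.of_discrete (s := {z : Bool × Bool | z.2 = true}))
  have hpt : ∀ ω : Path E, (queue ω (j + 2) : ℝ≥0∞) +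
      (({ω : Path E | queue ω (j + 1) = 0}ᶜ ∩ {ω : Path E |
        ((ω.2.2 (j + 1)).1, (ω.2.2 (j + 1)).2.1) ∈ {z : Bool × Bool | z.2 = true}}).indicator 1 ω) =
      (queue ω (j + 1) : ℝ≥0∞) + {ω : Path E | ((ω.2.2 (j + 1)).1, (ω.2.2 (j + 1)).2.1) ∈
      {z : Bool × Bool | z.1 = true}}.indicator 1 ω := by
    intro ω
    have hq := queue_succ ω j
    have hle : delivered (outcome ω (j + 1)) ≤ queue ω (j + 1) := delivered_outcomeOf_le _ _
    have h1 : queue ω (j + 2) + delivered (outcome ω (j + 1)) =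
      queue ω (j + 1) + arrival ω (j + 1) := by omega
    have h2 : (queue ω (j + 2) : ℝ≥0∞) + (delivered (outcome ω (j + 1)) : ℕ) =
      queue ω (j + 1) + (arrival ω (j + 1) : ℕ) := by exact_mod_cast h1
    convert h2 using 2
    · unfold outcome
      rw [delivered_outcomeOf]
      by_cases h3 : queue ω (j + 1) = 0 <;> cases h4 : (ω.2.2 (j + 1)).2.1 <;>
        simp [h3, h4]
    · unfold arrival
      cases h4 : (ω.2.2 (j + 1)).1 <;> simp [h4]
  have hint := lintegral_congr (μ := (M.law ⊤).restrict B) hpt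
  rw [lintegral_add_left (hmq _), lintegral_add_left (hmq _),
    lintegral_indicator_one (hQ0.compl.inter hC), lintegral_indicator_one hA,
    Measure.restrict_apply (hQ0.compl.inter hC), Measure.restrict_apply hA,
    Set.inter_comm _ B, Set.inter_comm _ B, ← Set.inter_assoc,
    law_top_inter j hB hag, mixedLaw_arrival, law_top_inter j (hB.inter hQ0.compl) ?_,
    mixedLaw_channel] at hint
  swap
  · intro ω ω' h
    have h1 : ω ∈ {ω : Path E | queue ω (j + 1) = 0}ᶜ ↔
        ω' ∈ {ω : Path E | queue ω (j + 1) = 0}ᶜ := by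
      simp only [Set.mem_compl_iff, Set.mem_ofPred_eq, h.queue (j + 1) le_rfl]
    exact and_congr (hag ω ω' h) h1
  have hsub : ∫⁻ ω in notStopped T (j + 1), (queue ω (j + 2) : ℝ≥0∞) ∂M.law ⊤ ≤
      ∫⁻ ω in B, (queue ω (j + 2) : ℝ≥0∞) ∂M.law ⊤ := by
    refine lintegral_mono_set fun ω hω => ?_
    have h1 : ((j + 1 + 1 : ℕ) : ℕ∞) ≤ T ω := hω
    exact le_trans (by exact_mod_cast Nat.le_succ _) h1
  have hsplit : M.law ⊤ B = M.law ⊤ (B ∩ {ω : Path E | queue ω (j + 1) = 0}) +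
      M.law ⊤ (B ∩ {ω : Path E | queue ω (j + 1) = 0}ᶜ) := by
    rw [← Set.sdiff_eq, measure_inter_add_sdiff B hQ0]
  set x := M.law ⊤ (B ∩ {ω : Path E | queue ω (j + 1) = 0})
  set y := M.law ⊤ (B ∩ {ω : Path E | queue ω (j + 1) = 0}ᶜ)
  have hpr : ENNReal.ofReal M.p₀ = ENNReal.ofReal (M.p₀ - M.r) + ENNReal.ofReal M.r := by
    rw [← ENNReal.ofReal_add (sub_nonneg.2 hr₀.le) M.r.2.1, sub_add_cancel]
  -- Adding `r ℙ_∞(B)` to both sides replaces the cancellation of the arrivals by a comparison of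
  -- sums without subtraction.
  refine (ENNReal.add_le_add_iff_right (a := M.law ⊤ B * ENNReal.ofReal M.r)
    (ENNReal.mul_ne_top (measure_ne_top _ _) ENNReal.ofReal_ne_top)).1 ?_
  calc _ ≤ ∫⁻ ω in B, (queue ω (j + 2) : ℝ≥0∞) ∂M.law ⊤ +
        ENNReal.ofReal (M.p₀ - M.r) * M.law ⊤ B + M.law ⊤ B * ENNReal.ofReal M.r := by gcongr
    _ = (∫⁻ ω in B, (queue ω (j + 2) : ℝ≥0∞) ∂M.law ⊤ + y * ENNReal.ofReal M.p₀) +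
        ENNReal.ofReal M.p₀ * x := by
      have : ENNReal.ofReal (M.p₀ - M.r) * M.law ⊤ B + M.law ⊤ B * ENNReal.ofReal M.r =
        y * ENNReal.ofReal M.p₀ + ENNReal.ofReal M.p₀ * x := by
        rw [mul_comm (M.law ⊤ B), ← add_mul, ← hpr, hsplit]; ring
      rw [add_assoc, this, ← add_assoc]
    _ = _ := by rw [hint, add_right_comm]

/-- The expected number of slots before `T` is controlled by that of idle slots before `T`. -/
lemma mul_lintegral_le (hT : IsStoppingTime (augFiltration E) T) (hr₀ : M.r < M.p₀) :
    ENNReal.ofReal (M.p₀ - M.r) * ∫⁻ ω, (T ω : ℝ≥0∞) ∂M.law ⊤ ≤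
      ∫⁻ q, (q : ℝ≥0∞) ∂(M.π : Measure ℕ) + ENNReal.ofReal M.p₀ *
        ∑' j, M.law ⊤ (notStopped T j ∩ {ω | queue ω (j + 1) = 0}) := by
  have hB : ∀ j, MeasurableSet (notStopped T j) := fun j =>
    (augFiltration E).le j _ (measurableSet_notStopped hT j)
  have hE : ∫⁻ ω, (T ω : ℝ≥0∞) ∂M.law ⊤ = ∑' j, M.law ⊤ (notStopped T j) := by
    simp_rw [toENNReal_eq_tsum]
    rw [lintegral_tsum]
    · refine tsum_congr fun j => ?_
      rw [← lintegral_indicator_one (hB j)]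
      exact lintegral_congr fun ω => by simp [Set.indicator_apply, notStopped]
    · intro j
      exact (Measurable.ite (hB j) measurable_const measurable_const).aemeasurable
  have hfin : ∀ N, ∫⁻ ω in notStopped T N, (queue ω (N + 1) : ℝ≥0∞) ∂M.law ⊤ +
      ∑ j ∈ Finset.range N, ENNReal.ofReal (M.p₀ - M.r) * M.law ⊤ (notStopped T j) ≤
      ∫⁻ q, (q : ℝ≥0∞) ∂(M.π : Measure ℕ) + ∑ j ∈ Finset.range N, ENNReal.ofReal M.p₀ *
        M.law ⊤ (notStopped T j ∩ {ω | queue ω (j + 1) = 0}) := by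
    intro N
    induction N with
    | zero =>
      simp only [Finset.range_zero, Finset.sum_empty, add_zero, zero_add]
      refine (setLIntegral_le_lintegral _ _).trans (le_of_eq ?_)
      rw [← map_queue_one (M := M) ⊤, lintegral_map .of_discrete (measurable_queue 1)]
    | succ N ih =>
      rw [Finset.sum_range_succ, Finset.sum_range_succ]
      have h := drift_step hT hr₀ N
      calc _ = (∫⁻ ω in notStopped T (N + 1), (queue ω (N + 2) : ℝ≥0∞) ∂M.law ⊤ +
            ENNReal.ofReal (M.p₀ - M.r) * M.law ⊤ (notStopped T N)) +
            ∑ j ∈ Finset.range N, ENNReal.ofReal (M.p₀ - M.r) * M.law ⊤ (notStopped T j) := by ring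
        _ ≤ _ := add_le_add_left h _
        _ = (∫⁻ ω in notStopped T N, (queue ω (N + 1) : ℝ≥0∞) ∂M.law ⊤ +
            ∑ j ∈ Finset.range N, ENNReal.ofReal (M.p₀ - M.r) * M.law ⊤ (notStopped T j)) +
            ENNReal.ofReal M.p₀ * M.law ⊤ (notStopped T N ∩ {ω | queue ω (N + 1) = 0}) := by ring
        _ ≤ _ := add_le_add_left ih _
        _ = _ := by ring
  rw [hE, ← ENNReal.tsum_mul_left, ENNReal.tsum_eq_iSup_nat]
  refine iSup_le fun N => (le_add_self.trans (hfin N)).trans ?_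
  rw [← Finset.mul_sum]
  gcongr
  exact ENNReal.sum_le_tsum _

/-- If `T` has a large mean, then for some idle slot `j + 1` before `T` the conditional probability
that `T` occurs within the following `m` slots is small. -/
lemma exists_quiet_slot (hT : IsStoppingTime (augFiltration E) T) (hr₀ : M.r < M.p₀) (m : ℕ)
    {ε : ℝ≥0∞} (hε : ε ≠ 0) (hε' : ε ≠ ⊤)
    (h : ∫⁻ q, (q : ℝ≥0∞) ∂(M.π : Measure ℕ) + ENNReal.ofReal M.p₀ * (1 + m / ε) <
      ENNReal.ofReal (M.p₀ - M.r) * ∫⁻ ω, (T ω : ℝ≥0∞) ∂M.law ⊤) :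
    ∃ j, M.law ⊤ (idleNotStopped T j ∩ {ω | T ω ≤ ((j + 1 + m : ℕ) : ℕ∞)}) <
      ε * M.law ⊤ (idleNotStopped T j) := by
  by_contra! hcon
  refine absurd ((mul_lintegral_le hT hr₀).trans ?_) h.not_ge
  have hB : ∀ j, MeasurableSet (notStopped T j) := fun j =>
    (augFiltration E).le j _ (measurableSet_notStopped hT j)
  have hTle : ∀ n : ℕ, MeasurableSet {ω | T ω ≤ (n : ℕ∞)} := fun n =>
    (augFiltration E).le n _ (hT n)
  have hwin : ∀ j, M.law ⊤ (idleNotStopped T j ∩ {ω | T ω ≤ ((j + 1 + m : ℕ) : ℕ∞)}) ≤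
      ∫⁻ ω, (if ((j + 2 : ℕ) : ℕ∞) ≤ T ω ∧ T ω ≤ ((j + 1 + m : ℕ) : ℕ∞) then (1 : ℝ≥0∞) else 0)
        ∂M.law ⊤ := by
    intro j
    have hs := (hB (j + 1)).inter (hTle (j + 1 + m))
    refine (measure_mono (Set.inter_subset_inter_left _ Set.inter_subset_left)).trans (le_of_eq ?_)
    rw [← lintegral_indicator_one hs]
    exact lintegral_congr fun ω => by simp [Set.indicator_apply, notStopped, add_assoc, one_add_one_eq_two]
  have hsum : ∑' j, M.law ⊤ (idleNotStopped T j) ≤ m / ε := by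
    rw [ENNReal.le_div_iff_mul_le (Or.inl hε) (Or.inl hε'), mul_comm, ← ENNReal.tsum_mul_left]
    calc _ ≤ ∑' j, ∫⁻ ω, (if ((j + 2 : ℕ) : ℕ∞) ≤ T ω ∧ T ω ≤ ((j + 1 + m : ℕ) : ℕ∞)
            then (1 : ℝ≥0∞) else 0) ∂M.law ⊤ :=
          ENNReal.tsum_le_tsum fun j => (hcon j).trans (hwin j)
      _ = ∫⁻ ω, ∑' j : ℕ, (if ((j + 2 : ℕ) : ℕ∞) ≤ T ω ∧ T ω ≤ ((j + 1 + m : ℕ) : ℕ∞)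
            then (1 : ℝ≥0∞) else 0) ∂M.law ⊤ := (lintegral_tsum fun j =>
          (Measurable.ite ((hB (j + 1)).inter (hTle (j + 1 + m))) measurable_const
            measurable_const).aemeasurable).symm
      _ ≤ ∫⁻ _, (m : ℝ≥0∞) ∂M.law ⊤ := lintegral_mono fun ω => tsum_window_le _ _
      _ = m := by simp
  -- The event that `T` is exactly `j + 1` must be split off, since `idleNotStopped` requires
  -- survival of the idle slot itself. These events are disjoint and contribute at most `1`.
  have hidle : ∑' j, M.law ⊤ (notStopped T j ∩ {ω | queue ω (j + 1) = 0}) ≤ 1 + m / ε := by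
    have h1 : ∀ j, M.law ⊤ (notStopped T j ∩ {ω | queue ω (j + 1) = 0}) ≤
        M.law ⊤ {ω | T ω = ((j + 1 : ℕ) : ℕ∞)} + M.law ⊤ (idleNotStopped T j) := by
      intro j
      refine (measure_mono ?_).trans (measure_union_le _ _)
      rintro ω ⟨h1, h2⟩
      have h1 : ((j + 1 : ℕ) : ℕ∞) ≤ T ω := h1
      rcases h1.eq_or_lt with h3 | h3
      · exact Or.inl h3.symm
      · refine Or.inr ⟨?_, h2⟩
        show ((j + 1 + 1 : ℕ) : ℕ∞) ≤ T ω
        rw [Nat.cast_succ (j + 1)]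
        exact Order.add_one_le_of_lt h3
    refine (ENNReal.tsum_le_tsum h1).trans ?_
    rw [ENNReal.tsum_add]
    gcongr
    rw [← measure_iUnion]
    · exact prob_le_one
    · intro i j hij
      rw [Function.onFun, Set.disjoint_left]
      intro ω (hi : T ω = _) (hj : T ω = _)
      rw [hi, Nat.cast_inj] at hj
      omega
    · intro j
      exact (augFiltration E).le (j + 1) _ (hT.measurableSet_eq (j + 1))
  gcongr

end Model

end NetQCD

/-! ### Lower bound on the delay for a fixed window -/

namespace NetQCD

namespace Model

variable {E : Type*} [MeasurableSpace E] {M : Model E} {T : Path E → ℕ∞}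

lemma obsLR_of_agree {ν n : ℕ} {ω ω' : Path E} (h : Agree ν n ω ω') :
    M.obsLR ν n ω = M.obsLR ν n ω' := by
  unfold obsLR partialLR
  rw [← h.busySlots, ← h.deliveredSlots]
  congr 1
  · exact Finset.prod_congr rfl fun k hk => by rw [h.channel k hk]
  · exact Finset.prod_congr rfl fun k hk => by rw [h.value k hk]

lemma law_eq_law_top (hsample : M.sampleDiv ≠ ⊤) (hchannel : M.channelDiv ≠ ⊤) {ν : ℕ}
    {B : Set (Path E)} (hB : MeasurableSet[augFiltration E ν] B) : M.law ν B = M.law ⊤ B := by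
  rw [law_apply hsample hchannel ν ν ((augFiltration E).le ν _ hB)
    fun ω ω' h => mem_iff_of_agree h hB]
  have h : ∀ ω, M.obsLR ν ν ω = 1 := fun ω => by
    simp [obsLR, partialLR, busySlots, deliveredSlots]
  simp [h]

/-- Change of measure on the part of an event where the likelihood ratio is at most `c`. -/
lemma law_inter_obsLR_le (hsample : M.sampleDiv ≠ ⊤) (hchannel : M.channelDiv ≠ ⊤) (ν n : ℕ)
    {B : Set (Path E)} (hB : MeasurableSet[augFiltration E n] B) (c : ℝ≥0∞) :
    M.law ν (B ∩ {ω | M.obsLR ν n ω ≤ c}) ≤ c * M.law ⊤ B := by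
  have hL : MeasurableSet {ω | M.obsLR ν n ω ≤ c} :=
    measurableSet_le (measurable_obsLR ν n) measurable_const
  have hBm := (augFiltration E).le n _ hB
  rw [law_apply hsample hchannel ν n (hBm.inter hL) fun ω ω' h => and_congr
    (mem_iff_of_agree h hB) (by simp only [Set.mem_ofPred_eq, obsLR_of_agree h])]
  calc _ ≤ ∫⁻ _ in B ∩ {ω | M.obsLR ν n ω ≤ c}, c ∂M.law ⊤ :=
        setLIntegral_mono' (hBm.inter hL) fun ω hω => hω.2
    _ = c * M.law ⊤ (B ∩ {ω | M.obsLR ν n ω ≤ c}) := setLIntegral_const _ _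
    _ ≤ _ := by gcongr; exact Set.inter_subset_left

/-- The probability, under the post-change law and with initial queue `q`, that the likelihood
ratio after `n` slots exceeds `c`. -/
noncomputable def exceedProb (M : Model E) (x : ℕ → E) (n : ℕ) (c : ℝ≥0∞) (q : ℕ) : ℝ≥0∞ :=
  Measure.infinitePi (M.slotLaw 0) {s | c < M.obsLR 0 n (q, x, s)}

lemma measurableSet_exceed (x : ℕ → E) (n : ℕ) (c : ℝ≥0∞) (q : ℕ) :
    MeasurableSet {s | c < M.obsLR 0 n (q, x, s)} :=
  measurableSet_lt measurable_const ((measurable_obsLR 0 n).comp (by fun_prop))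

/-- Markov property at the change: given the path up to `ν`, the future is a fresh post-change
sequence, and the ratio depends on the past only through `Q_{ν+1}`. This works for any `x`, as the
waiting values are not read. -/
lemma lintegral_exceed_shift (x : ℕ → E) (ν n : ℕ) (c : ℝ≥0∞) (ω : Path E) :
    ∫⁻ t, {ω' : Path E | c < M.obsLR ν (ν + n) ω'}.indicator 1 (ω.1, ω.2.1, joinAt ν ω.2.2 t)
      ∂Measure.infinitePi (fun k => M.slotLaw ν (ν + 1 + k)) =
      M.exceedProb x n c (queue ω (ν + 1)) := by
  have hlaw : ∀ k, M.slotLaw ν (ν + 1 + k) = M.slotLaw 0 (0 + 1 + k) := fun k => by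
    have h1 : ¬ ((ν + 1 + k : ℕ) : ℕ∞) ≤ ν := by rw [Nat.cast_le]; omega
    rw [show 0 + 1 + k = k + 1 by ring, slotLaw_zero_succ, slotLaw_eq_mixedLaw]
    simp only [h1, not_false_eq_true, decide_true]
  simp_rw [hlaw]
  unfold exceedProb
  rw [← lintegral_indicator_one (measurableSet_exceed x n c _),
    lintegral_infinitePi_joinAt (M.slotLaw 0) 0
      (measurable_one.indicator (measurableSet_exceed x n c _))]
  have h : ∀ a t : ℕ → Bool × Bool × E,
      {s | c < M.obsLR 0 n (queue ω (ν + 1), x, s)}.indicator (1 : (ℕ → Bool × Bool × E) → ℝ≥0∞)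
        (joinAt 0 a t) =
      {ω' : Path E | c < M.obsLR ν (ν + n) ω'}.indicator 1 (ω.1, ω.2.1, joinAt ν ω.2.2 t) := by
    intro a t
    have ha : Agree ν ν ω (ω.1, ω.2.1, joinAt ν ω.2.2 t) :=
      agree_of_eq_upTo rfl rfl fun k hk => (joinAt_of_le hk).symm
    have h1 : M.obsLR ν (ν + n) (ω.1, ω.2.1, joinAt ν ω.2.2 t) =
        M.obsLR 0 n (queue ω (ν + 1), x, joinAt 0 a t) := by
      rw [obsLR_shift]
      refine obsLR_congr (ha.queue (ν + 1) le_rfl).symm (fun k => ?_) n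
      have h2 := joinAt_add ν ω.2.2 t k
      have h3 := joinAt_add 0 a t k
      rw [show 0 + 1 + k = k + 1 by ring] at h3
      rw [show ν + 1 + k = ν + (k + 1) by ring] at h2
      exact h2.trans h3.symm
    simp only [Set.indicator_apply, Set.mem_ofPred_eq, h1, Pi.one_apply]
  simp_rw [h]
  simp

/-- With the queue at most `2`, the three possible initial queues are summed, giving a bound uniform
over `B`. -/
lemma law_inter_obsLR_gt (x : ℕ → E) (ν n : ℕ) {B : Set (Path E)}
    (hB : MeasurableSet[augFiltration E ν] B) (hq : ∀ ω ∈ B, queue ω (ν + 1) ≤ 2) (c : ℝ≥0∞) :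
    M.law ν (B ∩ {ω | c < M.obsLR ν (ν + n) ω}) ≤
      (∑ q ∈ Finset.range 3, M.exceedProb x n c q) * M.law ν B := by
  have hL : MeasurableSet {ω | c < M.obsLR ν (ν + n) ω} :=
    measurableSet_lt measurable_const (measurable_obsLR ν (ν + n))
  have hBm := (augFiltration E).le ν _ hB
  rw [← lintegral_indicator_one (hBm.inter hL), law_eq_pathLaw, lintegral_pathLaw_joinAt _ ν
    (measurable_one.indicator (hBm.inter hL)), ← law_eq_pathLaw, ← lintegral_indicator_one hBm,
    ← lintegral_const_mul _ (measurable_one.indicator hBm)]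
  refine lintegral_mono fun ω => ?_
  have ha : ∀ t, ω ∈ B ↔ (ω.1, ω.2.1, joinAt ν ω.2.2 t) ∈ B := fun t =>
    mem_iff_of_agree (ω := ω) (ω' := (ω.1, ω.2.1, joinAt ν ω.2.2 t))
      (agree_of_eq_upTo rfl rfl fun k hk => (joinAt_of_le hk).symm) hB
  by_cases hω : ω ∈ B
  · have h1 : ∀ t, (B ∩ {ω | c < M.obsLR ν (ν + n) ω}).indicator (1 : Path E → ℝ≥0∞)
        (ω.1, ω.2.1, joinAt ν ω.2.2 t) =
        {ω' : Path E | c < M.obsLR ν (ν + n) ω'}.indicator 1 (ω.1, ω.2.1, joinAt ν ω.2.2 t) :=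
      fun t => by
        by_cases h : (ω.1, ω.2.1, joinAt ν ω.2.2 t) ∈ {ω | c < M.obsLR ν (ν + n) ω}
        · rw [Set.indicator_of_mem (Set.mem_inter ((ha t).1 hω) h), Set.indicator_of_mem h]
        · rw [Set.indicator_of_notMem fun h' => h h'.2, Set.indicator_of_notMem h]
    simp_rw [h1]
    rw [lintegral_exceed_shift x, Set.indicator_of_mem hω, Pi.one_apply, mul_one]
    exact Finset.single_le_sum (f := fun q => M.exceedProb x n c q) (fun _ _ => zero_le)
      (Finset.mem_range.2 (Nat.lt_succ_of_le (hq ω hω)))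
  · have h1 : ∀ t, (B ∩ {ω | c < M.obsLR ν (ν + n) ω}).indicator (1 : Path E → ℝ≥0∞)
        (ω.1, ω.2.1, joinAt ν ω.2.2 t) = 0 :=
      fun t => Set.indicator_of_notMem (fun h => hω ((ha t).2 h.1)) _
    simp_rw [h1]
    simp

/-- Observations that refine neither more than the augmented filtration nor less than what is
needed to recognize idle slots. -/
structure Observable (𝓗 : Filtration ℕ (inferInstance : MeasurableSpace (Path E))) : Prop where
  le_aug : ∀ n, 𝓗 n ≤ augFiltration E n
  idle : ∀ k, MeasurableSet[𝓗 (k + 1)] {ω | queue ω (k + 1) = 0}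

variable (E) in
lemma observable_aug : Observable (augFiltration E) where
  le_aug _ := le_rfl
  idle k := (measurable_aug (Nat.le_add_left 1 k) le_rfl).fst (MeasurableSet.of_discrete (s := {0}))

variable (E) in
lemma observable_obs : Observable (obsFiltration E) where
  le_aug n := by
    refine sup_le le_sup_left (iSup₂_le fun k hk => ?_)
    rw [← measurable_iff_comap_le]
    exact (measurable_aug hk.1 hk.2).snd
  idle k := by
    have h : Measurable[obsFiltration E (k + 1)]
        fun ω : Path E => (outcome ω (k + 1), received ω (k + 1)) :=
      (comap_measurable (fun ω : Path E => (outcome ω (k + 1), received ω (k + 1)))).mono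
        (le_sup_of_le_right (le_iSup₂_of_le (k + 1) ⟨Nat.le_add_left 1 k, le_rfl⟩ le_rfl)) le_rfl
    have h1 : {ω : Path E | queue ω (k + 1) = 0} =
        (fun ω => outcome ω (k + 1)) ⁻¹' {Outcome.idle} := by
      ext ω
      simp only [Set.mem_ofPred_eq, Set.mem_preimage, Set.mem_singleton_iff, outcome, outcomeOf]
      split_ifs <;> simp_all
    rw [h1]
    exact h.fst .of_discrete

variable {𝓗 : Filtration ℕ (inferInstance : MeasurableSpace (Path E))}

lemma Observable.isStoppingTime (h𝓗 : Observable 𝓗) (hT : IsStoppingTime 𝓗 T) :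
    IsStoppingTime (augFiltration E) T := fun i => h𝓗.le_aug i _ (hT i)

/-- The worst-case delay is at least the conditional mean delay on an event of the past. -/
lemma setLIntegral_le_worstDelay (ν : ℕ) (hν : 1 ≤ ν) {H : Set (Path E)}
    (hH : MeasurableSet[𝓗 (ν - 1)] H) :
    ∫⁻ ω in H, ((T ω + 1 - (ν : ℕ∞) : ℕ∞) : ℝ≥0∞) ∂M.law ν ≤ M.worstDelay 𝓗 T * M.law ν H := by
  rw [← setLIntegral_condLExp (𝓗.le (ν - 1)) (M.law ν) _ hH, ← setLIntegral_const]
  refine lintegral_mono_ae (ae_restrict_of_ae ?_)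
  filter_upwards [ENNReal.ae_le_essSup (μ := M.law ν) (condLExp (𝓗 (ν - 1)) (M.law ν)
    fun ω => ((T ω + 1 - (ν : ℕ∞) : ℕ∞) : ℝ≥0∞))] with ω hω
  exact hω.trans (le_iSup₂_of_le (f := fun (ν : ℕ) (_ : 1 ≤ ν) => essSup
    (condLExp (𝓗 (ν - 1)) (M.law ν) fun ω => ((T ω + 1 - (ν : ℕ∞) : ℕ∞) : ℝ≥0∞)) (M.law ν))
    ν hν le_rfl)

/-- The change is put at `ν = j + 2`, with slot `j + 1` the quiet idle slot, so that the
conditioning event belongs to `𝓗 (ν - 1)`. -/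
lemma le_worstDelay (h𝓗 : Observable 𝓗) (hT : IsStoppingTime 𝓗 T) (hsample : M.sampleDiv ≠ ⊤)
    (hchannel : M.channelDiv ≠ ⊤) (hr₀ : M.r < M.p₀) (x : ℕ → E) (n : ℕ) {ε c : ℝ≥0∞} (hε : ε ≠ 0)
    (hε' : ε ≠ ⊤)
    (h : ∫⁻ q, (q : ℝ≥0∞) ∂(M.π : Measure ℕ) + ENNReal.ofReal M.p₀ * (1 + (n + 1 : ℕ) / ε) <
      ENNReal.ofReal (M.p₀ - M.r) * ∫⁻ ω, (T ω : ℝ≥0∞) ∂M.law ⊤) :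
    (n + 1 : ℕ) * (1 - (c * ε + ∑ q ∈ Finset.range 3, M.exceedProb x n c q)) ≤
      M.worstDelay 𝓗 T := by
  have hT' := h𝓗.isStoppingTime hT
  obtain ⟨j, hj⟩ := exists_quiet_slot hT' hr₀ (n + 1) hε hε' h
  set H := idleNotStopped T j with hHdef
  have hH : MeasurableSet[𝓗 (j + 1)] H :=
    (measurableSet_notStopped hT (j + 1)).inter (h𝓗.idle j)
  have hHa : MeasurableSet[augFiltration E (j + 2)] H :=
    (augFiltration E).mono (Nat.le_succ _) _ (h𝓗.le_aug _ _ hH)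
  have hTn : MeasurableSet[augFiltration E (j + 2 + n)] {ω | T ω ≤ ((j + 2 + n : ℕ) : ℕ∞)} :=
    hT' (j + 2 + n)
  -- The window of `n + 1` slots consists of `ν` itself, still pre-change, and the `n` post-change
  -- slots read by `obsLR ν (ν + n)`.
  rw [show j + 1 + (n + 1) = j + 2 + n by ring] at hj
  set S := {ω | T ω ≤ ((j + 2 + n : ℕ) : ℕ∞)} with hS
  have hHS : MeasurableSet[augFiltration E (j + 2 + n)] (H ∩ S) :=
    ((augFiltration E).mono (Nat.le_add_right _ _) _ hHa).inter hTn
  have hHm := (augFiltration E).le _ _ hHa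
  have hSm := (augFiltration E).le _ _ hTn
  have hPH : M.law (j + 2 : ℕ) H = M.law ⊤ H := law_eq_law_top hsample hchannel hHa
  have hH0 : M.law (j + 2 : ℕ) H ≠ 0 := by
    rw [hPH]; intro h0; rw [h0, mul_zero] at hj; exact not_lt_zero hj
  -- From an empty queue in slot `j + 1`, at most one arrival in each of the slots `j + 1` and `j +
  -- 2`.
  have hq : ∀ ω ∈ H, queue ω (j + 2 + 1) ≤ 2 := by
    rintro ω ⟨-, hω⟩
    have h0 : queue ω (j + 1) = 0 := hω
    have h1 := queue_succ ω j
    have h2 := queue_succ ω (j + 1)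
    have h3 := arrival_le_one ω (j + 1)
    have h4 := arrival_le_one ω (j + 1 + 1)
    change queue ω (j + 1 + 1) = _ at h1
    change queue ω (j + 2 + 1) = _ at h2
    omega
  set β := ∑ q ∈ Finset.range 3, M.exceedProb x n c q with hβ
  have hbound : M.law (j + 2 : ℕ) (H ∩ S) ≤ (c * ε + β) * M.law (j + 2 : ℕ) H := by
    calc M.law (j + 2 : ℕ) (H ∩ S)
        ≤ M.law (j + 2 : ℕ) ((H ∩ S) ∩ {ω | M.obsLR (j + 2) (j + 2 + n) ω ≤ c}) +
          M.law (j + 2 : ℕ) (H ∩ {ω | c < M.obsLR (j + 2) (j + 2 + n) ω}) := by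
          refine (measure_mono fun ω hω => ?_).trans (measure_union_le _ _)
          rcases le_or_gt (M.obsLR (j + 2) (j + 2 + n) ω) c with h | h
          · exact Or.inl ⟨hω, h⟩
          · exact Or.inr ⟨hω.1, h⟩
      _ ≤ c * M.law ⊤ (H ∩ S) + β * M.law (j + 2 : ℕ) H :=
          add_le_add (law_inter_obsLR_le hsample hchannel _ _ hHS c)
            (law_inter_obsLR_gt x (j + 2) n hHa hq c)
      _ ≤ c * (ε * M.law ⊤ H) + β * M.law (j + 2 : ℕ) H := by gcongr
      _ = _ := by rw [hPH]; ring
  refine (ENNReal.mul_le_mul_iff_left hH0 (measure_ne_top _ _)).1 ?_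
  refine le_trans ?_ (setLIntegral_le_worstDelay (T := T) (j + 2) (by omega) hH)
  calc _ = (n + 1 : ℕ) * (M.law (j + 2 : ℕ) H - (c * ε + β) * M.law (j + 2 : ℕ) H) := by
        rw [mul_assoc, ENNReal.sub_mul fun _ _ => measure_ne_top _ _, one_mul]
    _ ≤ (n + 1 : ℕ) * M.law (j + 2 : ℕ) (H \ S) := by
        gcongr
        rw [tsub_le_iff_right]
        calc _ = M.law (j + 2 : ℕ) (H \ S) + M.law (j + 2 : ℕ) (H ∩ S) :=
              (measure_sdiff_add_inter H hSm).symm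
          _ ≤ _ := by gcongr
    _ = ∫⁻ _ in H \ S, ((n + 1 : ℕ) : ℝ≥0∞) ∂M.law (j + 2 : ℕ) := (setLIntegral_const _ _).symm
    _ ≤ ∫⁻ ω in H \ S, ((T ω + 1 - ((j + 2 : ℕ) : ℕ∞) : ℕ∞) : ℝ≥0∞) ∂M.law (j + 2 : ℕ) := by
        refine setLIntegral_mono' (hHm.diff hSm) fun ω hω => ?_
        have h1 : ((j + 2 + n : ℕ) : ℕ∞) < T ω := not_le.1 hω.2
        have h2 : ((n + 1 : ℕ) : ℕ∞) ≤ T ω + 1 - ((j + 2 : ℕ) : ℕ∞) := by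
          generalize T ω = t at h1
          induction t with
          | top => rw [top_add, ENat.top_sub_natCast]; exact le_top
          | coe t =>
            rw [Nat.cast_lt] at h1
            have : n + 1 ≤ t + 1 - (j + 2) := by omega
            exact_mod_cast this
        exact_mod_cast ENat.toENNReal_le.2 h2
    _ ≤ _ := lintegral_mono_set Set.sdiff_subset

end Model

end NetQCD

/-! ### Asymptotics in `γ` and choice of the constants -/

/-- A lower bound of the order `(a + o(1)) log γ` from lower bounds `(a - δ) log γ`. -/
lemma exists_tendsto_zero_of_forall_le {g : ℝ → ℝ≥0∞} {a : ℝ}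
    (h : ∀ δ > 0, ∀ᶠ γ in atTop, ENNReal.ofReal ((a - δ) * Real.log γ) ≤ g γ) :
    ∃ e : ℝ → ℝ, Tendsto e atTop (𝓝 0) ∧
      ∀ᶠ γ in atTop, ENNReal.ofReal ((a + e γ) * Real.log γ) ≤ g γ := by
  -- The normalized excess of `g` over `a`, truncated above at `0` because only a lower bound is
  -- available.
  refine ⟨fun γ => if g γ = ⊤ then 0 else min 0 ((g γ).toReal / Real.log γ - a), ?_, ?_⟩
  · rw [Metric.tendsto_nhds]
    intro ε hε
    filter_upwards [h (ε / 2) (by positivity), eventually_gt_atTop 1] with γ hγ h1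
    have hlog : 0 < Real.log γ := Real.log_pos h1
    split_ifs with htop
    · simpa using hε
    · rw [← ENNReal.ofReal_toReal htop, ENNReal.ofReal_le_ofReal_iff ENNReal.toReal_nonneg,
        ← le_div_iff₀ hlog] at hγ
      rw [Real.dist_0_eq_abs, abs_lt]
      exact ⟨lt_min (by linarith) (by linarith), (min_le_left _ _).trans_lt hε⟩
  · filter_upwards [eventually_gt_atTop 1] with γ h1
    have hlog : 0 < Real.log γ := Real.log_pos h1
    split_ifs with htop
    · rw [htop]; exact le_top
    · refine ENNReal.ofReal_le_of_le_toReal ?_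
      rw [← le_div_iff₀ hlog]
      linarith [min_le_right 0 ((g γ).toReal / Real.log γ - a)]

/-- Controls `c ε` with `c = exp(b m)`, `ε = K m / γ` and `m = ⌈a log γ⌉`: up to a factor linear in
`log γ` it is of order `γ ^ (b a - 1)`. -/
lemma tendsto_exp_ceil_log_div {a b K : ℝ} (ha : 0 < a) (hb : 0 < b) (hab : b * a < 1)
    (hK : 0 ≤ K) :
    Tendsto (fun γ : ℝ => Real.exp (b * ⌈a * Real.log γ⌉₊) * (K * ⌈a * Real.log γ⌉₊ / γ)) atTop
      (𝓝 0) := by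
  have h1 : Tendsto (fun L : ℝ => Real.exp b * K * ((a * L + 1) * Real.exp (-((1 - b * a) * L))))
      atTop (𝓝 0) := by
    have hc : 0 < 1 - b * a := by linarith
    have h2 := (Real.tendsto_pow_mul_exp_neg_atTop_nhds_zero 1).comp
      (tendsto_id.const_mul_atTop hc)
    have h3 := (Real.tendsto_pow_mul_exp_neg_atTop_nhds_zero 0).comp
      (tendsto_id.const_mul_atTop hc)
    have h4 := ((h2.const_mul (a / (1 - b * a))).add h3).const_mul (Real.exp b * K)
    simp only [mul_zero, add_zero] at h4
    refine h4.congr fun L => ?_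
    simp only [Function.comp, id, pow_one, pow_zero, one_mul]
    rw [← mul_assoc (a / _), ← mul_assoc (a / _), div_mul_cancel₀ _ hc.ne']
    ring
  refine squeeze_zero' ?_ ?_ (h1.comp Real.tendsto_log_atTop)
  · filter_upwards [eventually_gt_atTop 1] with γ hγ
    positivity
  · filter_upwards [eventually_gt_atTop 1] with γ hγ
    have hlog : 0 < Real.log γ := Real.log_pos hγ
    have hceil : (⌈a * Real.log γ⌉₊ : ℝ) ≤ a * Real.log γ + 1 :=
      (Nat.ceil_lt_add_one (by positivity)).le
    have hγ' : Real.exp (Real.log γ) = γ := Real.exp_log (by linarith)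
    calc _ ≤ Real.exp (b * (a * Real.log γ + 1)) * (K * (a * Real.log γ + 1) / γ) := by gcongr
      _ = Real.exp (b * (a * Real.log γ + 1)) *
          (K * (a * Real.log γ + 1) * Real.exp (-Real.log γ)) := by
        rw [Real.exp_neg, hγ', div_eq_mul_inv]
      _ = _ := by
        simp only [Function.comp]
        rw [show b * (a * Real.log γ + 1) = b + (b * a * Real.log γ) by ring, Real.exp_add,
          show -((1 - b * a) * Real.log γ) = b * a * Real.log γ + -Real.log γ by ring,
          Real.exp_add]
        ring

namespace NetQCD

namespace Model

variable {E : Type*} [MeasurableSpace E] {M : Model E}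

/-- A divergence between probability measures vanishes only when they coincide, and a Bernoulli law
determines its parameter. -/
lemma infoNumber_pos (hr : 0 < M.r) (hr₁ : M.r < M.p₁)
    (hchange : M.f₀ ≠ M.f₁ ∨ M.p₀ ≠ M.p₁) (hsample : M.sampleDiv ≠ ⊤)
    (hchannel : M.channelDiv ≠ ⊤) : 0 < M.infoNumber := by
  have hr' : (0 : ℝ) < M.r := hr
  have hp : (0 : ℝ) < M.p₁ := hr'.trans hr₁
  have h1 : 0 ≤ M.channelDiv.toReal / M.p₁ := by positivity
  have h2 : 0 ≤ M.sampleDiv.toReal := ENNReal.toReal_nonneg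
  refine mul_pos hr' ?_
  rcases hchange with h | h
  · have : 0 < M.sampleDiv.toReal := by
      refine ENNReal.toReal_pos (fun h0 => h ?_) hsample
      exact Subtype.ext (klDiv_eq_zero_iff.1 h0).symm
    linarith
  · have : 0 < M.channelDiv.toReal := by
      refine ENNReal.toReal_pos (fun h0 => h ?_) hchannel
      have h3 := klDiv_eq_zero_iff.1 h0
      have h4 := bernoulli_true M.p₁
      rw [h3, bernoulli_true] at h4
      exact Subtype.ext ((ENNReal.ofReal_eq_ofReal_iff M.p₀.2.1 M.p₁.2.1).1 h4)
    have : 0 < M.channelDiv.toReal / M.p₁ := by positivity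
    linarith

theorem eventually_le_iInf_worstDelay (hr : 0 < M.r) (hr₀ : M.r < M.p₀) (hr₁ : M.r < M.p₁)
    (hπ : M.IsSteadyState) (hchange : M.f₀ ≠ M.f₁ ∨ M.p₀ ≠ M.p₁) (hsample : M.sampleDiv ≠ ⊤)
    (hchannel : M.channelDiv ≠ ⊤)
    {𝓗 : Filtration ℕ (inferInstance : MeasurableSpace (Path E))} (h𝓗 : Observable 𝓗)
    {δ : ℝ} (hδ : 0 < δ) :
    ∀ᶠ γ in atTop, ENNReal.ofReal ((M.infoNumber⁻¹ - δ) * Real.log γ) ≤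
      ⨅ T ∈ M.admissible 𝓗 γ, M.worstDelay 𝓗 T := by
  have hI := infoNumber_pos hr hr₁ hchange hsample hchannel
  set J := M.infoNumber with hJ
  -- Half of `δ` is spent on the window length; the other half pays for the factor `1 - δ / (2 a)`
  -- at the end. If `a ≤ 0` the claim is trivial.
  set a := J⁻¹ - δ / 2 with ha_def
  rcases le_or_gt a 0 with ha | ha
  · filter_upwards [eventually_gt_atTop 1] with γ hγ
    rw [ENNReal.ofReal_of_nonpos (mul_nonpos_of_nonpos_of_nonneg (by linarith)
      (Real.log_pos hγ).le)]
    exact zero_le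
  have hrp : (0 : ℝ) < M.p₀ - M.r := sub_pos.2 hr₀
  have hp₀ : (0 : ℝ) < M.p₀ := lt_trans hr hr₀
  -- Small enough that `η / J` is half of the gain `J δ / 2` in `(J + η) a`.
  set η := J ^ 2 * δ / 4 with hη_def
  have hη : 0 < η := by positivity
  have hba : (J + η) * a < 1 := by
    have h1 : (J + η) * a = 1 - J * δ / 4 - η * δ / 2 := by
      rw [ha_def, hη_def]; field_simp; ring
    have : 0 < J * δ / 4 := by positivity
    have : 0 < η * δ / 2 := by positivity
    linarith
  obtain ⟨e⟩ : Nonempty E := (M.f₀ : Measure E).nonempty_of_neZero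
  let x : ℕ → E := fun _ => e
  let m : ℝ → ℕ := fun γ => ⌈a * Real.log γ⌉₊
  let c : ℕ → ℝ≥0∞ := fun n => ENNReal.ofReal (Real.exp ((J + η) * n))
  -- Makes `p₀ m / ε` equal to `(p₀ - r) γ / 2`, half of what the drift bound allows; for large `γ`
  -- the other half dominates `𝔼[Q₁] + p₀`.
  set K : ℝ := 2 * M.p₀ / (M.p₀ - M.r) with hK
  have hK0 : 0 < K := by positivity
  have hm : Tendsto m atTop atTop :=
    tendsto_nat_ceil_atTop.comp (Real.tendsto_log_atTop.const_mul_atTop ha)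
  have hβ : Tendsto (fun n => ∑ q ∈ Finset.range 3, M.exceedProb x n (c n) q) atTop (𝓝 0) := by
    have h := tendsto_finsetSum (Finset.range 3) fun q _ =>
      tendsto_measure_obsLR_gt hr hr₁ hsample hchannel q x hη
    rw [Finset.sum_const_zero] at h
    exact h
  have hβ' := hβ.comp ((tendsto_sub_atTop_nat 1).comp hm)
  have hcε := ENNReal.tendsto_ofReal (tendsto_exp_ceil_log_div ha (by positivity) hba hK0.le)
  have htot := hcε.add hβ'
  rw [ENNReal.ofReal_zero, add_zero] at htot
  have hτ : 0 < ENNReal.ofReal (δ / (2 * a)) := ENNReal.ofReal_pos.2 (by positivity)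
  set μQ := (∫⁻ q, (q : ℝ≥0∞) ∂(M.π : Measure ℕ)).toReal with hμQ
  have hμQ' : ∫⁻ q, (q : ℝ≥0∞) ∂(M.π : Measure ℕ) = ENNReal.ofReal μQ :=
    (ENNReal.ofReal_toReal (hπ.lintegral_ne_top hr₀)).symm
  filter_upwards [htot.eventually_lt_const hτ, hm.eventually_ge_atTop 1, eventually_gt_atTop 1,
    eventually_gt_atTop (2 * (μQ + M.p₀) / (M.p₀ - M.r))] with γ hγ hm1 hγ1 hγ2
  have hγ0 : 0 < γ := by linarith
  have hlog : 0 < Real.log γ := Real.log_pos hγ1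
  have hmpos : (0 : ℝ) < m γ := by exact_mod_cast hm1
  refine le_iInf₂ fun T hT => ?_
  obtain ⟨n, hn⟩ := Nat.exists_eq_add_of_le' hm1
  have hεpos : 0 < K * m γ / γ := by positivity
  have hmain := le_worstDelay (M := M) h𝓗 hT.1 hsample hchannel hr₀ x n
    (ε := ENNReal.ofReal (K * m γ / γ)) (c := c n) (ENNReal.ofReal_pos.2 hεpos).ne'
    ENNReal.ofReal_ne_top (by
      refine lt_of_lt_of_le ?_ (mul_le_mul_right hT.2 _)
      rw [hμQ', ← hn, ← ENNReal.ofReal_natCast, ← ENNReal.ofReal_div_of_pos hεpos,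
        ← ENNReal.ofReal_one, ← ENNReal.ofReal_add zero_le_one (by positivity),
        ← ENNReal.ofReal_mul hp₀.le, ← ENNReal.ofReal_add ENNReal.toReal_nonneg (by positivity),
        ← ENNReal.ofReal_mul hrp.le, ENNReal.ofReal_lt_ofReal_iff (by positivity)]
      have h1 : (M.p₀ : ℝ) * (1 + m γ / (K * m γ / γ)) = M.p₀ + (M.p₀ - M.r) * γ / 2 := by
        rw [hK]; field_simp
      rw [h1]
      rw [div_lt_iff₀ hrp] at hγ2
      linarith)
  refine le_trans ?_ hmain
  rw [← hn]
  have hsmall : c n * ENNReal.ofReal (K * m γ / γ) +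
      ∑ q ∈ Finset.range 3, M.exceedProb x n (c n) q ≤ ENNReal.ofReal (δ / (2 * a)) := by
    refine le_trans ?_ hγ.le
    have h1 : ((fun n => n - 1) ∘ m) γ = n := by simp [hn]
    simp only [Function.comp] at h1 ⊢
    rw [h1]
    gcongr
    simp only [c]
    rw [← ENNReal.ofReal_mul (Real.exp_nonneg _)]
    refine ENNReal.ofReal_le_ofReal ?_
    have h2 : (n : ℝ) ≤ ⌈a * Real.log γ⌉₊ := by
      have : n ≤ m γ := by omega
      exact_mod_cast this
    gcongr
  calc ENNReal.ofReal ((J⁻¹ - δ) * Real.log γ)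
      = ENNReal.ofReal (a * Real.log γ * (1 - δ / (2 * a))) := by
        congr 1
        rw [show J⁻¹ - δ = a - δ / 2 by rw [ha_def]; ring]
        field_simp
    _ = ENNReal.ofReal (a * Real.log γ) * (1 - ENNReal.ofReal (δ / (2 * a))) := by
        rw [ENNReal.ofReal_mul (by positivity), ENNReal.ofReal_sub _ (by positivity),
          ENNReal.ofReal_one]
    _ ≤ _ := by
        gcongr
        rw [← ENNReal.ofReal_natCast]
        exact ENNReal.ofReal_le_ofReal (Nat.le_ceil _)

end Model

end NetQCD

theorem mainTheorem2 {E : Type*} [MeasurableSpace E] (M : NetQCD.Model E)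
    (hr : 0 < M.r) (hr₀ : M.r < M.p₀) (hr₁ : M.r < M.p₁)
    (hπ : M.IsSteadyState)
    (hchange : M.f₀ ≠ M.f₁ ∨ M.p₀ ≠ M.p₁)
    (hsample : M.sampleDiv ≠ ⊤) (hchannel : M.channelDiv ≠ ⊤) :
    (∀ᵐ ω ∂(M.law 0),
      Tendsto (fun n : ℕ => M.logLR 0 n ω / (n : ℝ)) atTop (𝓝 M.infoNumber)) ∧
    (∃ e : ℝ → ℝ, Tendsto e atTop (𝓝 0) ∧
      ∀ᶠ γ : ℝ in atTop,
        ENNReal.ofReal ((M.infoNumber⁻¹ + e γ) * Real.log γ) ≤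
          ⨅ T ∈ M.admissible (NetQCD.augFiltration E) γ,
            M.worstDelay (NetQCD.augFiltration E) T) ∧
    (∃ e : ℝ → ℝ, Tendsto e atTop (𝓝 0) ∧
      ∀ᶠ γ : ℝ in atTop,
        ENNReal.ofReal ((M.infoNumber⁻¹ + e γ) * Real.log γ) ≤
          ⨅ T ∈ M.admissible (NetQCD.obsFiltration E) γ,
            M.worstDelay (NetQCD.obsFiltration E) T) :=
  ⟨NetQCD.Model.tendsto_logLR hr hr₁ hsample hchannel,
    exists_tendsto_zero_of_forall_le fun _ hδ => NetQCD.Model.eventually_le_iInf_worstDelay hr hr₀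
      hr₁ hπ hchange hsample hchannel (NetQCD.Model.observable_aug E) hδ,
    exists_tendsto_zero_of_forall_le fun _ hδ => NetQCD.Model.eventually_le_iInf_worstDelay hr hr₀
      hr₁ hπ hchange hsample hchannel (NetQCD.Model.observable_obs E) hδ⟩
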